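/- There are an absolute constant $C$, an exponent $c\in\mathbb N$, a function $T:\mathbb R^3\to\mathbb R$ and one deterministic algorithm $P$ (a program for a random access machine on integers with logarithmic cost, i.e. every elementary operation costs the total bit length of the operands, addresses and contents involved) such that the following holds for all real $\delta,\gamma,\lambda>0$. Let $G$ be a $d$-regular graph on $n\ge 2$ vertices, $d\ge1$, with adjacency matrix $A$, and suppose that the second largest eigenvalue (with multiplicity) of $\frac1d A$ is at most $\lambda$. Let $\chi:V(G)\to\{1,2,3\}$ be a $3$-partition of the vertices such that - some set of at most $\delta n$ vertices covers all edges of $G$ with both endpoints in the same part of $\chi$, and - $\max_{a}\frac1n|\chi^{-1}(a)|\le\frac12-\gamma$. Then $P$, given only $n$, the adjacency matrix of $G$ and the integers $\lfloor1/\delta\rfloor,\lceil1/\gamma\rceil,\lfloor1/\lambda\rfloor$ (but not $\chi$), halts within time $T(\delta,\gamma,\lambda)\cdot n^{c}$ and outputs a $(3,\varepsilon)$-coloring of $G$ with $$\varepsilon=C\left(\frac{\lambda}{\gamma^{8}}+\frac{\delta}{\lambda\gamma^{8}}\right),$$ that is, three pairwise disjoint independent sets of $G$ that together contain at least $(1-\varepsilon)n$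 vertices. -/

import Mathlib

/-! ### The machine model: a random access machine with logarithmic cost

The memory consists of banks `0, 1, 2, …`; every bank is an array of integers indexed by the
natural numbers. Programs are finite `while`-programs over integer expressions with indirect
addressing. Every elementary operation is charged the total bit length of the numbers (operands,
addresses and contents) that it handles, so running times agree with those of Turing machines up to
a polynomial. -/

namespace RAM

/-- A memory: `s b i` is the content of cell `i` of bank `b`. -/
abbrev Memory : Type := ℕ → ℕ → ℤ

/-- Integer expressions. `read b i` is the content of the cell of bank `b` whose address is the
value of `i`. -/
inductive Expr : Type
  | lit (z : ℤ) : Expr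
  | read (b : ℕ) (i : Expr) : Expr
  | plus (e₁ e₂ : Expr) : Expr
  | minus (e₁ e₂ : Expr) : Expr
  | times (e₁ e₂ : Expr) : Expr
  | quot (e₁ e₂ : Expr) : Expr

/-- The bit length of an integer. -/
def bits (z : ℤ) : ℕ := Nat.size z.natAbs

/-- The value of an expression in a memory. Negative addresses are read as address `0`. -/
def Expr.value (s : Memory) : Expr → ℤ
  | .lit z => z
  | .read b i => s b (i.value s).toNat
  | .plus e₁ e₂ => e₁.value s + e₂.value s
  | .minus e₁ e₂ => e₁.value s - e₂.value s
  | .times e₁ e₂ => e₁.value s * e₂.value s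
  | .quot e₁ e₂ => e₁.value s / e₂.value s

/-- The (logarithmic) cost of evaluating an expression in a memory. -/
def Expr.cost (s : Memory) : Expr → ℕ
  | .lit z => 1 + bits z
  | .read b i => i.cost s + 1 + bits (i.value s) + bits (s b (i.value s).toNat)
  | .plus e₁ e₂ => e₁.cost s + e₂.cost s + 1 + bits (e₁.value s) + bits (e₂.value s)
  | .minus e₁ e₂ => e₁.cost s + e₂.cost s + 1 + bits (e₁.value s) + bits (e₂.value s)
  | .times e₁ e₂ => e₁.cost s + e₂.cost s + 1 + bits (e₁.value s) + bits (e₂.value s)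
  | .quot e₁ e₂ => e₁.cost s + e₂.cost s + 1 + bits (e₁.value s) + bits (e₂.value s)

/-- Programs. `assign b i e` stores the value of `e` in the cell of bank `b` whose address is the
value of `i`; `cond e p q` runs `p` if the value of `e` is positive and `q` otherwise; `loop e p`
repeats `p` as long as the value of `e` is positive. -/
inductive Program : Type
  | skip : Program
  | assign (b : ℕ) (i e : Expr) : Program
  | seq (p q : Program) : Program
  | cond (e : Expr) (p q : Program) : Program
  | loop (e : Expr) (p : Program) : Program

/-- The memory after writing `z` into cell `i` of bank `b`. -/
def Memory.write (s : Memory) (b i : ℕ) (z : ℤ) : Memory :=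
  Function.update s b (Function.update (s b) i z)

/-- `Runs p s s' t`: started in memory `s`, the program `p` halts in memory `s'` after running
time `t`. -/
inductive Runs : Program → Memory → Memory → ℕ → Prop
  | skip (s : Memory) : Runs .skip s s 1
  | assign (b : ℕ) (i e : Expr) (s : Memory) :
      Runs (.assign b i e) s (s.write b (i.value s).toNat (e.value s))
        (i.cost s + e.cost s + 1 + bits (i.value s) + bits (e.value s))
  | seq {p q : Program} {s s' s'' : Memory} {t t' : ℕ}
      (hp : Runs p s s' t) (hq : Runs q s' s'' t') : Runs (.seq p q) s s'' (t + t')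
  | cond_pos {e : Expr} {p q : Program} {s s' : Memory} {t : ℕ}
      (he : 0 < e.value s) (hp : Runs p s s' t) : Runs (.cond e p q) s s' (e.cost s + 1 + t)
  | cond_neg {e : Expr} {p q : Program} {s s' : Memory} {t : ℕ}
      (he : ¬ 0 < e.value s) (hq : Runs q s s' t) : Runs (.cond e p q) s s' (e.cost s + 1 + t)
  | loop_pos {e : Expr} {p : Program} {s s' s'' : Memory} {t t' : ℕ}
      (he : 0 < e.value s) (hp : Runs p s s' t) (hl : Runs (.loop e p) s' s'' t') :
      Runs (.loop e p) s s'' (e.cost s + 1 + t + t')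
  | loop_neg {e : Expr} {p : Program} {s : Memory}
      (he : ¬ 0 < e.value s) : Runs (.loop e p) s s (e.cost s + 1)

/-- Programs are deterministic: the final memory and the running time are determined by the
program and the initial memory. -/
theorem Runs.deterministic {p : Program} {s s₁ : Memory} {t₁ : ℕ} (h₁ : Runs p s s₁ t₁) :
    ∀ {s₂ : Memory} {t₂ : ℕ}, Runs p s s₂ t₂ → s₁ = s₂ ∧ t₁ = t₂ := by
  induction h₁ with
  | skip s => intro s₂ t₂ h; cases h; exact ⟨rfl, rfl⟩
  | assign b i e s => intro s₂ t₂ h; cases h; exact ⟨rfl, rfl⟩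
  | seq _ _ ihp ihq =>
    intro s₂ t₂ h
    cases h with
    | seq hp hq =>
      obtain ⟨rfl, rfl⟩ := ihp hp
      obtain ⟨rfl, rfl⟩ := ihq hq
      exact ⟨rfl, rfl⟩
  | cond_pos he _ ih =>
    intro s₂ t₂ h
    cases h with
    | cond_pos _ hp => obtain ⟨rfl, rfl⟩ := ih hp; exact ⟨rfl, rfl⟩
    | cond_neg he' _ => exact absurd he he'
  | cond_neg he _ ih =>
    intro s₂ t₂ h
    cases h with
    | cond_pos he' _ => exact absurd he' he
    | cond_neg _ hq => obtain ⟨rfl, rfl⟩ := ih hq; exact ⟨rfl, rfl⟩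
  | loop_pos he _ _ ihp ihl =>
    intro s₂ t₂ h
    cases h with
    | loop_pos _ hp hl =>
      obtain ⟨rfl, rfl⟩ := ihp hp
      obtain ⟨rfl, rfl⟩ := ihl hl
      exact ⟨rfl, rfl⟩
    | loop_neg he' => exact absurd he he'
  | loop_neg he =>
    intro s₂ t₂ h
    cases h with
    | loop_pos he' _ _ => exact absurd he' he
    | loop_neg _ => exact ⟨rfl, rfl⟩

end RAM

/-! ### Graphs, second eigenvalue, partial colorings -/

/-- The normalized adjacency matrix `(1/d) A` of a `d`-regular graph. -/
noncomputable def normalizedAdjMatrix {V : Type*} [Fintype V] (G : SimpleGraph V)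
    [DecidableRel G.Adj] (d : ℕ) : Matrix V V ℝ :=
  (1 / (d : ℝ)) • G.adjMatrix ℝ

theorem normalizedAdjMatrix_isHermitian {V : Type*} [Fintype V] (G : SimpleGraph V)
    [DecidableRel G.Adj] (d : ℕ) : (normalizedAdjMatrix G d).IsHermitian := by
  ext i j
  simp [normalizedAdjMatrix, SimpleGraph.adj_comm]

/-- The second largest eigenvalue (counted with multiplicity) of the normalized adjacency matrix
`(1/d) A`; `eigenvalues₀` lists the eigenvalues in decreasing order, starting at index `0`. -/
noncomputable def secondEigenvalue {V : Type*} [Fintype V] [DecidableEq V] (G : SimpleGraph V)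
    [DecidableRel G.Adj] (d : ℕ) (hV : 2 ≤ Fintype.card V) : ℝ :=
  (normalizedAdjMatrix_isHermitian G d).eigenvalues₀ ⟨1, hV⟩

/-- `S` is a vertex cover of the edges of `G` that are monochromatic under `χ`. -/
def CoversMonochromaticEdges {V : Type*} {k : ℕ} (G : SimpleGraph V) (χ : V → Fin k)
    (S : Finset V) : Prop :=
  ∀ u v : V, G.Adj u v → χ u = χ v → u ∈ S ∨ v ∈ S

/-- A `(k, ε)`-coloring: `k` disjoint independent sets that cover all but at most an `ε` fraction
of the vertices. -/
structure IsPartialColoring {V : Type*} [Fintype V] [DecidableEq V] (G : SimpleGraph V) (k : ℕ)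
    (ε : ℝ) (I : Fin k → Finset V) : Prop where
  disjoint : ∀ a b : Fin k, a ≠ b → Disjoint (I a) (I b)
  independent : ∀ a : Fin k, G.IsIndepSet (I a : Set V)
  covers : (1 - ε) * (Fintype.card V : ℝ) ≤ ((Finset.univ.biUnion I).card : ℝ)

/-! ### Input and output conventions -/

/-- The memory in which the input is presented: bank `0` starts with the number of vertices `n`
and three integer parameters `p q r`, bank `1` holds the adjacency matrix of the graph row by row,
and all other cells are `0`. -/
def graphInput {n : ℕ} (G : SimpleGraph (Fin n)) [DecidableRel G.Adj] (p q r : ℕ) : RAM.Memory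
  | 0, 0 => (n : ℤ)
  | 0, 1 => (p : ℤ)
  | 0, 2 => (q : ℤ)
  | 0, 3 => (r : ℤ)
  | 1, m =>
      if ∃ i j : Fin n, m = (i : ℕ) * n + (j : ℕ) ∧ G.Adj i j then 1 else 0
  | _, _ => 0

/-- The `k` vertex sets written by a program: vertex `x` belongs to the `a`-th set
(`a = 0, …, k - 1`) if cell `x` of bank `2` contains `a + 1`. -/
def outputSets (n k : ℕ) (s : RAM.Memory) (a : Fin k) : Finset (Fin n) :=
  Finset.univ.filter fun x : Fin n => s 2 (x : ℕ) = ((a : ℕ) : ℤ) + 1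

namespace RAM

/-! ### Unit-cost executions with bounded contents -/

/-! Write A for the normalized adjacency matrix. The coloring χ can nearly be read off from a
bounded number of spectral clusters of vertices, so it suffices to try all colorings of the
clusters.

Threshold rank. Only the second largest eigenvalue is controlled, yet few eigenvalues are very
negative (`card_mul_le_one`). If P projects onto the eigenvectors with eigenvalue at most -τ, then
the kernel P(u,v)² / √(P(u,u) P(v,v)) is positive semidefinite, has trace rank P and total sum at
most n. Testing A ≼ J/n + λ against it gives rank P · (τ² - λ) ≤ 1. Hence only O(1/λ) eigenvalues
have a square above a suitable multiple of λ.

Profiles. The vector A 1_{χ=a} records the proportion of neighbors of color a. Up to an error of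
small norm it lies in the span of the few large eigenvectors, hence is Lipschitz in the spectral
metric (`exists_profile`). Typical vertices u, v of different colors have different profiles. Indeed
u has few neighbors of its own color. So has v, and expansion together with the bound on the color
classes prevents almost all neighbors of v from having the third color (`card_pure_mul_le`); so v
has a proportion of order γ of neighbors colored χ u. Thus close vertices outside a small set have
equal colors (`exists_bad_set`).

Clusters. By a trace bound most vertices have bounded norm in the spectral embedding, and a packing
argument (`card_separated_le`) bounds the number K of greedy clusters in terms of γ and λ. Some
coloring of the clusters agrees with χ outside a small set. For each of the 3^K colorings the
program uncolors the ends of a maximal matching of monochromatic edges, which costs at most twice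
the size of a vertex cover, and it keeps the best result.

Computation. Eigenvectors are never computed. A polynomial in A² that separates large from small
eigenvalues is formed by repeated squaring, scaled so that all entries are integers; norms and
distances are then compared exactly. Correctness is proved for step counts with bounded memory
contents (`Exec`, `Does`), and `Exec.runs` converts this to logarithmic cost. For λ ≤ 1/16 the error
obtained is O(λ/γ² + δ/γ), which is below the one claimed; for larger λ the claim is trivial. -/

theorem bits_le_size {z : ℤ} {M : ℕ} (h : z.natAbs ≤ M) : bits z ≤ Nat.size M :=
  Nat.size_le_size h

theorem bits_plus_le (a b : ℤ) : bits (a + b) ≤ bits a + bits b + 1 := by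
  unfold bits
  rw [Nat.size_le]
  have h1 := Nat.lt_size_self a.natAbs
  have h2 := Nat.lt_size_self b.natAbs
  have h3 := Int.natAbs_add_le a b
  have h4 : 2 ^ Nat.size a.natAbs ≤ 2 ^ (Nat.size a.natAbs + Nat.size b.natAbs) :=
    Nat.pow_le_pow_right (by norm_num) (by omega)
  have h5 : 2 ^ Nat.size b.natAbs ≤ 2 ^ (Nat.size a.natAbs + Nat.size b.natAbs) :=
    Nat.pow_le_pow_right (by norm_num) (by omega)
  rw [pow_succ]
  omega

theorem bits_minus_le (a b : ℤ) : bits (a - b) ≤ bits a + bits b + 1 := by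
  have h := bits_plus_le a (-b)
  rwa [← sub_eq_add_neg, show bits (-b) = bits b by simp [bits]] at h

theorem bits_times_le (a b : ℤ) : bits (a * b) ≤ bits a + bits b := by
  unfold bits
  rw [Nat.size_le, Int.natAbs_mul, pow_add]
  exact Nat.mul_lt_mul'' (Nat.lt_size_self _) (Nat.lt_size_self _)

theorem bits_quot_le (a b : ℤ) : bits (a / b) ≤ bits a :=
  Nat.size_le_size (Int.natAbs_ediv_le_natAbs a b)

/-- The bit length of the value of an expression is at most `e.width` times the word length. -/
def Expr.width : Expr → ℕ
  | .lit z => 1 + bits z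
  | .read _ _ => 1
  | .plus e₁ e₂ => e₁.width + e₂.width + 1
  | .minus e₁ e₂ => e₁.width + e₂.width + 1
  | .times e₁ e₂ => e₁.width + e₂.width
  | .quot e₁ _ => e₁.width

/-- The cost of an expression is at most `e.weight` times the word length. -/
def Expr.weight : Expr → ℕ
  | .lit z => 1 + bits z
  | .read _ i => i.weight + 1 + i.width + 1
  | .plus e₁ e₂ => e₁.weight + e₂.weight + 1 + e₁.width + e₂.width
  | .minus e₁ e₂ => e₁.weight + e₂.weight + 1 + e₁.width + e₂.width
  | .times e₁ e₂ => e₁.weight + e₂.weight + 1 + e₁.width + e₂.width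
  | .quot e₁ e₂ => e₁.weight + e₂.weight + 1 + e₁.width + e₂.width

/-- All contents of the memory are at most `M` in absolute value. -/
def Memory.Bounded (M : ℕ) (s : Memory) : Prop := ∀ b i, (s b i).natAbs ≤ M

theorem Expr.bits_value_le {M : ℕ} {s : Memory} (hs : s.Bounded M) (e : Expr) :
    bits (e.value s) ≤ e.width * (Nat.size M + 1) := by
  induction e with
  | lit z => simp only [value, width]; nlinarith [Nat.zero_le (bits z * Nat.size M)]
  | read b i _ => simpa [value, width] using (bits_le_size (hs _ _)).trans (Nat.le_succ _)
  | plus a b iha ihb => simp only [value, width]; have := bits_plus_le (a.value s) (b.value s); nlinarith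
  | minus a b iha ihb =>
    simp only [value, width]; have := bits_minus_le (a.value s) (b.value s); nlinarith
  | times a b iha ihb =>
    simp only [value, width]; have := bits_times_le (a.value s) (b.value s); nlinarith
  | quot a b iha ihb => exact (bits_quot_le _ _).trans iha

theorem Expr.cost_le {M : ℕ} {s : Memory} (hs : s.Bounded M) (e : Expr) :
    e.cost s ≤ e.weight * (Nat.size M + 1) := by
  induction e with
  | lit z => simp only [cost, weight]; nlinarith [Nat.zero_le (bits z * Nat.size M)]
  | read b i ih =>
    simp only [cost, weight]
    have h1 := i.bits_value_le hs
    have h2 := bits_le_size (hs b (i.value s).toNat)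
    nlinarith
  | plus a b iha ihb | minus a b iha ihb | times a b iha ihb | quot a b iha ihb =>
    simp only [cost, weight]
    have h1 := a.bits_value_le hs
    have h2 := b.bits_value_le hs
    nlinarith

/-- The cost of every elementary step of a program is at most `p.weight` times the word length. -/
def Program.weight : Program → ℕ
  | .skip => 1
  | .assign _ i e => i.weight + e.weight + 1 + i.width + e.width
  | .seq p q => p.weight + q.weight
  | .cond e p q => e.weight + 1 + p.weight + q.weight
  | .loop e p => e.weight + 1 + p.weight

/-- The banks that a program may modify. -/
def Program.mods : Program → List ℕ
  | .skip => []
  | .assign b _ _ => [b]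
  | .seq p q => p.mods ++ q.mods
  | .cond _ p q => p.mods ++ q.mods
  | .loop _ p => p.mods

/-- `Exec M p s s' k`: the program `p` leads from `s` to `s'` in `k` steps, and writes only numbers
of absolute value at most `M`. -/
inductive Exec (M : ℕ) : Program → Memory → Memory → ℕ → Prop
  | skip (s : Memory) : Exec M .skip s s 1
  | assign (b : ℕ) (i e : Expr) (s : Memory) (h : (e.value s).natAbs ≤ M) :
      Exec M (.assign b i e) s (s.write b (i.value s).toNat (e.value s)) 1
  | seq {p q : Program} {s s' s'' : Memory} {k k' : ℕ}
      (hp : Exec M p s s' k) (hq : Exec M q s' s'' k') : Exec M (.seq p q) s s'' (k + k')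
  | cond_pos {e : Expr} {p q : Program} {s s' : Memory} {k : ℕ}
      (he : 0 < e.value s) (hp : Exec M p s s' k) : Exec M (.cond e p q) s s' (k + 1)
  | cond_neg {e : Expr} {p q : Program} {s s' : Memory} {k : ℕ}
      (he : ¬ 0 < e.value s) (hq : Exec M q s s' k) : Exec M (.cond e p q) s s' (k + 1)
  | loop_pos {e : Expr} {p : Program} {s s' s'' : Memory} {k k' : ℕ}
      (he : 0 < e.value s) (hp : Exec M p s s' k) (hl : Exec M (.loop e p) s' s'' k') :
      Exec M (.loop e p) s s'' (k + 1 + k')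
  | loop_neg {e : Expr} {p : Program} {s : Memory}
      (he : ¬ 0 < e.value s) : Exec M (.loop e p) s s 1

theorem Memory.write_of_ne (s : Memory) {b b' : ℕ} (h : b' ≠ b) (i : ℕ) (z : ℤ) :
    s.write b i z b' = s b' := by
  simp [Memory.write, h]

theorem Memory.write_self (s : Memory) (b i : ℕ) (z : ℤ) :
    s.write b i z b = Function.update (s b) i z := by
  simp [Memory.write]

theorem Memory.write_cell (s : Memory) (b i : ℕ) (z : ℤ) : s.write b i z b i = z := by
  simp [Memory.write]

theorem Memory.Bounded.write {M : ℕ} {s : Memory} (hs : s.Bounded M) {z : ℤ} (hz : z.natAbs ≤ M)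
    (b i : ℕ) : (s.write b i z).Bounded M := by
  intro b' i'
  by_cases hb : b' = b
  · subst hb
    rw [Memory.write_self]
    by_cases hi : i' = i
    · subst hi; simpa using hz
    · rw [Function.update_of_ne hi]; exact hs _ _
  · rw [Memory.write_of_ne _ hb]; exact hs _ _

/-- Each step evaluates fixed expressions in a memory whose cells have at most `Nat.size M` bits, so
its logarithmic cost is at most the weight of the program times `Nat.size M + 1`. Bounds on step
counts and contents therefore suffice for the running time. -/
theorem Exec.runs {M : ℕ} {p : Program} {s s' : Memory} {k : ℕ} (h : Exec M p s s' k)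
    (hs : s.Bounded M) :
    s'.Bounded M ∧ ∃ t, Runs p s s' t ∧ t ≤ k * (p.weight * (Nat.size M + 1)) := by
  induction h with
  | skip s => exact ⟨hs, 1, .skip s, by simp [Program.weight]⟩
  | assign b i e s h =>
    refine ⟨hs.write h _ _, _, .assign b i e s, ?_⟩
    have h1 := i.bits_value_le hs
    have h2 := e.bits_value_le hs
    have h3 := i.cost_le hs
    have h4 := e.cost_le hs
    simp only [Program.weight]
    nlinarith
  | @seq p q s s' s'' k k' _ _ ihp ihq =>
    obtain ⟨hs', t, ht, htk⟩ := ihp hs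
    obtain ⟨hs'', t', ht', htk'⟩ := ihq hs'
    refine ⟨hs'', _, .seq ht ht', ?_⟩
    have e1 : k * (p.weight * (Nat.size M + 1)) ≤
        k * ((p.weight + q.weight) * (Nat.size M + 1)) := by gcongr; omega
    have e2 : k' * (q.weight * (Nat.size M + 1)) ≤
        k' * ((p.weight + q.weight) * (Nat.size M + 1)) := by gcongr; omega
    simp only [Program.weight]
    rw [add_mul]
    omega
  | @cond_pos e p q s s' k he _ ih =>
    obtain ⟨hs', t, ht, htk⟩ := ih hs
    refine ⟨hs', _, .cond_pos he ht, ?_⟩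
    have e1 : k * (p.weight * (Nat.size M + 1)) ≤
        k * ((e.weight + 1 + p.weight + q.weight) * (Nat.size M + 1)) := by gcongr; omega
    have h4 := e.cost_le hs
    simp only [Program.weight]
    nlinarith
  | @cond_neg e p q s s' k he _ ih =>
    obtain ⟨hs', t, ht, htk⟩ := ih hs
    refine ⟨hs', _, .cond_neg he ht, ?_⟩
    have e1 : k * (q.weight * (Nat.size M + 1)) ≤
        k * ((e.weight + 1 + p.weight + q.weight) * (Nat.size M + 1)) := by gcongr; omega
    have h4 := e.cost_le hs
    simp only [Program.weight]
    nlinarith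
  | @loop_pos e p s s' s'' k k' he _ _ ihp ihl =>
    obtain ⟨hs', t, ht, htk⟩ := ihp hs
    obtain ⟨hs'', t', ht', htk'⟩ := ihl hs'
    refine ⟨hs'', _, .loop_pos he ht ht', ?_⟩
    have e1 : k * (p.weight * (Nat.size M + 1)) ≤
        k * ((e.weight + 1 + p.weight) * (Nat.size M + 1)) := by gcongr; omega
    have h4 := e.cost_le hs
    simp only [Program.weight] at htk' ⊢
    nlinarith
  | @loop_neg e p s he =>
    refine ⟨hs, _, .loop_neg he, ?_⟩
    have h4 := e.cost_le hs
    simp only [Program.weight]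
    nlinarith

/-- Every scalar and every array lives in its own bank, so this syntactic frame rule replaces all
reasoning about aliasing. -/
theorem Exec.frame {M : ℕ} {p : Program} {s s' : Memory} {k : ℕ} (h : Exec M p s s' k) :
    ∀ b, b ∉ p.mods → s' b = s b := by
  induction h with
  | skip s => intro b _; rfl
  | assign b i e s h =>
    intro b' hb
    exact Memory.write_of_ne _ (by simpa [Program.mods] using hb) _ _
  | seq _ _ ihp ihq =>
    intro b hb
    simp only [Program.mods, List.mem_append, not_or] at hb
    rw [ihq b hb.2, ihp b hb.1]
  | cond_pos he _ ih =>
    intro b hb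
    simp only [Program.mods, List.mem_append, not_or] at hb
    exact ih b hb.1
  | cond_neg he _ ih =>
    intro b hb
    simp only [Program.mods, List.mem_append, not_or] at hb
    exact ih b hb.2
  | loop_pos he _ _ ihp ihl =>
    intro b hb
    rw [ihl b hb, ihp b hb]
  | loop_neg he => intro b _; rfl

/-- Total correctness: started in `s`, the program `p` halts after at most `k` steps in a memory that
satisfies `Q`, and writes only numbers of absolute value at most `M`. -/
def Does (M : ℕ) (p : Program) (s : Memory) (k : ℕ) (Q : Memory → Prop) : Prop :=
  ∃ s' k', Exec M p s s' k' ∧ k' ≤ k ∧ Q s'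

section Does

variable {M : ℕ} {p q : Program} {s : Memory} {k k' : ℕ} {Q R : Memory → Prop}

theorem Does.mono (h : Does M p s k Q) (hk : k ≤ k') (hQ : ∀ s', Q s' → R s') :
    Does M p s k' R := by
  obtain ⟨s', l, h1, h2, h3⟩ := h
  exact ⟨s', l, h1, h2.trans hk, hQ _ h3⟩

theorem Does.frame (h : Does M p s k Q) :
    Does M p s k fun s' => Q s' ∧ ∀ b, b ∉ p.mods → s' b = s b := by
  obtain ⟨s', l, h1, h2, h3⟩ := h
  exact ⟨s', l, h1, h2, h3, h1.frame⟩

theorem Does.skip (h : Q s) : Does M .skip s 1 Q := ⟨s, 1, .skip s, le_rfl, h⟩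

theorem Does.assign {b : ℕ} {i e : Expr} (h : (e.value s).natAbs ≤ M)
    (hQ : Q (s.write b (i.value s).toNat (e.value s))) : Does M (.assign b i e) s 1 Q :=
  ⟨_, 1, .assign b i e s h, le_rfl, hQ⟩

theorem Does.seq (h : Does M p s k fun s' => Does M q s' k' Q) : Does M (.seq p q) s (k + k') Q := by
  obtain ⟨s', l, h1, h2, s'', l', h3, h4, h5⟩ := h
  exact ⟨s'', l + l', .seq h1 h3, by omega, h5⟩

theorem Does.cond {e : Expr} (hp : 0 < e.value s → Does M p s k Q)
    (hq : ¬ 0 < e.value s → Does M q s k Q) : Does M (.cond e p q) s (k + 1) Q := by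
  by_cases he : 0 < e.value s
  · obtain ⟨s', l, h1, h2, h3⟩ := hp he
    exact ⟨s', l + 1, .cond_pos he h1, by omega, h3⟩
  · obtain ⟨s', l, h1, h2, h3⟩ := hq he
    exact ⟨s', l + 1, .cond_neg he h1, by omega, h3⟩

/-- The invariant is indexed by the number of completed iterations. The body must also show that
this index is below `J`, which is the termination argument; `J` may be a crude bound. -/
theorem Does.loop {e : Expr} (J : ℕ) (Inv : ℕ → Memory → Prop)
    (hbody : ∀ j s, Inv j s → 0 < e.value s → j < J ∧ Does M p s k (Inv (j + 1)))
    (h0 : Inv 0 s) :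
    Does M (.loop e p) s (J * (k + 1) + 1) fun s' => ∃ j, j ≤ J ∧ Inv j s' ∧ ¬ 0 < e.value s' := by
  suffices H : ∀ m j s, j + m = J → Inv j s → Does M (.loop e p) s (m * (k + 1) + 1)
      fun s' => ∃ j, j ≤ J ∧ Inv j s' ∧ ¬ 0 < e.value s' from H J 0 s (by omega) h0
  intro m
  induction m with
  | zero =>
    intro j s hj hI
    have he : ¬ 0 < e.value s := fun he => by have := (hbody j s hI he).1; omega
    exact ⟨s, 1, .loop_neg he, by omega, j, by omega, hI, he⟩
  | succ m ih =>
    intro j s hj hI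
    by_cases he : 0 < e.value s
    · obtain ⟨-, s', l, h1, h2, h3⟩ := hbody j s hI he
      obtain ⟨s'', l', h4, h5, h6⟩ := ih (j + 1) s' (by omega) h3
      refine ⟨s'', _, .loop_pos he h1 h4, ?_, h6⟩
      rw [Nat.succ_mul]
      omega
    · exact ⟨s, 1, .loop_neg he, by omega, j, by omega, hI, he⟩

end Does

/-! ### Counted loops, array filling and summation -/

/-- The scalar variable stored in cell `0` of bank `b`. -/
abbrev var (b : ℕ) : Expr := .read b (.lit 0)

/-- Assignment to the scalar variable stored in cell `0` of bank `b`. -/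
abbrev setVar (b : ℕ) (e : Expr) : Program := .assign b (.lit 0) e

/-- The loop `for c = 0, …, N - 1 do p`. -/
def forLoop (c : ℕ) (N : Expr) (p : Program) : Program :=
  .seq (setVar c (.lit 0)) (.loop (.minus N (var c)) (.seq p (setVar c (.plus (var c) (.lit 1)))))

theorem mods_forLoop (c : ℕ) (N : Expr) (p : Program) :
    (forLoop c N p).mods = c :: (p.mods ++ [c]) := rfl

theorem Does.setVar {M b : ℕ} {e : Expr} {s : Memory} {Q : Memory → Prop}
    (h : (e.value s).natAbs ≤ M) (hQ : Q (s.write b 0 (e.value s))) :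
    Does M (RAM.setVar b e) s 1 Q :=
  Does.assign h hQ

/-- The bound `N` is evaluated anew in each round, so `hN` covers every memory that differs from the
start only in banks the loop may modify. `hstable` lets the invariant survive the increment of the
counter. -/
theorem Does.forLoop {M c : ℕ} {N : Expr} {p : Program} {s₀ : Memory} {n k : ℕ}
    (Inv : ℕ → Memory → Prop) (hc : c ∉ p.mods) (hn : n ≤ M)
    (hN : ∀ s : Memory, (∀ b, b ≠ c → b ∉ p.mods → s b = s₀ b) → N.value s = n)
    (hstable : ∀ j s s', (∀ b, b ≠ c → s' b = s b) → Inv j s → Inv j s')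
    (h0 : Inv 0 s₀)
    (hbody : ∀ j, j < n → ∀ s : Memory, s c 0 = j → (∀ b, b ≠ c → b ∉ p.mods → s b = s₀ b) →
      Inv j s → Does M p s k (Inv (j + 1))) :
    Does M (RAM.forLoop c N p) s₀ (n * (k + 2) + 2) (Inv n) := by
  have key : Does M (RAM.forLoop c N p) s₀ (1 + (n * (k + 1 + 1) + 1)) (Inv n) := by
    refine Does.seq (Does.setVar (by simp [Expr.value]) ?_)
    refine (Does.loop (k := k + 1) n (fun j s => j ≤ n ∧ s c 0 = j ∧
      (∀ b, b ≠ c → b ∉ p.mods → s b = s₀ b) ∧ Inv j s) ?_ ?_).mono le_rfl ?_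
    · rintro j s ⟨hj, hsc, hfr, hI⟩ he
      have hjn : j < n := by
        have : (0 : ℤ) < n - j := by simpa [Expr.value, hN s hfr, hsc] using he
        omega
      refine ⟨hjn, Does.seq ((hbody j hjn s hsc hfr hI).frame.mono le_rfl ?_)⟩
      rintro s' ⟨hI', hfr'⟩
      have hsc' : s' c 0 = j := by rw [hfr' c hc, hsc]
      refine Does.setVar ?_ ⟨hjn, ?_, ?_, ?_⟩
      · simp only [Expr.value, Int.toNat_zero, hsc']; omega
      · rw [Memory.write_cell]; simp [Expr.value, hsc']
      · intro b hb hb'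
        rw [Memory.write_of_ne _ hb, hfr' b hb', hfr b hb hb']
      · exact hstable _ _ _ (fun b hb => Memory.write_of_ne _ hb _ _) hI'
    · refine ⟨Nat.zero_le _, ?_, ?_, ?_⟩
      · rw [Memory.write_cell]; simp [Expr.value]
      · intro b hb _; rw [Memory.write_of_ne _ hb]
      · exact hstable _ _ _ (fun b hb => Memory.write_of_ne _ hb _ _) h0
    · rintro s' ⟨j, hj, ⟨-, hsc, hfr, hI⟩, he⟩
      have : ¬ ((0 : ℤ) < n - j) := by simpa [Expr.value, hN s' hfr, hsc] using he
      obtain rfl : j = n := by omega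
      exact hI
  exact key.mono (by ring_nf; omega) fun _ h => h

/-- Fill the first `N` cells of bank `b` with the values of `e`, where `c` counts the cells. -/
def fill (b c : ℕ) (N e : Expr) : Program := forLoop c N (.assign b (var c) e)

theorem Does.fill {M b c : ℕ} {N e : Expr} {s₀ : Memory} {n : ℕ} (val : ℕ → ℤ)
    (hbc : b ≠ c) (hn : n ≤ M)
    (hN : ∀ s : Memory, (∀ b', b' ≠ c → b' ≠ b → s b' = s₀ b') → N.value s = n)
    (he : ∀ j, j < n → ∀ s : Memory, s c 0 = j → (∀ b', b' ≠ c → b' ≠ b → s b' = s₀ b') →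
      e.value s = val j ∧ (val j).natAbs ≤ M) :
    Does M (RAM.fill b c N e) s₀ (n * 3 + 2) fun s' => ∀ i, i < n → s' b i = val i := by
  refine Does.forLoop (k := 1) (fun j s => ∀ i, i < j → s b i = val i) (by simpa [Program.mods] using hbc.symm)
    hn (by simpa [Program.mods] using hN) ?_ (by simp) ?_
  · intro j s s' h hI i hi
    rw [h b hbc, hI i hi]
  · intro j hj s hsc hfr hI
    obtain ⟨h1, h2⟩ := he j hj s hsc (by simpa [Program.mods] using hfr)
    refine Does.assign (by rwa [h1]) ?_
    intro i hi
    rw [Memory.write_self, h1]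
    simp only [Expr.value, Int.toNat_zero, hsc, Int.toNat_natCast]
    by_cases hij : i = j
    · subst hij; simp
    · rw [Function.update_of_ne hij]; exact hI i (by omega)

/-- Store the sum of the values of `e` over `c = 0, …, N - 1` in cell `0` of bank `a`. -/
def accumulate (a c : ℕ) (N e : Expr) : Program :=
  .seq (setVar a (.lit 0)) (forLoop c N (setVar a (.plus (var a) e)))

/-- All partial sums need the bound `M`, because each of them is stored. -/
theorem Does.accumulate {M a c : ℕ} {N e : Expr} {s₀ : Memory} {n : ℕ} (val : ℕ → ℤ)
    (hac : a ≠ c) (hn : n ≤ M)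
    (hN : ∀ s : Memory, (∀ b, b ≠ c → b ≠ a → s b = s₀ b) → N.value s = n)
    (hM : ∀ j, j ≤ n → (∑ i ∈ Finset.range j, val i).natAbs ≤ M)
    (he : ∀ j, j < n → ∀ s : Memory, s c 0 = j → (∀ b, b ≠ c → b ≠ a → s b = s₀ b) →
      e.value s = val j) :
    Does M (RAM.accumulate a c N e) s₀ (n * 3 + 3)
      fun s' => s' a 0 = ∑ i ∈ Finset.range n, val i := by
  refine Does.mono (k := 1 + (n * 3 + 2)) ?_ (by omega) fun _ h => h
  refine Does.seq (Does.setVar (by simp [Expr.value]) ?_)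
  refine Does.forLoop (k := 1) (fun j s => s a 0 = ∑ i ∈ Finset.range j, val i)
    (by simpa [Program.mods] using hac.symm) hn ?_ ?_ ?_ ?_
  · intro s hs
    refine hN s fun b hb hb' => ?_
    rw [hs b hb (by simpa [Program.mods] using hb'), Memory.write_of_ne _ hb']
  · intro j s s' h hI
    rw [h a hac, hI]
  · rw [Memory.write_cell]; simp [Expr.value]
  · intro j hj s hsc hfr hI
    have h1 := he j hj s hsc (fun b hb hb' => by
      rw [hfr b hb (by simpa [Program.mods] using hb'), Memory.write_of_ne _ hb'])
    have h2 : (Expr.plus (var a) e).value s = ∑ i ∈ Finset.range (j + 1), val i := by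
      simp [Expr.value, h1, hI, Finset.sum_range_succ]
    refine Does.setVar (by rw [h2]; exact hM _ hj) ?_
    rw [Memory.write_cell, h2]

end RAM

/-! ### Spectral theory of one-sided expanders -/

/-- `μ` and `ψ` are the eigenvalues and an orthonormal basis of eigenvectors of the symmetric
matrix `M`. -/
structure IsEigensystem {V : Type*} [Fintype V] [DecidableEq V] (M : V → V → ℝ) (μ : V → ℝ)
    (ψ : V → V → ℝ) : Prop where
  orthonormal : ∀ i j, ∑ v, ψ i v * ψ j v = if i = j then 1 else 0
  complete : ∀ u v, ∑ i, ψ i u * ψ i v = if u = v then 1 else 0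
  expansion : ∀ u v, M u v = ∑ i, μ i * (ψ i u * ψ i v)

theorem Matrix.IsHermitian.exists_isEigensystem {V : Type*} [Fintype V] [DecidableEq V]
    {M : Matrix V V ℝ} (hM : M.IsHermitian) :
    IsEigensystem M hM.eigenvalues fun i v => hM.eigenvectorUnitary v i := by
  have h1 : (star (hM.eigenvectorUnitary : Matrix V V ℝ)) * hM.eigenvectorUnitary = 1 :=
    Unitary.coe_star_mul_self _
  have h2 : (hM.eigenvectorUnitary : Matrix V V ℝ) * star (hM.eigenvectorUnitary : Matrix V V ℝ)
      = 1 := Unitary.coe_mul_star_self _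
  refine ⟨fun i j => ?_, fun u v => ?_, fun u v => ?_⟩
  · have := congrFun (congrFun h1 i) j
    simpa [Matrix.mul_apply, Matrix.star_apply, Matrix.one_apply] using this
  · have := congrFun (congrFun h2 u) v
    simpa [Matrix.mul_apply, Matrix.star_apply, Matrix.one_apply] using this
  · have h := congrFun (congrFun hM.spectral_theorem u) v
    rw [Unitary.conjStarAlgAut_apply, Matrix.mul_apply] at h
    rw [h]
    refine Finset.sum_congr rfl fun i _ => ?_
    rw [Matrix.mul_diagonal]
    simp [Matrix.star_apply]
    ring

/-- A symmetric stochastic matrix. -/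
structure IsSymmStochastic {V : Type*} [Fintype V] (M : V → V → ℝ) : Prop where
  nonneg : ∀ u v, 0 ≤ M u v
  symm : ∀ u v, M u v = M v u
  row_sum : ∀ u, ∑ v, M u v = 1

namespace IsSymmStochastic

variable {V : Type*} [Fintype V] {M : V → V → ℝ}

theorem sum_mul_left (hM : IsSymmStochastic M) (f : V → ℝ) :
    ∑ u, ∑ v, M u v * f u = ∑ u, f u := by
  refine Finset.sum_congr rfl fun u _ => ?_
  rw [← Finset.sum_mul, hM.row_sum, one_mul]

theorem sum_mul_right (hM : IsSymmStochastic M) (f : V → ℝ) :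
    ∑ u, ∑ v, M u v * f v = ∑ u, f u := by
  rw [Finset.sum_comm, ← hM.sum_mul_left f]
  simp_rw [hM.symm]

/-- The quadratic form of a stochastic matrix is a contraction. -/
theorem quadratic_le (hM : IsSymmStochastic M) (f : V → ℝ) :
    ∑ u, ∑ v, M u v * (f u * f v) ≤ ∑ u, f u ^ 2 := by
  have h : ∑ u, ∑ v, M u v * (f u * f v) ≤
      ∑ u, ∑ v, (M u v * (f u ^ 2 / 2) + M u v * (f v ^ 2 / 2)) := by
    gcongr with u _ v _
    nlinarith [hM.nonneg u v, mul_nonneg (hM.nonneg u v) (sq_nonneg (f u - f v))]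
  refine h.trans_eq ?_
  simp_rw [Finset.sum_add_distrib]
  rw [hM.sum_mul_left fun u => f u ^ 2 / 2, hM.sum_mul_right fun u => f u ^ 2 / 2,
    ← Finset.sum_add_distrib]
  exact Finset.sum_congr rfl fun u _ => by ring

theorem neg_quadratic_le (hM : IsSymmStochastic M) (f : V → ℝ) :
    -∑ u, ∑ v, M u v * (f u * f v) ≤ ∑ u, f u ^ 2 := by
  have h : ∑ u, ∑ v, -(M u v * (f u * f v)) ≤
      ∑ u, ∑ v, (M u v * (f u ^ 2 / 2) + M u v * (f v ^ 2 / 2)) := by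
    gcongr with u _ v _
    nlinarith [hM.nonneg u v, mul_nonneg (hM.nonneg u v) (sq_nonneg (f u + f v))]
  simp_rw [Finset.sum_neg_distrib] at h
  refine h.trans_eq ?_
  simp_rw [Finset.sum_add_distrib]
  rw [hM.sum_mul_left fun u => f u ^ 2 / 2, hM.sum_mul_right fun u => f u ^ 2 / 2,
    ← Finset.sum_add_distrib]
  exact Finset.sum_congr rfl fun u _ => by ring

end IsSymmStochastic

namespace IsEigensystem

variable {V : Type*} [Fintype V] [DecidableEq V] {M : V → V → ℝ} {μ : V → ℝ} {ψ : V → V → ℝ}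

theorem mulVec (h : IsEigensystem M μ ψ) (i u : V) : ∑ v, M u v * ψ i v = μ i * ψ i u := by
  simp_rw [h.expansion, Finset.sum_mul]
  rw [Finset.sum_comm]
  have : ∀ j, ∑ v, μ j * (ψ j u * ψ j v) * ψ i v = if j = i then μ i * ψ i u else 0 := by
    intro j
    have h1 : ∑ v, μ j * (ψ j u * ψ j v) * ψ i v = μ j * ψ j u * ∑ v, ψ j v * ψ i v := by
      rw [Finset.mul_sum]; exact Finset.sum_congr rfl fun v _ => by ring
    rw [h1, h.orthonormal]
    split_ifs with hij
    · subst hij; ring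
    · ring
  simp [this]

/-- The coefficients of a vector in the eigenbasis. -/
def coeff (ψ : V → V → ℝ) (f : V → ℝ) (i : V) : ℝ := ∑ v, ψ i v * f v

theorem sum_coeff_mul_coeff (h : IsEigensystem M μ ψ) (f g : V → ℝ) :
    ∑ i, coeff ψ f i * coeff ψ g i = ∑ v, f v * g v := by
  simp_rw [coeff, Finset.sum_mul_sum]
  rw [Finset.sum_comm]
  refine Finset.sum_congr rfl fun u _ => ?_
  rw [Finset.sum_comm]
  have : ∀ v, ∑ i, ψ i u * f u * (ψ i v * g v) = if u = v then f u * g v else 0 := by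
    intro v
    have h1 : ∑ i, ψ i u * f u * (ψ i v * g v) = (f u * g v) * ∑ i, ψ i u * ψ i v := by
      rw [Finset.mul_sum]; exact Finset.sum_congr rfl fun v _ => by ring
    rw [h1, h.complete]
    split_ifs <;> ring
  simp [this]

theorem sum_coeff_sq (h : IsEigensystem M μ ψ) (f : V → ℝ) :
    ∑ i, coeff ψ f i ^ 2 = ∑ v, f v ^ 2 := by
  simpa [sq] using h.sum_coeff_mul_coeff f f

theorem mulVec_eq (h : IsEigensystem M μ ψ) (f : V → ℝ) (u : V) :
    ∑ v, M u v * f v = ∑ i, μ i * coeff ψ f i * ψ i u := by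
  simp_rw [h.expansion, Finset.sum_mul, coeff, Finset.mul_sum, Finset.sum_mul]
  rw [Finset.sum_comm]
  exact Finset.sum_congr rfl fun i _ => Finset.sum_congr rfl fun v _ => by ring

theorem quadratic_eq (h : IsEigensystem M μ ψ) (f : V → ℝ) :
    ∑ u, ∑ v, M u v * (f u * f v) = ∑ i, μ i * coeff ψ f i ^ 2 := by
  have h1 : ∀ u, ∑ v, M u v * (f u * f v) = ∑ i, μ i * coeff ψ f i * (ψ i u * f u) := by
    intro u
    have : ∑ v, M u v * (f u * f v) = f u * ∑ v, M u v * f v := by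
      rw [Finset.mul_sum]; exact Finset.sum_congr rfl fun v _ => by ring
    rw [this, h.mulVec_eq, Finset.mul_sum]
    exact Finset.sum_congr rfl fun v _ => by ring
  simp_rw [h1]
  rw [Finset.sum_comm]
  refine Finset.sum_congr rfl fun i _ => ?_
  rw [← Finset.mul_sum, coeff]
  ring

theorem quadratic_eigenvector (h : IsEigensystem M μ ψ) (i : V) :
    ∑ u, ∑ v, M u v * (ψ i u * ψ i v) = μ i := by
  have h1 : ∀ u, ∑ v, M u v * (ψ i u * ψ i v) = μ i * (ψ i u * ψ i u) := by
    intro u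
    have : ∑ v, M u v * (ψ i u * ψ i v) = ψ i u * ∑ v, M u v * ψ i v := by
      rw [Finset.mul_sum]; exact Finset.sum_congr rfl fun v _ => by ring
    rw [this, h.mulVec]; ring
  simp_rw [h1]
  rw [← Finset.mul_sum, h.orthonormal]
  simp

theorem sum_sq_eigenvector (h : IsEigensystem M μ ψ) (i : V) : ∑ v, ψ i v ^ 2 = 1 := by
  simpa [sq] using h.orthonormal i i

theorem sq_eigenvalue_le_one (h : IsEigensystem M μ ψ) (hM : IsSymmStochastic M) (i : V) :
    μ i ^ 2 ≤ 1 := by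
  have h1 := hM.quadratic_le (ψ i)
  have h2 := hM.neg_quadratic_le (ψ i)
  rw [h.quadratic_eigenvector, h.sum_sq_eigenvector] at h1 h2
  nlinarith

/-- If all eigenvalues but one are at most `lam`, then `M ≼ J / n + lam`. -/
theorem quadratic_le_of_eigenvalue_le (h : IsEigensystem M μ ψ) (hM : IsSymmStochastic M)
    {lam : ℝ} (h0 : 0 ≤ lam) (h1 : lam < 1) {i₀ : V} (hμ : ∀ i, i ≠ i₀ → μ i ≤ lam) (f : V → ℝ) :
    ∑ u, ∑ v, M u v * (f u * f v) ≤
      (∑ v, f v) ^ 2 / Fintype.card V + lam * ∑ v, f v ^ 2 := by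
  -- M fixes the all-ones vector, which is therefore orthogonal to every eigenvector whose
  -- eigenvalue differs from 1. So it is a multiple of `ψ i₀`, and J/n is the projection onto `ψ
  -- i₀`.
  have he : ∀ i, i ≠ i₀ → coeff ψ 1 i = 0 := by
    intro i hi
    have e1 : ∑ u, ∑ v, M u v * ψ i v = coeff ψ 1 i := by
      rw [hM.sum_mul_right (ψ i)]; simp [coeff]
    have e2 : ∑ u, ∑ v, M u v * ψ i v = μ i * coeff ψ 1 i := by
      simp_rw [h.mulVec, ← Finset.mul_sum]; simp [coeff]
    have e3 : (1 - μ i) * coeff ψ 1 i = 0 := by linarith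
    rcases mul_eq_zero.1 e3 with h4 | h4
    · linarith [hμ i hi]
    · exact h4
  have e1 : coeff ψ 1 i₀ ^ 2 = Fintype.card V := by
    have := h.sum_coeff_sq 1
    rw [Finset.sum_eq_single i₀ (fun i _ hi => by simp [he i hi]) (by simp)] at this
    simpa using this
  have e2 : ∑ v, f v = coeff ψ f i₀ * coeff ψ 1 i₀ := by
    have := h.sum_coeff_mul_coeff f 1
    rw [Finset.sum_eq_single i₀ (fun i _ hi => by simp [he i hi]) (by simp)] at this
    simpa using this.symm
  have hn : (0 : ℝ) < Fintype.card V := by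
    have : Nonempty V := ⟨i₀⟩
    exact_mod_cast Fintype.card_pos
  rw [e2, mul_pow, e1, mul_div_cancel_right₀ _ hn.ne', h.quadratic_eq, ← h.sum_coeff_sq f,
    Finset.mul_sum]
  have h3 : ∀ i ∈ Finset.univ, μ i * coeff ψ f i ^ 2 ≤
      (if i = i₀ then coeff ψ f i₀ ^ 2 else 0) + lam * coeff ψ f i ^ 2 := by
    intro i _
    split_ifs with hi
    · subst hi
      have := h.sq_eigenvalue_le_one hM i
      have h5 : μ i ≤ 1 := by nlinarith
      nlinarith [mul_nonneg h0 (sq_nonneg (coeff ψ f i)), sq_nonneg (coeff ψ f i)]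
    · have := mul_le_mul_of_nonneg_right (hμ i hi) (sq_nonneg (coeff ψ f i))
      linarith
  refine (Finset.sum_le_sum h3).trans_eq ?_
  rw [Finset.sum_add_distrib]
  simp

/-! ### Few very negative eigenvalues -/

section Count

/-- The projection onto the span of the eigenvectors with indices in `S`. -/
def proj (ψ : V → V → ℝ) (S : Finset V) (u v : V) : ℝ := ∑ i ∈ S, ψ i u * ψ i v

theorem proj_self (S : Finset V) (u : V) : proj ψ S u u = ∑ i ∈ S, ψ i u ^ 2 := by
  simp [proj, sq]

theorem proj_self_nonneg (S : Finset V) (u : V) : 0 ≤ proj ψ S u u := by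
  rw [proj_self]; positivity

theorem proj_eq_zero {S : Finset V} {u : V} (hu : proj ψ S u u = 0) (v : V) :
    proj ψ S u v = 0 ∧ proj ψ S v u = 0 := by
  rw [proj_self, Finset.sum_eq_zero_iff_of_nonneg fun _ _ => sq_nonneg _] at hu
  constructor <;>
  · refine Finset.sum_eq_zero fun i hi => ?_
    simp [pow_eq_zero_iff two_ne_zero |>.1 (hu i hi)]

theorem sum_proj_self (h : IsEigensystem M μ ψ) (S : Finset V) :
    ∑ u, proj ψ S u u = S.card := by
  simp_rw [proj_self]
  rw [Finset.sum_comm]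
  simp [h.sum_sq_eigenvector]

theorem sum_proj_sq (h : IsEigensystem M μ ψ) (S : Finset V) (u : V) :
    ∑ v, proj ψ S u v ^ 2 = proj ψ S u u := by
  simp_rw [proj, sq, Finset.sum_mul_sum]
  rw [Finset.sum_comm]
  refine Finset.sum_congr rfl fun i hi => ?_
  rw [Finset.sum_comm]
  have : ∀ j ∈ S, ∑ v, ψ i u * ψ i v * (ψ j u * ψ j v) = if i = j then ψ i u * ψ i u else 0 := by
    intro j _
    have h1 : ∑ v, ψ i u * ψ i v * (ψ j u * ψ j v) = ψ i u * ψ j u * ∑ v, ψ i v * ψ j v := by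
      rw [Finset.mul_sum]; exact Finset.sum_congr rfl fun v _ => by ring
    rw [h1, h.orthonormal]
    split_ifs with hij
    · subst hij; ring
    · ring
  rw [Finset.sum_congr rfl this]
  simp [hi]

theorem sum_mul_proj (h : IsEigensystem M μ ψ) (S : Finset V) :
    ∑ u, ∑ v, M u v * proj ψ S u v = ∑ i ∈ S, μ i := by
  simp_rw [proj, Finset.mul_sum]
  have : ∀ u, ∑ v, ∑ i ∈ S, M u v * (ψ i u * ψ i v) = ∑ i ∈ S, ∑ v, M u v * (ψ i u * ψ i v) :=
    fun u => Finset.sum_comm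
  simp_rw [this]
  rw [Finset.sum_comm]
  exact Finset.sum_congr rfl fun i _ => h.quadratic_eigenvector i

/-- If `M ≼ J / n + lam` then `M` has at most `1 / (τ² - lam)` eigenvalues below `-τ`. -/
theorem card_mul_le_one (h : IsEigensystem M μ ψ) (hM : IsSymmStochastic M) {lam τ : ℝ}
    (hquad : ∀ f : V → ℝ, ∑ u, ∑ v, M u v * (f u * f v) ≤
      (∑ v, f v) ^ 2 / Fintype.card V + lam * ∑ v, f v ^ 2)
    (hτ : 0 ≤ τ) {S : Finset V} (hS : ∀ i ∈ S, μ i ≤ -τ) :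
    (S.card : ℝ) * (τ ^ 2 - lam) ≤ 1 := by
  set P := proj ψ S with hP
  set N : V → ℝ := fun u => √(P u u) with hN
  have hNsq : ∀ u, N u ^ 2 = P u u := fun u => Real.sq_sqrt (proj_self_nonneg S u)
  have hN0 : ∀ u, 0 ≤ N u := fun u => Real.sqrt_nonneg _
  have hPz : ∀ u v, N u * N v = 0 → P u v = 0 := by
    intro u v huv
    rcases mul_eq_zero.1 huv with h1 | h1
    · exact (proj_eq_zero (by rw [← hP, ← hNsq, h1]; simp) v).1
    · exact (proj_eq_zero (by rw [← hP, ← hNsq, h1]; simp) u).2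
  -- The kernel `X` is the sum of the rank-one kernels given by the vectors `w i j`, so `hquad` can
  -- be applied to each of them and summed. The convention 0⁻¹ = 0 is harmless: where `N` vanishes,
  -- so do the row and column of `P`.
  set w : V → V → V → ℝ := fun i j u => ψ i u * ψ j u * (N u)⁻¹ with hw
  set X : V → V → ℝ := fun u v => P u v ^ 2 * ((N u)⁻¹ * (N v)⁻¹) with hX
  have hXw : ∀ u v, X u v = ∑ i ∈ S, ∑ j ∈ S, w i j u * w i j v := by
    intro u v
    simp only [hX, hw, hP, proj, sq]
    rw [Finset.sum_mul_sum, Finset.sum_mul]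
    refine Finset.sum_congr rfl fun i _ => ?_
    rw [Finset.sum_mul]
    exact Finset.sum_congr rfl fun j _ => by ring
  have hswap : ∀ F : V → V → V → V → ℝ, ∑ u, ∑ v, ∑ i ∈ S, ∑ j ∈ S, F u v i j =
      ∑ i ∈ S, ∑ j ∈ S, ∑ u, ∑ v, F u v i j := by
    intro F
    calc ∑ u, ∑ v, ∑ i ∈ S, ∑ j ∈ S, F u v i j
        = ∑ u, ∑ i ∈ S, ∑ v, ∑ j ∈ S, F u v i j :=
          Finset.sum_congr rfl fun u _ => Finset.sum_comm
      _ = ∑ i ∈ S, ∑ u, ∑ v, ∑ j ∈ S, F u v i j := Finset.sum_comm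
      _ = ∑ i ∈ S, ∑ u, ∑ j ∈ S, ∑ v, F u v i j :=
          Finset.sum_congr rfl fun i _ => Finset.sum_congr rfl fun u _ => Finset.sum_comm
      _ = _ := Finset.sum_congr rfl fun i _ => Finset.sum_comm
  have hMX : ∑ u, ∑ v, M u v * X u v ≤
      (∑ u, ∑ v, X u v) / Fintype.card V + lam * ∑ u, X u u := by
    have e1 : ∑ u, ∑ v, M u v * X u v =
        ∑ i ∈ S, ∑ j ∈ S, ∑ u, ∑ v, M u v * (w i j u * w i j v) := by
      simp_rw [hXw, Finset.mul_sum]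
      exact hswap _
    have e2 : ∑ u, ∑ v, X u v = ∑ i ∈ S, ∑ j ∈ S, (∑ v, w i j v) ^ 2 := by
      simp_rw [hXw]
      rw [hswap]
      simp_rw [sq, Finset.sum_mul_sum]
    have e3 : ∑ u, X u u = ∑ i ∈ S, ∑ j ∈ S, ∑ v, w i j v ^ 2 := by
      simp_rw [hXw, ← sq]
      rw [Finset.sum_comm]
      exact Finset.sum_congr rfl fun i _ => Finset.sum_comm
    rw [e1, e2, e3, Finset.mul_sum, Finset.sum_div, ← Finset.sum_add_distrib]
    refine Finset.sum_le_sum fun i _ => ?_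
    rw [Finset.mul_sum, Finset.sum_div, ← Finset.sum_add_distrib]
    exact Finset.sum_le_sum fun j _ => hquad _
  have hXdiag : ∑ u, X u u = S.card := by
    rw [← h.sum_proj_self S]
    refine Finset.sum_congr rfl fun u _ => ?_
    simp only [hX]
    by_cases hu : N u = 0
    · have := hPz u u (by simp [hu]); rw [this]; simp [← hP, this]
    · rw [← hP, ← hNsq u]; field_simp
  -- By AM-GM, 1/(N u N v) is at most the mean of 1/N(u)² and 1/N(v)², and the row sums of P² are
  -- P(u,u) = N(u)²; so each half contributes at most n/2.
  have hXall : ∑ u, ∑ v, X u v ≤ Fintype.card V := by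
    have h1 : ∑ u, ∑ v, X u v ≤
        ∑ u, ∑ v, (P u v ^ 2 * ((N u)⁻¹ ^ 2 / 2) + P v u ^ 2 * ((N v)⁻¹ ^ 2 / 2)) := by
      gcongr with u _ v _
      have : P v u = P u v := by simp only [hP, proj, mul_comm]
      rw [this]
      simp only [hX]
      nlinarith [mul_nonneg (sq_nonneg (P u v)) (sq_nonneg ((N u)⁻¹ - (N v)⁻¹))]
    have h2 : ∑ u, ∑ v, P u v ^ 2 * ((N u)⁻¹ ^ 2 / 2) ≤ (Fintype.card V : ℝ) / 2 := by
      have : ∀ u ∈ Finset.univ, ∑ v, P u v ^ 2 * ((N u)⁻¹ ^ 2 / 2) ≤ (1 : ℝ) / 2 := by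
        intro u _
        rw [← Finset.sum_mul, h.sum_proj_sq, ← hP, ← hNsq]
        by_cases hu : N u = 0
        · simp [hu]
        · field_simp; rfl
      refine (Finset.sum_le_sum this).trans_eq ?_
      simp [div_eq_mul_inv]
    refine h1.trans ?_
    simp_rw [Finset.sum_add_distrib]
    have h3 : ∑ u, ∑ v, P v u ^ 2 * ((N v)⁻¹ ^ 2 / 2) = ∑ u, ∑ v, P u v ^ 2 * ((N u)⁻¹ ^ 2 / 2) :=
      Finset.sum_comm
    rw [h3]
    linarith
  -- Completing the square, P²/(N u N v) + 2τP + τ² N u N v ≥ 0. Weighting by M, where ∑ M P is the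
  -- sum of the eigenvalues in S and the quadratic form of M at N is at most |S|, gives 2τ²|S| ≤ ∑ M
  -- X + τ²|S|.
  have hlow : τ ^ 2 * S.card ≤ ∑ u, ∑ v, M u v * X u v := by
    have h1 : ∑ u, ∑ v, M u v * (-(2 * τ) * P u v) ≤
        ∑ u, ∑ v, (M u v * X u v + τ ^ 2 * (M u v * (N u * N v))) := by
      gcongr with u _ v _
      have : -(2 * τ) * P u v ≤ X u v + τ ^ 2 * (N u * N v) := by
        by_cases huv : N u * N v = 0
        · simp [hX, hPz u v huv, huv]
        · have hpos : 0 < N u * N v :=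
            lt_of_le_of_ne (mul_nonneg (hN0 u) (hN0 v)) (Ne.symm huv)
          simp only [hX]
          rw [← mul_inv, ← div_eq_mul_inv, ← sub_nonneg]
          have : P u v ^ 2 / (N u * N v) + τ ^ 2 * (N u * N v) - -(2 * τ) * P u v =
              (P u v + τ * (N u * N v)) ^ 2 / (N u * N v) := by
            generalize N u * N v = x at huv
            field_simp
            ring
          rw [this]; positivity
      nlinarith [hM.nonneg u v]
    have h2 : ∑ u, ∑ v, M u v * (-(2 * τ) * P u v) = -(2 * τ) * ∑ i ∈ S, μ i := by
      rw [← h.sum_mul_proj S, Finset.mul_sum]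
      refine Finset.sum_congr rfl fun u _ => ?_
      rw [Finset.mul_sum]
      exact Finset.sum_congr rfl fun v _ => by rw [← hP]; ring
    have h3 := hM.quadratic_le N
    have h4 : ∑ u, N u ^ 2 = S.card := by simp_rw [hNsq]; exact h.sum_proj_self S
    have h6 : ∑ u, ∑ v, (M u v * X u v + τ ^ 2 * (M u v * (N u * N v))) =
        ∑ u, ∑ v, M u v * X u v + τ ^ 2 * ∑ u, ∑ v, M u v * (N u * N v) := by
      simp_rw [Finset.sum_add_distrib, Finset.mul_sum]
    have h5 : ∑ i ∈ S, μ i ≤ -τ * S.card := by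
      refine (Finset.sum_le_sum hS).trans_eq ?_
      simp; ring
    rw [h2, h6] at h1
    rw [h4] at h3
    nlinarith [mul_le_mul_of_nonneg_left h3 (sq_nonneg τ), mul_le_mul_of_nonneg_left h5 hτ]
  have hn : (∑ u, ∑ v, X u v) / Fintype.card V ≤ 1 := div_le_one_of_le₀ hXall (Nat.cast_nonneg _)
  rw [hXdiag] at hMX
  linarith

end Count

end IsEigensystem

/-! ### Spectral filters -/

/-- One step of the filter: `1 - u²`. -/
def filterStep (u : ℝ) : ℝ := 1 - u ^ 2

theorem filterStep_mem {u : ℝ} (h0 : 0 ≤ u) (h1 : u ≤ 1) : 0 ≤ filterStep u ∧ filterStep u ≤ 1 := by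
  unfold filterStep
  constructor <;> nlinarith

/-- Two steps of the filter, iterated `m` times. -/
def filterIter (m : ℕ) (u : ℝ) : ℝ := (filterStep ∘ filterStep)^[m] u

theorem filterIter_succ (m : ℕ) (u : ℝ) :
    filterIter (m + 1) u = filterStep (filterStep (filterIter m u)) := by
  simp only [filterIter, Function.iterate_succ_apply', Function.comp_apply]

theorem filterIter_mem {u : ℝ} (h0 : 0 ≤ u) (h1 : u ≤ 1) (m : ℕ) :
    0 ≤ filterIter m u ∧ filterIter m u ≤ 1 := by
  induction m with
  | zero => exact ⟨h0, h1⟩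
  | succ m ih =>
    rw [filterIter_succ]
    have := filterStep_mem ih.1 ih.2
    exact filterStep_mem this.1 this.2

/-- The map 1 - u² has the repelling fixed point (√5 - 1)/2 < 5/8, so its second iterate maps [5/8,
1] into itself. -/
theorem filterIter_large {u : ℝ} (h0 : 5 / 8 ≤ u) (h1 : u ≤ 1) (m : ℕ) :
    5 / 8 ≤ filterIter m u := by
  have key : ∀ x : ℝ, 5 / 8 ≤ x → x ≤ 1 → 5 / 8 ≤ filterStep (filterStep x) := by
    intro x hx hx'
    unfold filterStep
    have h3 : 25 / 64 ≤ x ^ 2 := by nlinarith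
    have h4 : x ^ 2 ≤ 1 := by nlinarith
    nlinarith
  induction m with
  | zero => exact h0
  | succ m ih =>
    rw [filterIter_succ]
    exact key _ ih (filterIter_mem (by linarith) h1 m).2

/-- Since 1 - (1 - u²)² ≤ 2u², a double step at most squares the quantity 2u; hence the doubly
exponential decay. -/
theorem filterIter_small {u : ℝ} (h0 : 0 ≤ u) (h1 : u ≤ 1 / 4) (m : ℕ) :
    2 * filterIter m u ≤ (1 / 2) ^ 2 ^ m := by
  induction m with
  | zero => simp [filterIter]; linarith
  | succ m ih =>
    have hm := filterIter_mem h0 (by linarith) m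
    rw [filterIter_succ, pow_succ 2 m, pow_mul]
    refine le_trans ?_ (pow_le_pow_left₀ (by linarith) ih 2)
    unfold filterStep
    nlinarith [sq_nonneg (filterIter m u ^ 2)]

/-- The filter, which maps small squares of eigenvalues almost to `0` and large ones to constants. -/
def specFilter (q m : ℕ) (x : ℝ) : ℝ := filterIter m (filterStep ((1 - x) ^ q))

theorem specFilter_mem {x : ℝ} (h0 : 0 ≤ x) (h1 : x ≤ 1) (q m : ℕ) :
    0 ≤ specFilter q m x ∧ specFilter q m x ≤ 1 := by
  have := filterStep_mem (pow_nonneg (sub_nonneg.2 h1) q)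
    (pow_le_one₀ (sub_nonneg.2 h1) (by linarith))
  exact filterIter_mem this.1 this.2 m

/-- Bernoulli's inequality gives (1 - x)^q (1 + qx) ≤ (1 - x²)^q ≤ 1, so (1 - x)^q ≤ 1/3 and the
iteration starts at 8/9 or above. -/
theorem specFilter_large {x : ℝ} (h0 : 0 ≤ x) (h1 : x ≤ 1) {q : ℕ} (hx : 2 ≤ q * x) (m : ℕ) :
    5 / 8 ≤ specFilter q m x := by
  have h2 := filterStep_mem (pow_nonneg (sub_nonneg.2 h1) q)
    (pow_le_one₀ (sub_nonneg.2 h1) (by linarith))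
  refine filterIter_large ?_ h2.2 m
  have h3 : (1 - x) ^ q * (1 + q * x) ≤ 1 := by
    have h4 : 1 + q * x ≤ (1 + x) ^ q := one_add_mul_le_pow (by linarith) q
    calc (1 - x) ^ q * (1 + q * x) ≤ (1 - x) ^ q * (1 + x) ^ q := by
          gcongr
      _ = (1 - x ^ 2) ^ q := by rw [← mul_pow]; ring
      _ ≤ 1 := pow_le_one₀ (by nlinarith) (by nlinarith)
  have h5 : 0 ≤ (1 - x) ^ q := pow_nonneg (by linarith) q
  have h6 : (1 - x) ^ q ≤ 1 / 3 := by nlinarith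
  unfold filterStep
  nlinarith

/-- Bernoulli's inequality gives (1 - x)^q ≥ 7/8, so the iteration starts at 15/64 < 1/4 or below.
-/
theorem specFilter_small {x : ℝ} (h0 : 0 ≤ x) (h1 : x ≤ 1) {q : ℕ} (hx : 8 * (q * x) ≤ 1) (m : ℕ) :
    2 * specFilter q m x ≤ (1 / 2) ^ 2 ^ m := by
  have h2 := filterStep_mem (pow_nonneg (sub_nonneg.2 h1) q)
    (pow_le_one₀ (sub_nonneg.2 h1) (by linarith))
  refine filterIter_small h2.1 ?_ m
  have h4 : 1 + q * (-x) ≤ (1 + -x) ^ q := one_add_mul_le_pow (by linarith) q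
  rw [← sub_eq_add_neg] at h4
  have h6 : 7 / 8 ≤ (1 - x) ^ q := by linarith
  unfold filterStep
  nlinarith

/-! ### Spectral kernels -/

section Kernel

variable {V : Type*} [Fintype V]

/-- The symmetric matrix with eigenvalues `F` and eigenvectors `ψ`. -/
def specKernel (ψ : V → V → ℝ) (F : V → ℝ) (u v : V) : ℝ := ∑ i, F i * (ψ i u * ψ i v)

/-- The squared distance of two vertices in the metric of a spectral kernel. -/
def specDist (ψ : V → V → ℝ) (F : V → ℝ) (u v : V) : ℝ := ∑ i, F i * (ψ i u - ψ i v) ^ 2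

theorem specDist_eq (ψ : V → V → ℝ) (F : V → ℝ) (u v : V) : specDist ψ F u v =
    specKernel ψ F u u + specKernel ψ F v v - 2 * specKernel ψ F u v := by
  simp only [specDist, specKernel, Finset.mul_sum]
  rw [← Finset.sum_add_distrib, ← Finset.sum_sub_distrib]
  exact Finset.sum_congr rfl fun i _ => by ring

theorem specDist_comm (ψ : V → V → ℝ) (F : V → ℝ) (u v : V) :
    specDist ψ F u v = specDist ψ F v u :=
  Finset.sum_congr rfl fun i _ => by ring

/-- Squared distances satisfy the triangle inequality only up to the factor 2, by (a + b)² ≤ 2a² +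
2b². -/
theorem specDist_le (ψ : V → V → ℝ) {F : V → ℝ} (hF : ∀ i, 0 ≤ F i) (u v w : V) :
    specDist ψ F u w ≤ 2 * specDist ψ F u v + 2 * specDist ψ F v w := by
  simp only [specDist, Finset.mul_sum]
  rw [← Finset.sum_add_distrib]
  gcongr with i _
  nlinarith [mul_nonneg (hF i) (sq_nonneg (ψ i u - ψ i v - (ψ i v - ψ i w)))]

end Kernel

namespace IsEigensystem

variable {V : Type*} [Fintype V] [DecidableEq V] {M : V → V → ℝ} {μ : V → ℝ} {ψ : V → V → ℝ}

/-- Functional calculus: products of kernels multiply the eigenvalue functions, so squaring matrices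
in the program evaluates polynomials at the eigenvalues. -/
theorem specKernel_mul (h : IsEigensystem M μ ψ) (F H : V → ℝ) (u v : V) :
    ∑ w, specKernel ψ F u w * specKernel ψ H w v = specKernel ψ (fun i => F i * H i) u v := by
  simp_rw [specKernel, Finset.sum_mul_sum]
  rw [Finset.sum_comm]
  refine Finset.sum_congr rfl fun i _ => ?_
  rw [Finset.sum_comm]
  have : ∀ j, ∑ w, F i * (ψ i u * ψ i w) * (H j * (ψ j w * ψ j v)) =
      if i = j then F i * H i * (ψ i u * ψ i v) else 0 := by
    intro j
    have h1 : ∑ w, F i * (ψ i u * ψ i w) * (H j * (ψ j w * ψ j v)) =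
        F i * ψ i u * H j * ψ j v * ∑ w, ψ i w * ψ j w := by
      rw [Finset.mul_sum]; exact Finset.sum_congr rfl fun v _ => by ring
    rw [h1, h.orthonormal]
    split_ifs with hij
    · subst hij; ring
    · ring
  simp [this]

theorem specKernel_one (h : IsEigensystem M μ ψ) (u v : V) :
    specKernel ψ (fun _ => 1) u v = if u = v then 1 else 0 := by
  simp [specKernel, h.complete]

theorem abs_specKernel_le_one (h : IsEigensystem M μ ψ) {F : V → ℝ} (hF : ∀ i, |F i| ≤ 1)
    (u v : V) : |specKernel ψ F u v| ≤ 1 := by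
  have h1 : ∀ w, ∑ i, ψ i w ^ 2 = 1 := fun w => by simpa [sq] using h.complete w w
  calc |specKernel ψ F u v| ≤ ∑ i, |F i * (ψ i u * ψ i v)| := Finset.abs_sum_le_sum_abs _ _
    _ ≤ ∑ i, (ψ i u ^ 2 / 2 + ψ i v ^ 2 / 2) := by
        gcongr with i _
        rw [abs_mul, abs_mul]
        have := mul_le_mul_of_nonneg_right (hF i) (mul_nonneg (abs_nonneg (ψ i u)) (abs_nonneg (ψ i v)))
        nlinarith [sq_nonneg (|ψ i u| - |ψ i v|), sq_abs (ψ i u), sq_abs (ψ i v)]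
    _ = 1 := by
        rw [Finset.sum_add_distrib, ← Finset.sum_div, ← Finset.sum_div, h1, h1]; norm_num

theorem sum_specKernel_self (h : IsEigensystem M μ ψ) (F : V → ℝ) :
    ∑ v, specKernel ψ F v v = ∑ i, F i := by
  simp_rw [specKernel]
  rw [Finset.sum_comm]
  refine Finset.sum_congr rfl fun i _ => ?_
  rw [← Finset.mul_sum, h.orthonormal]
  simp

/-- Up to a small error, `M f` is Lipschitz in the metric of a spectral kernel. -/
theorem exists_profile (h : IsEigensystem M μ ψ) {F : V → ℝ} {σ : ℝ} (hσ : 0 ≤ σ)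
    (hF0 : ∀ i, 0 ≤ F i) (hF : ∀ i, 5 / 8 ≤ F i ∨ μ i ^ 2 ≤ σ) (hμ : ∀ i, μ i ^ 2 ≤ 1) (f : V → ℝ) :
    ∃ z : V → ℝ, ∑ v, z v ^ 2 ≤ σ * ∑ v, f v ^ 2 ∧ ∀ u v,
      ((∑ w, M u w * f w - z u) - (∑ w, M v w * f w - z v)) ^ 2 ≤
        8 / 5 * (∑ w, f w ^ 2) * specDist ψ F u v := by
  classical
  -- The eigencomponents of M f are split at the filter threshold: those in `a` have μ² ≤ σ and form
  -- the error z, those in `b` survive the filter.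
  set c := coeff ψ f with hc
  set a : V → ℝ := fun i => if 5 / 8 ≤ F i then 0 else μ i * c i with ha
  set b : V → ℝ := fun i => if 5 / 8 ≤ F i then μ i * c i else 0 with hb
  refine ⟨fun v => ∑ i, a i * ψ i v, ?_, fun u v => ?_⟩
  · have h1 : ∑ v, (∑ i, a i * ψ i v) ^ 2 = ∑ i, a i ^ 2 := by
      have h2 : ∀ v, (∑ i, a i * ψ i v) ^ 2 = ∑ i, ∑ j, a i * a j * (ψ i v * ψ j v) := by
        intro v
        rw [sq, Finset.sum_mul_sum]
        exact Finset.sum_congr rfl fun i _ => Finset.sum_congr rfl fun j _ => by ring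
      simp_rw [h2]
      rw [Finset.sum_comm]
      refine Finset.sum_congr rfl fun i _ => ?_
      rw [Finset.sum_comm]
      simp_rw [← Finset.mul_sum, h.orthonormal]
      simp [sq]
    rw [h1, ← h.sum_coeff_sq f, Finset.mul_sum]
    gcongr with i _
    simp only [ha]
    split_ifs with hi
    · simp only [ne_eq, OfNat.ofNat_ne_zero, not_false_eq_true, zero_pow]; positivity
    · rw [mul_pow]
      exact mul_le_mul_of_nonneg_right ((hF i).resolve_left hi) (sq_nonneg _)
  · have h1 : ∀ u, ∑ w, M u w * f w - ∑ i, a i * ψ i u = ∑ i, b i * ψ i u := by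
      intro u
      rw [h.mulVec_eq, ← Finset.sum_sub_distrib]
      refine Finset.sum_congr rfl fun i _ => ?_
      simp only [ha, hb, hc]
      split_ifs <;> ring
    simp only [h1]
    rw [← Finset.sum_sub_distrib]
    -- The weights √F prepare for Cauchy-Schwarz: one factor becomes the spectral distance, and in
    -- the other b²/F is at most 8/5 times the squared coefficient of f, because F ≥ 5/8 wherever b
    -- is nonzero.
    have h2 : ∀ i, b i * ψ i u - b i * ψ i v = (b i / √(F i)) * (√(F i) * (ψ i u - ψ i v)) := by
      intro i
      simp only [hb]
      split_ifs with hi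
      · have : √(F i) ≠ 0 := (Real.sqrt_pos.2 (by linarith)).ne'
        field_simp
      · simp
    simp_rw [h2]
    refine (Finset.sum_mul_sq_le_sq_mul_sq _ _ _).trans ?_
    have h3 : ∑ i, (√(F i) * (ψ i u - ψ i v)) ^ 2 = specDist ψ F u v := by
      refine Finset.sum_congr rfl fun i _ => ?_
      rw [mul_pow, Real.sq_sqrt (hF0 i)]
    rw [h3]
    refine mul_le_mul_of_nonneg_right ?_
      (Finset.sum_nonneg fun i _ => mul_nonneg (hF0 i) (sq_nonneg _))
    rw [← h.sum_coeff_sq f, Finset.mul_sum]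
    gcongr with i _
    rw [div_pow, Real.sq_sqrt (hF0 i)]
    simp only [hb]
    split_ifs with hi
    · rw [div_le_iff₀ (by linarith), mul_pow]
      have h4 : 1 ≤ 8 / 5 * F i := by linarith
      have h5 : μ i ^ 2 * c i ^ 2 ≤ c i ^ 2 := mul_le_of_le_one_left (sq_nonneg _) (hμ i)
      have h6 := mul_le_mul_of_nonneg_right h4 (sq_nonneg (c i))
      rw [← hc]
      linarith
    · simp only [ne_eq, OfNat.ofNat_ne_zero, not_false_eq_true, zero_pow, zero_div]; positivity

/-- Points of bounded norm that are separated in the metric of a kernel of small rank are few. -/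
theorem card_separated_le (h : IsEigensystem M μ ψ) {F : V → ℝ} (hF0 : ∀ i, 0 ≤ F i)
    {T B : Finset V} {ε κ : ℝ} {R s k : ℕ}
    (hsep : ∀ u ∈ T, ∀ v ∈ T, u ≠ v → 2 * κ < Fintype.card V * specDist ψ F u v)
    (hnorm : ∀ v ∈ T, Fintype.card V * specKernel ψ F v v ≤ (R : ℝ) ^ 2)
    (hε : 0 ≤ ε) (hB : ∀ i, i ∉ B → F i ≤ ε) (hκ : Fintype.card V * (2 * ε) ≤ κ)
    (hk : B.card ≤ k) (hs : 0 < s) (hks : (k : ℝ) ≤ κ * s ^ 2) :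
    T.card ≤ (2 * s * R + 1) ^ k := by
  classical
  set n : ℝ := ((Fintype.card V : ℕ) : ℝ) with hn
  have hn0 : 0 ≤ n := Nat.cast_nonneg _
  set y : V → V → ℝ := fun v i => √(n * F i) * ψ i v with hy
  have hy2 : ∀ v i, y v i ^ 2 = n * (F i * ψ i v ^ 2) := by
    intro v i
    simp only [hy]
    rw [mul_pow, Real.sq_sqrt (mul_nonneg hn0 (hF0 i))]
    ring
  have hs' : (0 : ℝ) < s := by exact_mod_cast hs
  have hybd : ∀ v ∈ T, ∀ i, |y v i| ≤ R := by
    intro v hv i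
    refine abs_le_of_sq_le_sq ?_ (Nat.cast_nonneg _)
    refine le_trans ?_ (hnorm v hv)
    rw [hy2, specKernel]
    refine mul_le_mul_of_nonneg_left ?_ hn0
    refine le_trans ?_ (Finset.single_le_sum (f := fun i => F i * (ψ i v * ψ i v))
      (fun j _ => mul_nonneg (hF0 j) (mul_self_nonneg _)) (Finset.mem_univ i))
    rw [sq]
  have hle : T.card ≤ (Fintype.piFinset fun _ : {i // i ∈ B} =>
      Finset.Icc (-(s * R : ℤ)) (s * R)).card := by
    -- Packing: scale the embedding by `s` and round down the coordinates in `B`. Separated points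
    -- end up in different cells, and the cells are counted.
    refine Finset.card_le_card_of_injOn (fun v i => ⌊s * y v i⌋) ?_ ?_
    · intro v hv
      rw [Finset.mem_coe, Fintype.mem_piFinset]
      intro i
      have h1 := abs_le.1 (hybd v hv i)
      rw [Finset.mem_Icc]
      constructor
      · rw [Int.le_floor]; push_cast; nlinarith
      · have : (⌊s * y v i⌋ : ℝ) ≤ ((s * R : ℤ) : ℝ) := by
          push_cast
          exact (Int.floor_le _).trans (mul_le_mul_of_nonneg_left h1.2 hs'.le)
        exact_mod_cast this
    · intro u hu v hv huv
      by_contra hne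
      have h1 := hsep u hu v hv hne
      have h2 : ∀ i ∈ B, n * (F i * (ψ i u - ψ i v) ^ 2) ≤ 1 / (s : ℝ) ^ 2 := by
        intro i hi
        have h3 : ⌊s * y u i⌋ = ⌊s * y v i⌋ := congrFun huv ⟨i, hi⟩
        have h4 := Int.abs_sub_lt_one_of_floor_eq_floor h3
        rw [← mul_sub, abs_mul, abs_of_pos hs'] at h4
        have h5 : n * (F i * (ψ i u - ψ i v) ^ 2) = |y u i - y v i| ^ 2 := by
          rw [sq_abs]
          simp only [hy]
          rw [← mul_sub, mul_pow, Real.sq_sqrt (mul_nonneg hn0 (hF0 i))]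
          ring
        rw [h5, le_div_iff₀ (by positivity)]
        have := abs_nonneg (y u i - y v i)
        nlinarith [mul_nonneg hs'.le this]
      have h3 : ∀ i ∈ Bᶜ, n * (F i * (ψ i u - ψ i v) ^ 2) ≤ n * (ε * (ψ i u - ψ i v) ^ 2) := by
        intro i hi
        have := hB i (Finset.mem_compl.1 hi)
        gcongr
      -- Two points in one cell would be too close: the coordinates in `B` contribute at most k/s² ≤
      -- κ, the others at most 2nε ≤ κ, since the unweighted squared distance of two distinct
      -- vertices is exactly 2.
      have h4 : n * specDist ψ F u v ≤ B.card * (1 / (s : ℝ) ^ 2) + n * (ε * 2) := by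
        rw [specDist, Finset.mul_sum, ← Finset.sum_add_sum_compl B]
        refine add_le_add ((Finset.sum_le_sum h2).trans_eq (by simp)) ?_
        refine (Finset.sum_le_sum h3).trans ?_
        rw [← Finset.mul_sum, ← Finset.mul_sum]
        have h5 : ∑ i ∈ Bᶜ, (ψ i u - ψ i v) ^ 2 ≤ ∑ i, (ψ i u - ψ i v) ^ 2 :=
          Finset.sum_le_sum_of_subset_of_nonneg (Finset.subset_univ _) fun _ _ _ => sq_nonneg _
        have h6 : ∑ i, (ψ i u - ψ i v) ^ 2 = 2 := by
          have := specDist_eq ψ (fun _ => 1) u v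
          rw [h.specKernel_one, h.specKernel_one, h.specKernel_one] at this
          simpa [specDist, hne, one_add_one_eq_two] using this
        rw [h6] at h5
        gcongr
      have h5 : (B.card : ℝ) * (1 / (s : ℝ) ^ 2) ≤ κ := by
        rw [mul_one_div, div_le_iff₀ (by positivity)]
        exact le_trans (by exact_mod_cast hk) hks
      linarith
  refine hle.trans ?_
  rw [Fintype.card_piFinset]
  simp only [Int.card_Icc, Finset.prod_const, Finset.card_univ, Fintype.card_coe]
  have : (s * R + 1 - -(s * R : ℤ)).toNat = 2 * s * R + 1 := by
    have : (s * R + 1 - -(s * R : ℤ)) = ((2 * s * R + 1 : ℕ) : ℤ) := by push_cast; ring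
    rw [this, Int.toNat_natCast]
  rw [this]
  exact Nat.pow_le_pow_right (by omega) hk

set_option maxHeartbeats 800000 in
/-- In a one-sided expander, few vertices have almost all their neighbors in a set `B` of less than
half of the vertices. -/
theorem card_pure_mul_le [Nonempty V] (hM : IsSymmStochastic M) {lam γ : ℝ} (hlam : 0 ≤ lam)
    (hquad : ∀ f : V → ℝ, ∑ u, ∑ v, M u v * (f u * f v) ≤
      (∑ v, f v) ^ 2 / Fintype.card V + lam * ∑ v, f v ^ 2) (hγ : 0 < γ)
    {B W : Finset V} (hB : (B.card : ℝ) ≤ (1 / 2 - γ) * Fintype.card V)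
    (hW : ∀ v ∈ W, 1 - γ / 2 ≤ ∑ w ∈ B, M v w) :
    γ * W.card ≤ 6 * lam * Fintype.card V := by
  set n : ℝ := ((Fintype.card V : ℕ) : ℝ) with hn
  have hn0 : 0 < n := by exact Nat.cast_pos.2 Fintype.card_pos
  set a : V → ℝ := fun v => if v ∈ W then 1 else 0 with ha
  set c : V → ℝ := fun v => if v ∈ B then 1 else 0 with hc
  set w : ℝ := ((W.card : ℕ) : ℝ) with hw
  set β : ℝ := ((B.card : ℕ) : ℝ) with hβ
  have ha1 : ∑ v, a v = w := by simp [ha, hw]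
  have hc1 : ∑ v, c v = β := by simp [hc, hβ]
  set z : ℝ := n - β with hz
  have hβ0 : 0 ≤ β := Nat.cast_nonneg _
  have hw0 : 0 ≤ w := Nat.cast_nonneg _
  have hwn : w ≤ n := by simp only [hw, hn]; exact_mod_cast W.card_le_univ
  have hz2 : n / 2 ≤ z := by nlinarith
  have hz0 : 0 < z := by linarith
  -- This choice gives the test vector 1_W - t·1_{Bᶜ} sum zero, so the term with J/n disappears from
  -- `hquad`.
  set t : ℝ := w / z with ht
  have htz : t * z = w := div_mul_cancel₀ _ hz0.ne'
  have ht0 : 0 ≤ t := by positivity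
  have hq := hquad fun v => a v - t * (1 - c v)
  have e1 : ∑ v, (a v - t * (1 - c v)) = 0 := by
    rw [Finset.sum_sub_distrib, ← Finset.mul_sum, Finset.sum_sub_distrib, ha1, hc1]
    simp only [Finset.sum_const, Finset.card_univ, nsmul_eq_mul, mul_one]
    rw [← hn, ← hz, htz, sub_self]
  have e2 : ∑ v, (a v - t * (1 - c v)) ^ 2 ≤ 2 * w + 2 * (t ^ 2 * z) := by
    have : ∀ v ∈ Finset.univ, (a v - t * (1 - c v)) ^ 2 ≤ 2 * a v + 2 * (t ^ 2 * (1 - c v)) := by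
      intro v _
      simp only [ha, hc]
      split_ifs <;> nlinarith [sq_nonneg t, sq_nonneg (t + 1)]
    refine (Finset.sum_le_sum this).trans_eq ?_
    rw [Finset.sum_add_distrib, ← Finset.mul_sum, ← Finset.mul_sum, ← Finset.mul_sum,
      Finset.sum_sub_distrib, ha1, hc1]
    simp [hz, hn]
  have e3 : ∑ u, ∑ v, M u v * (a u * (1 - c v)) ≤ γ / 2 * w := by
    have h1 : ∀ u ∈ Finset.univ, ∑ v, M u v * (a u * (1 - c v)) ≤ γ / 2 * a u := by
      intro u _
      have h2 : ∑ v, M u v * (a u * (1 - c v)) = a u * (1 - ∑ v ∈ B, M u v) := by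
        have h3 : ∑ v ∈ B, M u v = ∑ v, M u v * c v := by simp [hc]
        rw [h3]
        conv_rhs => rw [← hM.row_sum u]
        rw [← Finset.sum_sub_distrib, Finset.mul_sum]
        exact Finset.sum_congr rfl fun v _ => by ring
      rw [h2]
      by_cases hu : u ∈ W
      · have := hW u hu
        simp only [ha, hu, if_true]
        linarith
      · simp [ha, hu]
    refine (Finset.sum_le_sum h1).trans_eq ?_
    rw [← Finset.mul_sum, ha1]
  -- The complement of `B` has more than half of the vertices, so regularity forces an edge weight
  -- of at least n - 2|B| ≥ 2γn inside it.
  have e4 : 2 * γ * n ≤ ∑ u, ∑ v, M u v * ((1 - c u) * (1 - c v)) := by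
    have h1 : ∑ u, ∑ v, M u v * ((1 - c u) * (1 - c v)) =
        ∑ u, ∑ v, M u v * 1 - ∑ u, ∑ v, M u v * c u - ∑ u, ∑ v, M u v * c v +
          ∑ u, ∑ v, M u v * (c u * c v) := by
      simp_rw [← Finset.sum_sub_distrib, ← Finset.sum_add_distrib]
      exact Finset.sum_congr rfl fun i _ => Finset.sum_congr rfl fun j _ => by ring
    have h2 : 0 ≤ ∑ u, ∑ v, M u v * (c u * c v) := by
      refine Finset.sum_nonneg fun u _ => Finset.sum_nonneg fun v _ => mul_nonneg (hM.nonneg u v) ?_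
      simp only [hc]
      split_ifs <;> simp
    rw [h1, hM.sum_mul_left fun _ => 1, hM.sum_mul_left c, hM.sum_mul_right c, hc1]
    simp only [Finset.sum_const, Finset.card_univ, nsmul_eq_mul, mul_one]
    rw [← hn]
    linarith
  have e5 : 0 ≤ ∑ u, ∑ v, M u v * (a u * a v) := by
    refine Finset.sum_nonneg fun u _ => Finset.sum_nonneg fun v _ => mul_nonneg (hM.nonneg u v) ?_
    simp only [ha]
    split_ifs <;> simp
  have e6 : ∑ u, ∑ v, M u v * ((a u - t * (1 - c u)) * (a v - t * (1 - c v))) =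
      ∑ u, ∑ v, M u v * (a u * a v) - 2 * t * ∑ u, ∑ v, M u v * (a u * (1 - c v)) +
        t ^ 2 * ∑ u, ∑ v, M u v * ((1 - c u) * (1 - c v)) := by
    have h1 : ∑ u, ∑ v, M u v * (a v * (1 - c u)) = ∑ u, ∑ v, M u v * (a u * (1 - c v)) := by
      rw [Finset.sum_comm]
      simp_rw [hM.symm]
    have h2 : ∑ u, ∑ v, M u v * ((a u - t * (1 - c u)) * (a v - t * (1 - c v))) =
      ∑ u, ∑ v, M u v * (a u * a v) - t * ∑ u, ∑ v, M u v * (a u * (1 - c v)) -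
        t * ∑ u, ∑ v, M u v * (a v * (1 - c u)) +
        t ^ 2 * ∑ u, ∑ v, M u v * ((1 - c u) * (1 - c v)) := by
      simp_rw [Finset.mul_sum, ← Finset.sum_sub_distrib, ← Finset.sum_add_distrib]
      exact Finset.sum_congr rfl fun i _ => Finset.sum_congr rfl fun j _ => by ring
    rw [h2, h1]
    ring
  rw [e6, e1] at hq
  have e7 : t * z ≤ t * n := by
    have : z ≤ n := by linarith
    gcongr
  have e8 : t * w ≤ 2 * w := by
    rw [ht, div_mul_eq_mul_div, div_le_iff₀ hz0]
    nlinarith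
  have f1 := mul_le_mul_of_nonneg_left e3 ht0
  have f2 := mul_le_mul_of_nonneg_left e4 (sq_nonneg t)
  have f3 := mul_le_mul_of_nonneg_left e2 hlam
  have f4 : t ^ 2 * z = t * w := by rw [sq, mul_assoc, htz]
  have f5 : t ^ 2 * w ≤ t ^ 2 * n := by gcongr
  -- Since t n ≥ t z = w, the positive term 2γt²n exceeds the cross term γtw by at least γtw; this
  -- excess must fit under the bound 6λw for the right-hand side.
  have f6 : γ * (t * w) ≤ γ * (t ^ 2 * n) := by
    refine mul_le_mul_of_nonneg_left ?_ hγ.le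
    nlinarith
  have f7 : γ * (t * w) ≤ 6 * lam * w := by
    have f8 : lam * (t * w) ≤ lam * (2 * w) := mul_le_mul_of_nonneg_left e8 hlam
    rw [f4] at f3
    norm_num at hq
    linarith
  rcases hw0.eq_or_lt with h0 | h0
  · rw [← h0]; simp; positivity
  · have f9 : γ * t ≤ 6 * lam := by
      have : (γ * t) * w ≤ (6 * lam) * w := by linarith
      exact le_of_mul_le_mul_right this h0
    calc γ * w = γ * t * z := by rw [mul_assoc, htz]
      _ ≤ 6 * lam * z := by gcongr
      _ ≤ 6 * lam * n := by gcongr; linarith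

end IsEigensystem

/-! ### The program -/

namespace RAM

/-- The number of vertices. -/
abbrev numE : Expr := .read 0 (.lit 0)

/-- The row of the matrix entry with index `var 6`. -/
abbrev rowE : Expr := .quot (var 6) numE

/-- The column of the matrix entry with index `var 6`. -/
abbrev colE : Expr := .minus (var 6) (.times numE rowE)

/-- The address of a matrix entry. -/
abbrev entryE (i j : Expr) : Expr := .plus (.times i numE) j

/-- The value is `1` if the values of `a` and `b` agree, and `0` otherwise. -/
def eqE (a b : Expr) : Expr :=
  .quot (.lit 1) (.plus (.lit 1) (.times (.minus a b) (.minus a b)))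

theorem value_eqE (a b : Expr) (s : Memory) :
    (eqE a b).value s = if a.value s = b.value s then 1 else 0 := by
  simp only [eqE, Expr.value]
  split_ifs with h
  · rw [h]; simp
  · have h1 : 0 < (a.value s - b.value s) * (a.value s - b.value s) :=
      mul_self_pos.2 (sub_ne_zero.2 h)
    exact Int.ediv_eq_zero_of_lt (by norm_num) (by omega)

/-- Replace the matrix `U` in bank `3` by `f E² + (1 - 2 f) U²`, and its scale `E` by `E²`. -/
def matStep (f : ℤ) : Program :=
  .seq (forLoop 6 (.times numE numE)
    (.seq (accumulate 8 7 numE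
        (.times (.read 3 (entryE rowE (var 7))) (.read 3 (entryE (var 7) colE))))
      (.assign 4 (var 6) (.plus (.times (.lit f) (.times (.times (var 5) (var 5)) (eqE rowE colE)))
        (.times (.lit (1 - 2 * f)) (var 8))))))
    (.seq (fill 3 6 (.times numE numE) (.read 4 (var 6))) (setVar 5 (.times (var 5) (var 5))))

theorem value_rowE {s : Memory} {n i : ℕ} (hn : s 0 0 = n) (hi : s 6 0 = i) :
    rowE.value s = ((i / n : ℕ) : ℤ) := by
  simp [Expr.value, hn, hi]

theorem value_colE {s : Memory} {n i : ℕ} (hn : s 0 0 = n) (hi : s 6 0 = i) :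
    colE.value s = ((i % n : ℕ) : ℤ) := by
  simp only [Expr.value, Int.toNat_zero, hn, hi]
  rw [Int.natCast_mod, Int.emod_def]

theorem value_entryE {s : Memory} {n i j : ℕ} {a b : Expr} (hn : s 0 0 = n) (hi : a.value s = i)
    (hj : b.value s = j) : ((entryE a b).value s).toNat = i * n + j := by
  simp only [Expr.value, Int.toNat_zero, hn, hi, hj]
  norm_cast

attribute [simp] Program.mods mods_forLoop

@[simp]
theorem mods_fill (b c : ℕ) (N e : Expr) : (fill b c N e).mods = [c, b, c] := rfl

@[simp]
theorem mods_accumulate (a c : ℕ) (N e : Expr) : (accumulate a c N e).mods = [a, c, a, c] := rfl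

theorem mods_matStep (f : ℤ) : (matStep f).mods = [6, 8, 7, 8, 7, 4, 6, 6, 3, 6, 5] := rfl

/-- In the bound (n + 1)E², the product contributes nE² and the multiple of the identity E². The new
matrix is assembled in bank 4 because every entry of the old one is still needed. -/
theorem Does.matStep {M n E : ℕ} {f : ℤ} {s₀ : Memory} (hf : f = 0 ∨ f = 1) (hn : s₀ 0 0 = n)
    (hE : s₀ 5 0 = E) (hU : ∀ i j, i < n → j < n → (s₀ 3 (i * n + j)).natAbs ≤ E)
    (hnM : n * n ≤ M) (hM : (n + 1) * E ^ 2 ≤ M) :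
    Does M (matStep f) s₀ (n * n * (n * 3 + 9) + 7) fun s' => s' 5 0 = (E : ℤ) ^ 2 ∧
      ∀ i j, i < n → j < n → s' 3 (i * n + j) = f * (E ^ 2 * if i = j then 1 else 0) +
        (1 - 2 * f) * ∑ k ∈ Finset.range n, s₀ 3 (i * n + k) * s₀ 3 (k * n + j) := by
  set P : ℕ → ℤ := fun t =>
    ∑ k ∈ Finset.range n, s₀ 3 (t / n * n + k) * s₀ 3 (k * n + t % n) with hP
  set R : ℕ → ℤ := fun t => f * (E ^ 2 * if t / n = t % n then 1 else 0) + (1 - 2 * f) * P t with hR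
  have hnn : n ≤ M := by nlinarith [Nat.le_mul_self n]
  have hpart : ∀ t < n * n, ∀ l ≤ n,
      (∑ k ∈ Finset.range l, s₀ 3 (t / n * n + k) * s₀ 3 (k * n + t % n)).natAbs ≤ n * E ^ 2 := by
    intro t ht l hl
    have hn0 : 0 < n := Nat.pos_of_ne_zero (by rintro rfl; simp at ht)
    have h1 : t / n < n := Nat.div_lt_of_lt_mul ht
    have h2 : t % n < n := Nat.mod_lt _ hn0
    refine (Int.natAbs_sum_le _ _).trans ?_
    calc ∑ k ∈ Finset.range l, (s₀ 3 (t / n * n + k) * s₀ 3 (k * n + t % n)).natAbs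
        ≤ ∑ k ∈ Finset.range l, E ^ 2 := by
          refine Finset.sum_le_sum fun k hk => ?_
          have hk' : k < n := (Finset.mem_range.1 hk).trans_le hl
          rw [Int.natAbs_mul, sq]
          exact Nat.mul_le_mul (hU _ _ h1 hk') (hU _ _ hk' h2)
      _ ≤ n * E ^ 2 := by simp only [Finset.sum_const, Finset.card_range, smul_eq_mul]; gcongr
  have hRb : ∀ t < n * n, (R t).natAbs ≤ M := by
    intro t ht
    refine le_trans ?_ hM
    have h1 := hpart t ht n le_rfl
    change (P t).natAbs ≤ n * E ^ 2 at h1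
    rcases hf with rfl | rfl
    · simp only [hR]
      rw [add_mul]
      simp
      omega
    · simp only [hR]
      rw [add_mul, one_mul, one_mul]
      split_ifs
      · have h2 := Int.natAbs_add_le ((E : ℤ) ^ 2 * 1) ((1 - 2 * 1) * P t)
        rw [Int.natAbs_mul (1 - 2 * 1), mul_one, Int.natAbs_pow] at h2
        simp only [Int.natAbs_natCast] at h2
        rw [mul_one]
        norm_num at h2 ⊢
        omega
      · simp
        omega
  have hE2 : E ^ 2 ≤ M := by nlinarith
  refine Does.mono (k := (n * n * ((n * 3 + 3 + 1) + 2) + 2) + (n * n * 3 + 2 + 1)) ?_ (by ring_nf; omega) fun _ h => h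
  refine Does.seq (Does.mono (Does.frame (Does.forLoop (n := n * n)
    (fun t s => ∀ i, i < t → s 4 i = R i) (by simp) hnM ?_ ?_ ?_ ?_)) le_rfl ?_)
  · intro s hs
    simp [Expr.value, hs 0 (by simp) (by simp), hn]
  · intro j s s' h hI i hi
    rw [h 4 (by simp)]; exact hI i hi
  · simp
  · intro t ht s hs6 hs hI
    have hn0 : 0 < n := Nat.pos_of_ne_zero (by rintro rfl; simp at ht)
    have h0 := hs 0 (by simp) (by simp)
    have h3 := hs 3 (by simp) (by simp)
    have h5 := hs 5 (by simp) (by simp)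
    refine Does.seq (k := n * 3 + 3) (k' := 1) (Does.mono (Does.frame (Does.accumulate
      (fun k => s₀ 3 (t / n * n + k) * s₀ 3 (k * n + t % n)) (by simp) hnn ?_ ?_ ?_)) le_rfl ?_)
    · intro s' hs'
      simp [Expr.value, hs' 0 (by simp) (by simp), h0, hn]
    · intro l hl
      refine (hpart t ht l hl).trans (le_trans ?_ hM)
      gcongr; omega
    · intro k hk s' hs7 hs'
      have h0' : s' 0 0 = n := by rw [hs' 0 (by simp) (by simp), h0, hn]
      have h6' : s' 6 0 = t := by rw [hs' 6 (by simp) (by simp), hs6]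
      have h3' : s' 3 = s₀ 3 := by rw [hs' 3 (by simp) (by simp), h3]
      have hk7 : (var 7).value s' = k := by simp [Expr.value, hs7]
      have e1 := value_entryE h0' (value_rowE h0' h6') hk7
      have e2 := value_entryE h0' hk7 (value_colE h0' h6')
      rw [Expr.value, Expr.value, Expr.value, e1, e2, h3']
    · rintro s' ⟨h8, hs'⟩
      have h0' : s' 0 0 = n := by rw [hs' 0 (by simp), h0, hn]
      have h6' : s' 6 0 = t := by rw [hs' 6 (by simp), hs6]
      have h5' : s' 5 0 = E := by rw [hs' 5 (by simp), h5, hE]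
      have hval : (Expr.plus (.times (.lit f) (.times (.times (var 5) (var 5)) (eqE rowE colE)))
          (.times (.lit (1 - 2 * f)) (var 8))).value s' = R t := by
        have heq : (eqE rowE colE).value s' = if t / n = t % n then 1 else 0 := by
          rw [value_eqE, value_rowE h0' h6', value_colE h0' h6']
          simp only [Nat.cast_inj]
        change f * (s' 5 0 * s' 5 0 * (eqE rowE colE).value s') + (1 - 2 * f) * s' 8 0 = R t
        rw [heq, h5', h8]
        simp only [hR, hP, sq]
      refine Does.assign (by rw [hval]; exact hRb t ht) ?_
      rw [hval]
      intro i hi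
      rw [Memory.write_self]
      simp only [Expr.value, Int.toNat_zero, h6', Int.toNat_natCast]
      by_cases hij : i = t
      · subst hij; simp
      · rw [Function.update_of_ne hij, hs' 4 (by simp)]; exact hI i (by omega)
  · rintro s ⟨h4, hs⟩
    have h0 := hs 0 (by simp)
    have h5 := hs 5 (by simp)
    refine Does.seq (Does.mono (Does.frame (Does.fill (n := n * n) R (by simp) hnM ?_ ?_)) le_rfl ?_)
    · intro s' hs'
      simp [Expr.value, hs' 0 (by simp) (by simp), h0, hn]
    · intro t ht s' h6 hs'
      refine ⟨?_, hRb t ht⟩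
      simp only [Expr.value, Int.toNat_zero, h6, Int.toNat_natCast, hs' 4 (by simp) (by simp)]
      exact h4 t ht
    · rintro s' ⟨h3, hs'⟩
      have h5' : s' 5 0 = E := by rw [hs' 5 (by simp), h5, hE]
      have hval : (Expr.times (var 5) (var 5)).value s' = (E : ℤ) ^ 2 := by
        simp only [Expr.value, Int.toNat_zero, h5', sq]
      refine Does.setVar (by rw [hval, Int.natAbs_pow]; simpa using hE2) ⟨?_, ?_⟩
      · rw [Memory.write_cell, hval]
      · intro i j hi hj
        have hn0 : 0 < n := by omega
        have hlt : i * n + j < n * n := by nlinarith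
        rw [Memory.write_of_ne _ (by simp), h3 _ hlt]
        have e1 : (i * n + j) / n = i := by
          rw [mul_comm, Nat.mul_add_div hn0, Nat.div_eq_of_lt hj, add_zero]
        have e2 : (i * n + j) % n = j := by
          rw [mul_comm, Nat.mul_add_mod, Nat.mod_eq_of_lt hj]
        simp only [hR, hP, e1, e2]

end RAM

/-! ### Computing the spectral filter by matrix squarings -/

namespace RAM

/-- The memory holds the matrix `E F(M)`, where `M` has the eigenvectors `ψ`. -/
def Represents {n : ℕ} (ψ : Fin n → Fin n → ℝ) (F : Fin n → ℝ) (E : ℕ) (s : Memory) : Prop :=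
  s 5 0 = E ∧ ∀ i j : Fin n, (s 3 (i * n + j) : ℝ) = E * specKernel ψ F i j

section Filter

variable {n : ℕ} {A : Fin n → Fin n → ℝ} {μ : Fin n → ℝ} {ψ : Fin n → Fin n → ℝ}
  {F : Fin n → ℝ} {E : ℕ}

theorem Represents.congr {s s' : Memory} (h : Represents ψ F E s) (h3 : s' 3 = s 3)
    (h5 : s' 5 = s 5) : Represents ψ F E s' := by
  unfold Represents
  rw [h3, h5]
  exact h

theorem Represents.natAbs_le (h : IsEigensystem A μ ψ) (hF : ∀ i, |F i| ≤ 1) {s : Memory}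
    (hs : Represents ψ F E s) {i j : ℕ} (hi : i < n) (hj : j < n) :
    (s 3 (i * n + j)).natAbs ≤ E := by
  have h1 := hs.2 ⟨i, hi⟩ ⟨j, hj⟩
  have h2 := h.abs_specKernel_le_one hF ⟨i, hi⟩ ⟨j, hj⟩
  have h3 : |(s 3 (i * n + j) : ℝ)| ≤ E := by
    simp only at h1
    rw [h1, abs_mul, Nat.abs_cast]
    exact mul_le_of_le_one_right (Nat.cast_nonneg _) h2
  rw [← Int.cast_abs, Int.abs_eq_natAbs] at h3
  exact_mod_cast h3

/-- The number of steps of `matStep`. -/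
def matSteps (n : ℕ) : ℕ := n * n * (n * 3 + 9) + 7

/-- For f = 0 the eigenvalue function F becomes F², for f = 1 it becomes 1 - F². These two moves
build the whole filter. The scale is squared to keep the entries integral. -/
theorem Represents.matStep (h : IsEigensystem A μ ψ) (hF : ∀ i, |F i| ≤ 1) {M : ℕ} {s : Memory}
    {f : ℤ} (hf : f = 0 ∨ f = 1) (hn : s 0 0 = n) (hs : Represents ψ F E s) (hnM : n * n ≤ M)
    (hM : (n + 1) * E ^ 2 ≤ M) :
    Does M (matStep f) s (matSteps n) fun s' =>
      Represents ψ (fun i => f + (1 - 2 * f) * F i ^ 2) (E ^ 2) s' := by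
  refine (Does.matStep hf hn hs.1 (fun i j hi hj => hs.natAbs_le h hF hi hj) hnM hM).mono le_rfl ?_
  rintro s' ⟨h5, h3⟩
  refine ⟨by rw [h5]; simp, fun i j => ?_⟩
  rw [h3 i j i.2 j.2]
  have e1 : ((∑ k ∈ Finset.range n, s 3 (i * n + k) * s 3 (k * n + j) : ℤ) : ℝ) =
      E ^ 2 * specKernel ψ (fun i => F i * F i) i j := by
    rw [← h.specKernel_mul, Finset.mul_sum,
      ← Fin.sum_univ_eq_sum_range (fun k => s 3 (i * n + k) * s 3 (k * n + j))]
    push_cast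
    refine Finset.sum_congr rfl fun k _ => ?_
    rw [hs.2, hs.2]; ring
  have e2 : specKernel ψ (fun i => (f : ℝ) + (1 - 2 * f) * F i ^ 2) i j =
      f * (if (i : ℕ) = j then 1 else 0) + (1 - 2 * f) * specKernel ψ (fun i => F i * F i) i j := by
    have := h.specKernel_one i j
    simp only [Fin.ext_iff] at this
    rw [← this]
    simp only [specKernel, Finset.mul_sum, ← Finset.sum_add_distrib]
    exact Finset.sum_congr rfl fun k _ => by ring
  push_cast at e1 ⊢
  rw [e1, e2]
  ring

/-- Compute a spectral filter of the adjacency matrix. -/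
def filterProgram : Program :=
  .seq (accumulate 5 7 numE (.read 1 (var 7)))
  (.seq (fill 3 6 (.times numE numE) (.read 1 (var 6)))
  (.seq (matStep 1)
  (.seq (setVar 9 (.lit 1))
  (.seq (.loop (.minus (.plus (.read 0 (.lit 3)) (.lit 1)) (.times (.lit 32) (var 9)))
    (.seq (matStep 0) (setVar 9 (.times (.lit 2) (var 9)))))
  (.seq (matStep 1)
  (.seq (setVar 9 (.lit 1))
  (.loop (.minus (.plus numE (.times (.lit 1024) (.times (.read 0 (.lit 2)) (.read 0 (.lit 2)))))
      (var 9))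
    (.seq (matStep 1) (.seq (matStep 1) (setVar 9 (.times (.lit 2) (var 9))))))))))))

/-- The number of steps of `filterProgram`. -/
def filterSteps (n r K : ℕ) : ℕ :=
  (n * 3 + 3) + ((n * n * 3 + 2) + (matSteps n + (1 + ((r * (matSteps n + 1 + 1) + 1) +
    (matSteps n + (1 + (K * (matSteps n + (matSteps n + 1) + 1) + 1)))))))

/-- A bound for the scale of the filtered matrix. -/
def scaleBound (n r K : ℕ) : ℕ := n ^ (16 * r * K ^ 2)

theorem mods_filterProgram : ∀ b ∈ filterProgram.mods, b = 3 ∨ b = 4 ∨ b = 5 ∨ b = 6 ∨ b = 7 ∨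
    b = 8 ∨ b = 9 := by decide

/-- The matrix passes through μ, 1 - μ², (1 - μ²)^q, 1 - (1 - μ²)^(2q) and then through the iterates
of the filter. The corresponding scales are d, d², d^(2q), d^(4q), and each double step raises the
scale to the fourth power. Iteration stops once the doubling counter 2^m reaches K, which makes
suppressed eigenvalues smaller than 2^(-K). -/
theorem Does.filterProgram (h : IsEigensystem A μ ψ) (hA : IsSymmStochastic A) {M d g r K : ℕ}
    {s₀ : Memory} (hn : s₀ 0 0 = n) (hg : s₀ 0 2 = g) (hr : s₀ 0 3 = r) (hr16 : 16 ≤ r)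
    (hK : K = n + 1024 * (g * g)) (hd : 0 < d) (hdn : d ≤ n)
    (h01 : ∀ i, s₀ 1 i = 0 ∨ s₀ 1 i = 1)
    (hdeg : ∑ j ∈ Finset.range n, s₀ 1 j = d)
    (hadj : ∀ i j : Fin n, (s₀ 1 (i * n + j) : ℝ) = d * specKernel ψ μ i j)
    (hnM : n * n ≤ M) (hrM : r ≤ M) (hKM : 2 * K ≤ M)
    (hM : (n + 1) * scaleBound n r K ^ 2 ≤ M) :
    Does M filterProgram s₀ (filterSteps n r K) fun s' => ∃ q m E : ℕ, 16 * q ≤ r ∧ r < 32 * q ∧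
      K ≤ 2 ^ m ∧ 0 < E ∧ E ≤ scaleBound n r K ∧
      Represents ψ (fun i => specFilter q m (μ i ^ 2)) E s' := by
  have hn0 : 0 < n := hd.trans_le hdn
  have hnn : n ≤ M := by nlinarith
  have hK0 : 0 < K := by omega
  have hμ0 : ∀ i, 0 ≤ μ i ^ 2 := fun i => sq_nonneg _
  have hμ1 : ∀ i, μ i ^ 2 ≤ 1 := h.sq_eigenvalue_le_one hA
  have hscale : ∀ a, a ≤ 16 * r * K ^ 2 → d ^ a ≤ scaleBound n r K := fun a ha =>
    (Nat.pow_le_pow_left hdn a).trans (Nat.pow_le_pow_right hn0 ha)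
  have hscM : ∀ a, a ≤ 16 * r * K ^ 2 → (n + 1) * (d ^ a) ^ 2 ≤ M := fun a ha => by
    refine le_trans ?_ hM
    have := hscale a ha
    gcongr
  have hrK : r ≤ r * K ^ 2 := Nat.le_mul_of_pos_right _ (by positivity)
  refine Does.seq (Does.mono (Does.frame (Does.accumulate (s₀ 1) (by decide) hnn ?_ ?_ ?_)) le_rfl ?_)
  · intro s hs
    simp [Expr.value, hs 0 (by decide) (by decide), hn]
  · intro l hl
    refine (Int.natAbs_sum_le _ _).trans ?_
    have : ∑ i ∈ Finset.range l, (s₀ 1 i).natAbs ≤ ∑ i ∈ Finset.range l, 1 := by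
      refine Finset.sum_le_sum fun i _ => ?_
      rcases h01 i with h1 | h1 <;> simp [h1]
    refine this.trans ?_
    simp only [Finset.sum_const, Finset.card_range, smul_eq_mul, mul_one]
    omega
  · intro j _ s h7 hs
    simp [Expr.value, h7, hs 1 (by decide) (by decide)]
  rintro s₁ ⟨h5, hs₁⟩
  rw [hdeg] at h5
  have h0₁ : s₁ 0 = s₀ 0 := hs₁ 0 (by simp)
  have h1₁ : s₁ 1 = s₀ 1 := hs₁ 1 (by simp)
  refine Does.seq (Does.mono (Does.frame (Does.fill (n := n * n) (s₀ 1) (by decide) hnM ?_ ?_))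
    le_rfl ?_)
  · intro s hs
    simp [Expr.value, hs 0 (by decide) (by decide), h0₁, hn]
  · intro j _ s h6 hs
    refine ⟨by simp [Expr.value, h6, hs 1 (by decide) (by decide), h1₁], ?_⟩
    rcases h01 j with h1 | h1 <;> rw [h1] <;> simp
    nlinarith
  rintro s₂ ⟨h3₂, hs₂⟩
  have h0₂ : s₂ 0 = s₀ 0 := by rw [hs₂ 0 (by simp), h0₁]
  have hR₂ : Represents ψ μ (d ^ 1) s₂ := by
    refine ⟨by rw [hs₂ 5 (by simp), h5, pow_one], fun i j => ?_⟩
    have hlt : (i * n + j : ℕ) < n * n := by nlinarith [i.2, j.2]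
    rw [h3₂ _ hlt, hadj, pow_one]
  refine Does.seq (Does.mono (Does.frame (hR₂.matStep h (fun i => ?_) (Or.inr rfl)
    (by rw [h0₂, hn]) hnM (hscM 1 (by nlinarith)))) le_rfl ?_)
  · exact abs_le_of_sq_le_sq (by simpa using hμ1 i) zero_le_one
  rintro s₃ ⟨hR₃, hs₃⟩
  have h0₃ : s₃ 0 = s₀ 0 := by rw [hs₃ 0 (by simp [mods_matStep]), h0₂]
  refine Does.seq (Does.setVar (by simp [Expr.value]; nlinarith) ?_)
  have hF0 : ∀ (w : ℕ) (i : Fin n), |(1 - μ i ^ 2) ^ w| ≤ 1 := fun w i => by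
    rw [abs_pow]
    refine pow_le_one₀ (abs_nonneg _) (abs_le.2 ⟨?_, ?_⟩) <;> linarith [hμ0 i, hμ1 i]
  refine Does.seq (Does.mono (Does.loop (k := matSteps n + 1) r (fun j s => s 0 = s₀ 0 ∧
    s 9 0 = ((2 ^ j : ℕ) : ℤ) ∧ 16 * 2 ^ j ≤ r ∧
      Represents ψ (fun i => (1 - μ i ^ 2) ^ 2 ^ j) (d ^ (2 * 2 ^ j)) s) ?_ ?_) le_rfl ?_)
  · rintro j s ⟨h0, h9, hjr, hR⟩ he
    have he' : (0 : ℤ) < r + 1 - 32 * (2 ^ j : ℕ) := by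
      simpa [Expr.value, h0, hr, h9] using he
    have hlt : 32 * 2 ^ j ≤ r := by omega
    have hj2 : j < 2 ^ j := Nat.lt_two_pow_self
    refine ⟨by omega, Does.seq (Does.mono (Does.frame (hR.matStep h (hF0 _) (Or.inl rfl)
      (by rw [h0, hn]) hnM (hscM _ (by nlinarith)))) le_rfl ?_)⟩
    rintro s' ⟨hR', hs'⟩
    have h0' : s' 0 = s₀ 0 := by rw [hs' 0 (by simp [mods_matStep]), h0]
    have h9' : s' 9 0 = ((2 ^ j : ℕ) : ℤ) := by rw [hs' 9 (by simp [mods_matStep]), h9]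
    have hval : (Expr.times (.lit 2) (var 9)).value s' = ((2 ^ (j + 1) : ℕ) : ℤ) := by
      simp only [Expr.value, Int.toNat_zero, h9']
      push_cast; ring
    refine Does.setVar (by rw [hval, Int.natAbs_natCast, pow_succ]; omega) ⟨?_, ?_, ?_, ?_⟩
    · rw [Memory.write_of_ne _ (by decide), h0']
    · rw [Memory.write_cell, hval]
    · rw [pow_succ]; omega
    · refine Represents.congr (s := s') ?_ (Memory.write_of_ne _ (by decide) _ _)
        (Memory.write_of_ne _ (by decide) _ _)
      convert hR' using 1
      · funext i; push_cast; ring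
      · ring
  · refine ⟨?_, ?_, by simpa using hr16, ?_⟩
    · rw [Memory.write_of_ne _ (by decide), h0₃]
    · rw [Memory.write_cell]; simp [Expr.value]
    · refine Represents.congr (s := s₃) ?_ (Memory.write_of_ne _ (by decide) _ _)
        (Memory.write_of_ne _ (by decide) _ _)
      convert hR₃ using 1
      · funext i; push_cast; ring
      · ring
  rintro s₄ ⟨k, -, ⟨h0₄, h9₄, hkr, hR₄⟩, he⟩
  have he' : ¬ (0 : ℤ) < r + 1 - 32 * (2 ^ k : ℕ) := by
    simpa [Expr.value, h0₄, hr, h9₄] using he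
  -- The first loop leaves a power of two q with 16q ≤ r < 32q, so q is of order 1/λ.
  obtain ⟨q, hq⟩ : ∃ q, q = 2 ^ k := ⟨_, rfl⟩
  rw [← hq] at he' hkr hR₄
  have hq0 : 0 < q := by rw [hq]; positivity
  refine Does.seq (Does.mono (Does.frame (hR₄.matStep h (hF0 _) (Or.inr rfl)
    (by rw [h0₄, hn]) hnM (hscM _ (by nlinarith)))) le_rfl ?_)
  rintro s₅ ⟨hR₅, hs₅⟩
  have h0₅ : s₅ 0 = s₀ 0 := by rw [hs₅ 0 (by simp [mods_matStep]), h0₄]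
  refine Does.seq (Does.setVar (by simp [Expr.value]; nlinarith) ?_)
  have hu : ∀ i, 0 ≤ filterStep ((1 - μ i ^ 2) ^ q) ∧ filterStep ((1 - μ i ^ 2) ^ q) ≤ 1 :=
    fun i => filterStep_mem (pow_nonneg (by linarith [hμ1 i]) q)
      (pow_le_one₀ (by linarith [hμ1 i]) (by linarith [hμ0 i]))
  refine Does.mono (Does.loop (k := matSteps n + (matSteps n + 1)) K (fun j s => s 0 = s₀ 0 ∧
    s 9 0 = ((2 ^ j : ℕ) : ℤ) ∧ 2 ^ j ≤ 2 * K ∧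
      Represents ψ (fun i => specFilter q j (μ i ^ 2)) (d ^ (4 * q * (2 ^ j) ^ 2)) s) ?_ ?_) le_rfl ?_
  · rintro j s ⟨h0, h9, -, hR⟩ he
    have he' : (0 : ℤ) < K - (2 ^ j : ℕ) := by
      rw [hK]
      simpa [Expr.value, h0, hn, hg, h9] using he
    have hlt : 2 ^ j < K := by omega
    have hj2 : j < 2 ^ j := Nat.lt_two_pow_self
    have hexp : 2 * (4 * q * (2 ^ j) ^ 2) ≤ 16 * r * K ^ 2 := by
      have e1 : (2 ^ j) ^ 2 ≤ K ^ 2 := Nat.pow_le_pow_left hlt.le 2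
      calc 2 * (4 * q * (2 ^ j) ^ 2) ≤ 2 * (4 * q * K ^ 2) := by gcongr
        _ = 8 * q * K ^ 2 := by ring
        _ ≤ 16 * r * K ^ 2 := by gcongr <;> omega
    have hmem := fun i => filterIter_mem (hu i).1 (hu i).2 j
    have hmem' := fun i => filterStep_mem (hmem i).1 (hmem i).2
    refine ⟨by omega, Does.seq (Does.mono (Does.frame (hR.matStep h (fun i => abs_le.2
      ⟨by linarith [(hmem i).1, show specFilter q j (μ i ^ 2) =
        filterIter j (filterStep ((1 - μ i ^ 2) ^ q)) from rfl], (hmem i).2⟩) (Or.inr rfl)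
      (by rw [h0, hn]) hnM (hscM _ (by omega)))) le_rfl ?_)⟩
    rintro s₆ ⟨hR₆, hs₆⟩
    have h0₆ : s₆ 0 = s₀ 0 := by rw [hs₆ 0 (by simp [mods_matStep]), h0]
    have h9₆ : s₆ 9 0 = ((2 ^ j : ℕ) : ℤ) := by rw [hs₆ 9 (by simp [mods_matStep]), h9]
    have hR₆' : Represents ψ (fun i => filterStep (specFilter q j (μ i ^ 2)))
        (d ^ (2 * (4 * q * (2 ^ j) ^ 2))) s₆ := by
      convert hR₆ using 1
      · funext i
        change filterStep (filterIter j (filterStep ((1 - μ i ^ 2) ^ q))) = _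
        conv_lhs => rw [filterStep]
        push_cast; ring
      · ring
    refine Does.seq (Does.mono (Does.frame (hR₆'.matStep h (fun i => abs_le.2
      ⟨by linarith [(hmem' i).1, show specFilter q j (μ i ^ 2) =
        filterIter j (filterStep ((1 - μ i ^ 2) ^ q)) from rfl], (hmem' i).2⟩) (Or.inr rfl)
      (by rw [h0₆, hn]) hnM (hscM _ hexp))) le_rfl ?_)
    rintro s' ⟨hR', hs'⟩
    have h0' : s' 0 = s₀ 0 := by rw [hs' 0 (by simp [mods_matStep]), h0₆]
    have h9' : s' 9 0 = ((2 ^ j : ℕ) : ℤ) := by rw [hs' 9 (by simp [mods_matStep]), h9₆]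
    have hval : (Expr.times (.lit 2) (var 9)).value s' = ((2 ^ (j + 1) : ℕ) : ℤ) := by
      simp only [Expr.value, Int.toNat_zero, h9']
      push_cast; ring
    refine Does.setVar (by rw [hval, Int.natAbs_natCast, pow_succ]; omega) ⟨?_, ?_, ?_, ?_⟩
    · rw [Memory.write_of_ne _ (by decide), h0']
    · rw [Memory.write_cell, hval]
    · rw [pow_succ]; omega
    · refine Represents.congr (s := s') ?_ (Memory.write_of_ne _ (by decide) _ _)
        (Memory.write_of_ne _ (by decide) _ _)
      convert hR' using 1
      · funext i
        simp only [specFilter]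
        rw [filterIter_succ]
        conv_lhs => rw [filterStep]
        push_cast; ring
      · ring
  · refine ⟨?_, ?_, by rw [pow_zero]; omega, ?_⟩
    · rw [Memory.write_of_ne _ (by decide), h0₅]
    · rw [Memory.write_cell]; simp [Expr.value]
    · refine Represents.congr (s := s₅) ?_ (Memory.write_of_ne _ (by decide) _ _)
        (Memory.write_of_ne _ (by decide) _ _)
      convert hR₅ using 1
      · funext i
        simp only [specFilter, filterIter, Function.iterate_zero, id_eq]
        unfold filterStep; push_cast; ring
      · ring
  rintro s' ⟨m, -, ⟨h0, h9, hmK, hR⟩, he''⟩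
  have he3 : ¬ (0 : ℤ) < K - (2 ^ m : ℕ) := by
    rw [hK]
    simpa [Expr.value, h0, hn, hg, h9] using he''
  refine ⟨q, m, _, hkr, by omega, by omega, by positivity, hscale _ ?_, hR⟩
  -- The last doubling started below K, so 2^m ≤ 2K; this is the origin of the exponent 16rK² in
  -- `scaleBound`.
  calc 4 * q * (2 ^ m) ^ 2 ≤ 4 * q * (2 * K) ^ 2 := by gcongr
    _ = 16 * q * K ^ 2 := by ring
    _ ≤ 16 * r * K ^ 2 := by gcongr; omega

end Filter

end RAM

/-! ### Greedy clustering -/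

namespace RAM

/-- Positive if the vertex `v` has bounded norm. -/
def normE (v : Expr) : Expr :=
  .minus (.plus (.times (.times (.read 0 (.lit 3)) (.plus (.read 0 (.lit 3)) (.lit 2))) (var 5))
    (.lit 1)) (.times numE (.read 3 (entryE v v)))

/-- Positive if the vertices `u` and `v` are close. -/
def distE (u v : Expr) : Expr :=
  .minus (.plus (var 5) (.lit 1)) (.times (.times (.lit 512) (.times (.read 0 (.lit 2))
    (.read 0 (.lit 2)))) (.times numE (.minus (.plus (.read 3 (entryE u u)) (.read 3 (entryE v v)))
      (.times (.lit 2) (.read 3 (entryE u v))))))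

/-- The vertex `v` has bounded norm. -/
def NormOK (s : Memory) (n r : ℕ) (v : ℕ) : Prop :=
  n * s 3 (v * n + v) ≤ r * (r + 2) * s 5 0

/-- The vertices `u` and `v` are close. -/
def Near (s : Memory) (n g : ℕ) (u v : ℕ) : Prop :=
  512 * (g * g) * (n * (s 3 (u * n + u) + s 3 (v * n + v) - 2 * s 3 (u * n + v))) ≤ s 5 0

theorem value_normE {s s₀ : Memory} {n r v : ℕ} {e : Expr} (hn : s 0 0 = n) (hr : s 0 3 = r)
    (h3 : s 3 = s₀ 3) (h5 : s 5 = s₀ 5) (he : e.value s = v) :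
    0 < (normE e).value s ↔ NormOK s₀ n r v := by
  have e1 := value_entryE hn he he
  have : (normE e).value s = r * (r + 2) * s₀ 5 0 + 1 - n * s₀ 3 (v * n + v) := by
    change s 0 3 * (s 0 3 + 2) * s 5 0 + 1 - s 0 0 * s 3 ((entryE e e).value s).toNat = _
    rw [e1, hn, hr, h3, h5]
  rw [this, NormOK]
  omega

theorem value_distE {s s₀ : Memory} {n g u v : ℕ} {a b : Expr} (hn : s 0 0 = n) (hg : s 0 2 = g)
    (h3 : s 3 = s₀ 3) (h5 : s 5 = s₀ 5) (ha : a.value s = u) (hb : b.value s = v) :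
    0 < (distE a b).value s ↔ Near s₀ n g u v := by
  have e1 := value_entryE hn ha ha
  have e2 := value_entryE hn hb hb
  have e3 := value_entryE hn ha hb
  have : (distE a b).value s = s₀ 5 0 + 1 - 512 * (g * g) *
      (n * (s₀ 3 (u * n + u) + s₀ 3 (v * n + v) - 2 * s₀ 3 (u * n + v))) := by
    change s 5 0 + 1 - 512 * (s 0 2 * s 0 2) * (s 0 0 * (s 3 ((entryE a a).value s).toNat +
      s 3 ((entryE b b).value s).toNat - 2 * s 3 ((entryE a b).value s).toNat)) = _
    rw [e1, e2, e3, hn, hg, h3, h5]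
  rw [this, Near]
  omega

/-- Group the vertices of bounded norm into clusters of close vertices. A vertex of cluster `t` is
marked with `3 ^ t` in bank `10`. -/
def clusterProgram : Program :=
  .seq (setVar 9 (.lit 1))
  (forLoop 15 numE (.cond (.minus (.lit 1) (.read 10 (var 15))) (.cond (normE (var 15))
    (.seq (forLoop 16 numE (.cond (.minus (.lit 1) (.read 10 (var 16)))
        (.cond (distE (var 16) (var 15)) (.assign 10 (var 16) (var 9)) .skip) .skip))
      (setVar 9 (.times (.lit 3) (var 9)))) .skip) .skip))

/-- A grouping of vertices into clusters around `K` centres. -/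
structure IsClustering (n : ℕ) (ok : ℕ → Prop) (near : ℕ → ℕ → Prop) (K : ℕ) (ctr : ℕ → ℕ)
    (mark : ℕ → ℤ) : Prop where
  mark_eq : ∀ x, x < n → mark x = 0 ∨ ∃ t < K, mark x = 3 ^ t ∧ near x (ctr t)
  ctr_ok : ∀ t, t < K → ctr t < n ∧ ok (ctr t)
  separated : ∀ t' < K, ∀ t < t', ¬ near (ctr t') (ctr t)
  unmarked : ∀ x, x < n → mark x = 0 → ∀ t < K, ¬ near x (ctr t)

/-- A new centre is an unmarked vertex, and being unmarked means being far from all earlier centres;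
this gives the separation. -/
theorem IsClustering.step {n : ℕ} {ok : ℕ → Prop} {near : ℕ → ℕ → Prop} {K : ℕ} {ctr : ℕ → ℕ}
    {mark mark' : ℕ → ℤ} (h : IsClustering n ok near K ctr mark) {v : ℕ} (hv : v < n)
    (hok : ok v) (hmark : mark v = 0)
    (h1 : ∀ x, x < n → mark x = 0 → near x v → mark' x = 3 ^ K)
    (h2 : ∀ x, x < n → ¬ (mark x = 0 ∧ near x v) → mark' x = mark x) :
    IsClustering n ok near (K + 1) (Function.update ctr K v) mark' := by
  have hctr : ∀ t < K, Function.update ctr K v t = ctr t := fun t ht =>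
    Function.update_of_ne ht.ne _ _
  refine ⟨fun x hx => ?_, fun t ht => ?_, fun t' ht' t ht => ?_, fun x hx hmx t ht => ?_⟩
  · by_cases hc : mark x = 0 ∧ near x v
    · exact Or.inr ⟨K, K.lt_succ_self, h1 x hx hc.1 hc.2, by simpa using hc.2⟩
    · rw [h2 x hx hc]
      rcases h.mark_eq x hx with h3 | ⟨t, ht, h3, h4⟩
      · exact Or.inl h3
      · exact Or.inr ⟨t, by omega, h3, by rwa [hctr t ht]⟩
  · rcases Nat.lt_succ_iff_lt_or_eq.1 ht with ht | rfl
    · rw [hctr t ht]; exact h.ctr_ok t ht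
    · simpa using ⟨hv, hok⟩
  · rw [hctr t (by omega)]
    rcases Nat.lt_succ_iff_lt_or_eq.1 ht' with ht' | rfl
    · rw [hctr t' ht']; exact h.separated t' ht' t ht
    · simpa using h.unmarked v hv hmark t ht
  · by_cases hc : mark x = 0 ∧ near x v
    · rw [h1 x hx hc.1 hc.2] at hmx
      exact absurd hmx (by positivity)
    · have hmx' := hmx
      rw [h2 x hx hc] at hmx'
      rcases Nat.lt_succ_iff_lt_or_eq.1 ht with ht | rfl
      · rw [hctr t ht]; exact h.unmarked x hx hmx' t ht
      · simpa using fun hnear => hc ⟨hmx', hnear⟩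

/-- The number of steps of `clusterProgram`. -/
def clusterSteps (n : ℕ) : ℕ := 1 + (n * ((n * 5 + 2 + 1 + 1 + 1) + 2) + 2)

/-- The number of clusters enters only through the abstract packing bound `hN`; it keeps the marks
3^t, and hence the contents of the memory, below `M`. -/
theorem Does.clusterProgram {M n g r N : ℕ} {s₀ : Memory} (hn : s₀ 0 0 = n) (hg : s₀ 0 2 = g)
    (hr : s₀ 0 3 = r) (h10 : ∀ x, x < n → s₀ 10 x = 0) (hE : 0 ≤ s₀ 5 0) (hnM : n ≤ M)
    (hM : 3 ^ N ≤ M)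
    (hN : ∀ (K : ℕ) (ctr : ℕ → ℕ), (∀ t, t < K → ctr t < n ∧ NormOK s₀ n r (ctr t)) →
      (∀ t' < K, ∀ t < t', ¬ Near s₀ n g (ctr t') (ctr t)) → K ≤ N) :
    Does M clusterProgram s₀ (clusterSteps n) fun s' => ∃ K ctr, K ≤ N ∧ s' 9 0 = 3 ^ K ∧
      IsClustering n (NormOK s₀ n r) (Near s₀ n g) K ctr (s' 10) ∧
      ∀ x, x < n → NormOK s₀ n r x → s' 10 x ≠ 0 := by
  have hM1 : 1 ≤ M := le_trans Nat.one_le_two_pow ((Nat.pow_le_pow_left (by norm_num) N).trans hM)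
  have hnear : ∀ x, Near s₀ n g x x := by
    intro x
    unfold Near
    ring_nf
    simpa using hE
  refine Does.seq (Does.setVar (by simpa [Expr.value] using hM1) ?_)
  refine Does.mono (Does.forLoop (k := (n * 5 + 2) + 1 + 1 + 1) (fun j s => ∃ K ctr, s 9 0 = 3 ^ K ∧
    IsClustering n (NormOK s₀ n r) (Near s₀ n g) K ctr (s 10) ∧
    ∀ x, x < n → x < j → NormOK s₀ n r x → s 10 x ≠ 0)
    (by decide) hnM ?_ ?_ ?_ ?_) le_rfl ?_
  · intro s hs
    simp [Expr.value, hs 0 (by decide) (by decide), Memory.write_of_ne, hn]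
  · intro j s s' h hI
    rw [h 9 (by decide), h 10 (by decide)]; exact hI
  · refine ⟨0, id, ?_, ⟨fun x hx => Or.inl ?_, by simp, by simp, by simp⟩, by simp⟩
    · rw [Memory.write_cell]; simp [Expr.value]
    · rw [Memory.write_of_ne _ (by decide), h10 x hx]
  · rintro v hv s h15 hs ⟨K, ctr, h9, hcl, hdone⟩
    have h0 : s 0 = s₀ 0 := by
      rw [hs 0 (by decide) (by decide), Memory.write_of_ne _ (by decide)]
    have h3 : s 3 = s₀ 3 := by
      rw [hs 3 (by decide) (by decide), Memory.write_of_ne _ (by decide)]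
    have h5 : s 5 = s₀ 5 := by
      rw [hs 5 (by decide) (by decide), Memory.write_of_ne _ (by decide)]
    have hv15 : (var 15).value s = v := by simp [Expr.value, h15]
    have hskip : ∀ l, 1 ≤ l → (s 10 v ≠ 0 ∨ ¬ NormOK s₀ n r v) → Does M .skip s l fun s =>
        ∃ K ctr, s 9 0 = 3 ^ K ∧ IsClustering n (NormOK s₀ n r) (Near s₀ n g) K ctr (s 10) ∧
          ∀ x, x < n → x < v + 1 → NormOK s₀ n r x → s 10 x ≠ 0 := by
      intro l hl hor
      refine (Does.skip ⟨K, ctr, h9, hcl, fun x hx hxv hok => ?_⟩).mono hl fun _ h => h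
      rcases Nat.lt_succ_iff_lt_or_eq.1 hxv with h | rfl
      · exact hdone x hx h hok
      · exact hor.resolve_right (not_not.2 hok)
    refine Does.cond (fun he => ?_) (fun he => hskip _ (by omega) (Or.inl ?_))
    swap
    · intro h10v
      exact he (by simp [Expr.value, h15, h10v])
    have h10v : s 10 v = 0 := by
      rcases hcl.mark_eq v hv with h1 | ⟨t, -, h1, -⟩
      · exact h1
      · have : s 10 v < 1 := by simpa [Expr.value, h15] using he
        rw [h1] at this
        exact absurd (one_le_pow₀ (by norm_num : (1 : ℤ) ≤ 3)) (not_le.2 this)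
    refine Does.cond (fun he' => ?_) (fun he' => hskip _ (by omega) (Or.inr ?_))
    swap
    · rwa [value_normE (by rw [h0, hn]) (by rw [h0, hr]) h3 h5 hv15] at he'
    rw [value_normE (by rw [h0, hn]) (by rw [h0, hr]) h3 h5 hv15] at he'
    refine Does.seq (k := n * 5 + 2) (k' := 1) (Does.mono (Does.frame (Does.forLoop (k := 3) (fun j s' =>
      ∀ x, x < n → ((x < j ∧ s 10 x = 0 ∧ Near s₀ n g x v) → s' 10 x = 3 ^ K) ∧
        (¬ (x < j ∧ s 10 x = 0 ∧ Near s₀ n g x v) → s' 10 x = s 10 x))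
      (by decide) hnM ?_ ?_ ?_ ?_)) le_rfl ?_)
    · intro s' hs'
      simp [Expr.value, hs' 0 (by decide) (by decide), h0, hn]
    · intro j s' s'' h hI
      rw [h 10 (by decide)]; exact hI
    · simp
    · intro u hu s' h16 hs' hI
      have h0' : s' 0 = s₀ 0 := by rw [hs' 0 (by decide) (by decide), h0]
      have h3' : s' 3 = s₀ 3 := by rw [hs' 3 (by decide) (by decide), h3]
      have h5' : s' 5 = s₀ 5 := by rw [hs' 5 (by decide) (by decide), h5]
      have h9' : s' 9 0 = 3 ^ K := by rw [hs' 9 (by decide) (by decide), h9]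
      have hv15' : (var 15).value s' = v := by
        simp [Expr.value, hs' 15 (by decide) (by decide), h15]
      have hu16 : (var 16).value s' = u := by simp [Expr.value, h16]
      have hu10 : s' 10 u = s 10 u := (hI u hu).2 (by simp)
      have hstep : ∀ x, x ≠ u → (x < u + 1 ↔ x < u) := fun x hx => by omega
      have hskip' : ¬ (s 10 u = 0 ∧ Near s₀ n g u v) → ∀ x, x < n →
          ((x < u + 1 ∧ s 10 x = 0 ∧ Near s₀ n g x v) → s' 10 x = 3 ^ K) ∧
          (¬ (x < u + 1 ∧ s 10 x = 0 ∧ Near s₀ n g x v) → s' 10 x = s 10 x) := by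
        intro hnot x hx
        by_cases hxu : x = u
        · subst hxu
          exact ⟨fun h => absurd h.2 hnot, fun _ => hu10⟩
        · rw [hstep x hxu]; exact hI x hx
      refine Does.cond (k := 2) (fun hc => ?_)
        (fun hc => (Does.skip (hskip' ?_)).mono (by norm_num) fun _ h => h)
      swap
      · rintro ⟨h1, -⟩
        exact hc (by simp [Expr.value, h16, hu10, h1])
      have hu0 : s 10 u = 0 := by
        rcases hcl.mark_eq u hu with h1 | ⟨t, -, h1, -⟩
        · exact h1
        · have : s 10 u < 1 := by simpa [Expr.value, h16, hu10] using hc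
          rw [h1] at this
          exact absurd (one_le_pow₀ (by norm_num : (1 : ℤ) ≤ 3)) (not_le.2 this)
      refine Does.cond (k := 1) (fun hc' => ?_) (fun hc' => Does.skip (hskip' ?_))
      swap
      · rintro ⟨-, h1⟩
        rw [value_distE (by rw [h0', hn]) (by rw [h0', hg]) h3' h5' hu16 hv15'] at hc'
        exact hc' h1
      rw [value_distE (by rw [h0', hn]) (by rw [h0', hg]) h3' h5' hu16 hv15'] at hc'
      have hK := hN K ctr hcl.ctr_ok hcl.separated
      have hval : (var 9).value s' = 3 ^ K := by simp [Expr.value, h9']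
      refine Does.assign ?_ ?_
      · rw [hval, Int.natAbs_pow]
        exact (Nat.pow_le_pow_right (by norm_num) hK).trans hM
      · intro x hx
        rw [hval, hu16, Int.toNat_natCast, Memory.write_self]
        by_cases hxu : x = u
        · subst hxu
          exact ⟨fun _ => by simp, fun h => absurd ⟨by omega, hu0, hc'⟩ h⟩
        · rw [hstep x hxu, Function.update_of_ne hxu]; exact hI x hx
    · rintro s' ⟨hI, hs'⟩
      have h9' : s' 9 0 = 3 ^ K := by rw [hs' 9 (by decide), h9]
      have hcl' := hcl.step (mark' := s' 10) hv he' h10v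
        (fun x hx h1 h2 => (hI x hx).1 ⟨hx, h1, h2⟩)
        (fun x hx h1 => (hI x hx).2 fun h2 => h1 h2.2)
      -- The packing bound is applied to the enlarged family of centres, since the next mark 3^(K+1)
      -- is stored even if no further cluster is opened.
      have hK := hN _ _ hcl'.ctr_ok hcl'.separated
      have hval : (Expr.times (.lit 3) (var 9)).value s' = 3 ^ (K + 1) := by
        simp only [Expr.value, Int.toNat_zero, h9', pow_succ]; ring
      refine Does.setVar ?_ ⟨K + 1, Function.update ctr K v, ?_, ?_, ?_⟩
      · rw [hval, Int.natAbs_pow]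
        exact (Nat.pow_le_pow_right (by norm_num) hK).trans hM
      · rw [Memory.write_cell, hval]
      · rw [Memory.write_of_ne _ (by decide)]; exact hcl'
      · intro x hx hxv hok
        rw [Memory.write_of_ne _ (by decide)]
        by_cases hc : s 10 x = 0 ∧ Near s₀ n g x v
        · rw [(hI x hx).1 ⟨hx, hc⟩]; positivity
        · rw [(hI x hx).2 fun h => hc h.2]
          rcases Nat.lt_succ_iff_lt_or_eq.1 hxv with h | rfl
          · exact hdone x hx h hok
          · exact absurd ⟨h10v, hnear x⟩ hc
  · rintro s' ⟨K, ctr, h9, hcl, hdone⟩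
    exact ⟨K, ctr, hN K ctr hcl.ctr_ok hcl.separated, h9, hcl, fun x hx => hdone x hx hx⟩

end RAM

/-! ### Removing monochromatic edges and searching over all codes -/

namespace RAM

/-- Uncolor both ends of every monochromatic edge, one edge after the other. -/
def cleanProgram : Program :=
  forLoop 6 (.times numE numE) (.cond (.times (.times (.read 1 (var 6)) (.minus (.lit 1)
      (.times (.minus (.read 12 rowE) (.read 12 colE)) (.minus (.read 12 rowE) (.read 12 colE)))))
      (.read 12 rowE))
    (.seq (.assign 12 rowE (.lit 0)) (.assign 12 colE (.lit 0))) .skip)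

/-- `S` covers the monochromatic edges of `c`. -/
def Covers (n : ℕ) (adj : ℕ → ℕ → Prop) (c : ℕ → ℤ) (S : Finset ℕ) : Prop :=
  ∀ x y, x < n → y < n → adj x y → c x = c y → x ∈ S ∨ y ∈ S

/-- The adjacency matrix of `adj` is stored in bank `1`. -/
def StoresAdj (n : ℕ) (adj : ℕ → ℕ → Prop) (s : Memory) : Prop :=
  ∀ x y, x < n → y < n → s 1 (x * n + y) = 1 ∧ adj x y ∨ s 1 (x * n + y) = 0 ∧ ¬ adj x y

/-- The edges whose ends are uncolored form a matching, and a vertex cover of the initial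
monochromatic edges contains an end of each. The invariant counts the uncolored vertices against the
uncolored members of the cover, so that each round adds at most two on one side and at least one on
the other. -/
theorem Does.cleanProgram {M n : ℕ} {adj : ℕ → ℕ → Prop} {s₀ : Memory} (hn : s₀ 0 0 = n)
    (hadj : StoresAdj n adj s₀) (hirr : ∀ x, ¬ adj x x) (hc : ∀ x, x < n → 0 < s₀ 12 x)
    (hnM : n * n ≤ M) :
    Does M cleanProgram s₀ (n * n * (1 + 1 + 1 + 2) + 2) fun s =>
      (∀ x, x < n → s 12 x = 0 ∨ s 12 x = s₀ 12 x) ∧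
      (∀ x y, x < n → y < n → adj x y → s 12 x = s 12 y → s 12 x = 0) ∧
      ∀ S, Covers n adj (s₀ 12) S → ((Finset.range n).filter fun x => s 12 x = 0).card ≤
        2 * (S.filter fun x => s 12 x = 0).card := by
  refine Does.mono (Does.forLoop (n := n * n) (k := 1 + 1 + 1) (fun t s =>
      (∀ x, x < n → s 12 x = 0 ∨ s 12 x = s₀ 12 x) ∧
      (∀ x y, x < n → y < n → x * n + y < t → adj x y → s 12 x = s 12 y → s 12 x = 0) ∧
      ∀ S, Covers n adj (s₀ 12) S → ((Finset.range n).filter fun x => s 12 x = 0).card ≤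
        2 * (S.filter fun x => s 12 x = 0).card) (by decide) hnM ?_ ?_ ?_ ?_) le_rfl ?_
  · intro s hs
    simp [Expr.value, hs 0 (by decide) (by decide), hn]
  · intro j s s' h hI
    rw [h 12 (by decide)]; exact hI
  · refine ⟨fun x _ => Or.inr rfl, by simp, fun S _ => ?_⟩
    rw [Finset.filter_false_of_mem]
    · simp
    · intro x hx; exact (hc x (Finset.mem_range.1 hx)).ne'
  · rintro t ht s h6 hs ⟨hI1, hI2, hI3⟩
    have hn0 : 0 < n := Nat.pos_of_ne_zero (by rintro rfl; simp at ht)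
    obtain ⟨i, j, hi, hj, rfl⟩ : ∃ i j, i < n ∧ j < n ∧ t = i * n + j :=
      ⟨t / n, t % n, Nat.div_lt_of_lt_mul ht, Nat.mod_lt _ hn0, (Nat.div_add_mod' t n).symm⟩
    have e1 : (i * n + j) / n = i := by
      rw [mul_comm, Nat.mul_add_div hn0, Nat.div_eq_of_lt hj, add_zero]
    have e2 : (i * n + j) % n = j := by
      rw [mul_comm, Nat.mul_add_mod, Nat.mod_eq_of_lt hj]
    have h0 : s 0 0 = n := by rw [hs 0 (by decide) (by decide), hn]
    have h1 : s 1 = s₀ 1 := hs 1 (by decide) (by decide)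
    have hrow := value_rowE h0 h6
    have hcol := value_colE h0 h6
    rw [e1] at hrow
    rw [e2] at hcol
    have hval : (Expr.times (.times (.read 1 (var 6)) (.minus (.lit 1)
        (.times (.minus (.read 12 rowE) (.read 12 colE)) (.minus (.read 12 rowE) (.read 12 colE)))))
        (.read 12 rowE)).value s =
        s₀ 1 (i * n + j) * (1 - (s 12 i - s 12 j) * (s 12 i - s 12 j)) * s 12 i := by
      change s 1 ((s 6 0).toNat) * (1 - (s 12 ((rowE.value s).toNat) - s 12 ((colE.value s).toNat)) *
        (s 12 ((rowE.value s).toNat) - s 12 ((colE.value s).toNat))) * s 12 ((rowE.value s).toNat) = _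
      rw [hrow, hcol, h6, h1, Int.toNat_natCast, Int.toNat_natCast, Int.toNat_natCast]
    have hlt : ∀ x y, x < n → y < n → x * n + y < i * n + j + 1 →
        x * n + y < i * n + j ∨ x = i ∧ y = j := by
      intro x y hx hy h
      rcases Nat.lt_succ_iff_lt_or_eq.1 h with h | h
      · exact Or.inl h
      · have f1 : (x * n + y) / n = x := by
          rw [mul_comm, Nat.mul_add_div hn0, Nat.div_eq_of_lt hy, add_zero]
        have f2 : (x * n + y) % n = y := by
          rw [mul_comm, Nat.mul_add_mod, Nat.mod_eq_of_lt hy]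
        rw [h, e1] at f1
        rw [h, e2] at f2
        exact Or.inr ⟨f1.symm, f2.symm⟩
    have hci : s 12 i = 0 ∨ 0 < s 12 i := by
      rcases hI1 i hi with h | h
      · exact Or.inl h
      · exact Or.inr (h ▸ hc i hi)
    have hcj : s 12 j = 0 ∨ 0 < s 12 j := by
      rcases hI1 j hj with h | h
      · exact Or.inl h
      · exact Or.inr (h ▸ hc j hj)
    refine Does.cond (fun he => ?_) (fun he => ?_)
    · rw [hval] at he
      have hA : s₀ 1 (i * n + j) = 1 ∧ adj i j := by
        rcases hadj i j hi hj with h | h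
        · exact h
        · rw [h.1] at he; simp at he
      rw [hA.1, one_mul] at he
      have hipos : 0 < s 12 i := by
        rcases hci with h | h
        · rw [h] at he; simp at he
        · exact h
      have heq : s 12 i = s 12 j := by
        have h2 : 0 < 1 - (s 12 i - s 12 j) * (s 12 i - s 12 j) := pos_of_mul_pos_left he hipos.le
        have h3 : (s 12 i - s 12 j) * (s 12 i - s 12 j) = 0 := by
          have := mul_self_nonneg (s 12 i - s 12 j); omega
        have := mul_self_eq_zero.1 h3
        omega
      have hij : i ≠ j := by rintro rfl; exact hirr _ hA.2
      refine Does.seq (Does.assign (by simp [Expr.value]) ?_)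
      set s1 := s.write 12 (rowE.value s).toNat ((Expr.lit 0).value s) with hs1
      have hcol' : colE.value s1 = (j : ℤ) := by
        rw [← e2]
        exact value_colE (by rw [hs1, Memory.write_of_ne _ (by decide), h0])
          (by rw [hs1, Memory.write_of_ne _ (by decide), h6])
      refine Does.assign (by simp [Expr.value]) ?_
      have hnew : (s1.write 12 (colE.value s1).toNat ((Expr.lit 0).value s1)) 12 =
          Function.update (Function.update (s 12) i 0) j 0 := by
        rw [Memory.write_self, hcol', hs1, Memory.write_self, hrow]
        simp [Expr.value]
      rw [hnew]
      set c' := Function.update (Function.update (s 12) i 0) j 0 with hc'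
      have hc'0 : ∀ x, x = i ∨ x = j → c' x = 0 := by
        rintro x (rfl | rfl)
        · rw [hc', Function.update_of_ne hij]; simp
        · simp [hc']
      have hc'1 : ∀ x, ¬ (x = i ∨ x = j) → c' x = s 12 x := by
        intro x hx
        rw [not_or] at hx
        rw [hc', Function.update_of_ne hx.2, Function.update_of_ne hx.1]
      refine ⟨fun x hx => ?_, fun x y hx hy hxy hadjxy hcxy => ?_, fun S hS => ?_⟩
      · by_cases hx' : x = i ∨ x = j
        · exact Or.inl (hc'0 x hx')
        · rw [hc'1 x hx']; exact hI1 x hx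
      · by_cases hx' : x = i ∨ x = j
        · exact hc'0 x hx'
        · by_cases hy' : y = i ∨ y = j
          · rw [hcxy, hc'0 y hy']
          · rw [hc'1 x hx'] at hcxy ⊢
            rw [hc'1 y hy'] at hcxy
            rcases hlt x y hx hy hxy with h | h
            · exact hI2 x y hx hy h hadjxy hcxy
            · exact absurd (Or.inl h.1) hx'
      · have hi0 : s₀ 12 i = s 12 i := ((hI1 i hi).resolve_left hipos.ne').symm
        have hj0 : s₀ 12 j = s 12 j := ((hI1 j hj).resolve_left (heq ▸ hipos.ne')).symm
        obtain ⟨a, ha, haS⟩ : ∃ a, (a = i ∨ a = j) ∧ a ∈ S := by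
          rcases hS i j hi hj hA.2 (by rw [hi0, hj0, heq]) with h | h
          · exact ⟨i, Or.inl rfl, h⟩
          · exact ⟨j, Or.inr rfl, h⟩
        -- Both ends were still colored, so the member `a` of the cover is newly uncolored and is
        -- not counted twice.
        have ha0 : s 12 a ≠ 0 := by
          rcases ha with rfl | rfl
          · exact hipos.ne'
          · exact heq ▸ hipos.ne'
        have g1 : ((Finset.range n).filter fun x => c' x = 0) ⊆
            insert i (insert j ((Finset.range n).filter fun x => s 12 x = 0)) := by
          intro x hx
          rw [Finset.mem_filter] at hx
          by_cases hx' : x = i ∨ x = j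
          · rcases hx' with rfl | rfl <;> simp
          · rw [hc'1 x hx'] at hx
            simp only [Finset.mem_insert, Finset.mem_filter]
            exact Or.inr (Or.inr hx)
        have g2 : insert a (S.filter fun x => s 12 x = 0) ⊆ S.filter fun x => c' x = 0 := by
          intro x hx
          rw [Finset.mem_insert, Finset.mem_filter] at hx
          rw [Finset.mem_filter]
          rcases hx with rfl | hx
          · exact ⟨haS, hc'0 _ ha⟩
          · refine ⟨hx.1, ?_⟩
            by_cases hx' : x = i ∨ x = j
            · exact hc'0 x hx'
            · rw [hc'1 x hx', hx.2]
        have g3 := Finset.card_le_card g1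
        have g4 := Finset.card_le_card g2
        rw [Finset.card_insert_of_notMem (by simp [ha0])] at g4
        have g5 := Finset.card_insert_le i (insert j ((Finset.range n).filter fun x => s 12 x = 0))
        have g6 := Finset.card_insert_le j ((Finset.range n).filter fun x => s 12 x = 0)
        have g7 := hI3 S hS
        omega
    · rw [hval] at he
      refine (Does.skip ⟨hI1, fun x y hx hy hxy hadjxy hcxy => ?_, hI3⟩).mono (by norm_num)
        fun _ h => h
      rcases hlt x y hx hy hxy with h | ⟨rfl, rfl⟩
      · exact hI2 x y hx hy h hadjxy hcxy
      · rcases hadj x y hx hy with h | h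
        · rw [h.1, hcxy] at he
          rcases hcj with h' | h'
          · rw [hcxy, h']
          · simp at he; omega
        · exact absurd hadjxy h.2
  · rintro s ⟨h1, h2, h3⟩
    exact ⟨h1, fun x y hx hy => h2 x y hx hy (by nlinarith), h3⟩

/-- The color that the code `c` gives to a vertex with mark `m`. -/
def baseColor (c m : ℤ) : ℤ := c / m % 3 + 1

/-- Compute the coloring for one code, uncolor the ends of monochromatic edges and keep the result
if it is the best so far. -/
def tryProgram : Program :=
  .seq (fill 12 15 numE (.plus (.minus (.quot (var 11) (.read 10 (var 15))) (.times (.lit 3)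
    (.quot (.quot (var 11) (.read 10 (var 15))) (.lit 3)))) (.lit 1)))
  (.seq cleanProgram
  (.seq (accumulate 14 15 numE (.quot (.plus (.read 12 (var 15)) (.lit 2)) (.lit 3)))
  (.cond (.minus (var 14) (var 13))
    (.seq (setVar 13 (var 14)) (fill 2 15 numE (.read 12 (var 15)))) .skip)))

/-- Try all codes. -/
def searchProgram : Program := forLoop 11 (var 9) tryProgram

/-- A partial proper coloring with the colors `1, 2, 3`. -/
def IsProper (n : ℕ) (adj : ℕ → ℕ → Prop) (c : ℕ → ℤ) : Prop :=
  (∀ x, x < n → 0 ≤ c x ∧ c x ≤ 3) ∧ ∀ x y, x < n → y < n → adj x y → c x = c y → c x = 0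

/-- The number of colored vertices. -/
def colored (n : ℕ) (c : ℕ → ℤ) : ℕ := ((Finset.range n).filter fun x => c x ≠ 0).card

theorem colored_le (n : ℕ) (c : ℕ → ℤ) : colored n c ≤ n :=
  (Finset.card_filter_le _ _).trans (by simp)

theorem colored_congr {n : ℕ} {c c' : ℕ → ℤ} (h : ∀ x, x < n → c x = c' x) :
    colored n c = colored n c' := by
  unfold colored
  congr 1
  exact Finset.filter_congr fun x hx => by rw [h x (Finset.mem_range.1 hx)]

theorem IsProper.congr {n : ℕ} {adj : ℕ → ℕ → Prop} {c c' : ℕ → ℤ} (hc : IsProper n adj c)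
    (h : ∀ x, x < n → c' x = c x) : IsProper n adj c' := by
  refine ⟨fun x hx => by rw [h x hx]; exact hc.1 x hx, fun x y hx hy hxy => ?_⟩
  rw [h x hx, h y hy]
  exact hc.2 x y hx hy hxy

/-- The integer quotient (c + 2)/3 is 0 at c = 0 and 1 at c = 1, 2, 3, so it is the indicator of
being colored. -/
theorem sum_eq_colored {l : ℕ} {c : ℕ → ℤ} (hc : ∀ x, x < l → 0 ≤ c x ∧ c x ≤ 3) :
    ∑ x ∈ Finset.range l, (c x + 2) / 3 = colored l c := by
  rw [colored, Finset.card_filter]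
  push_cast
  refine Finset.sum_congr rfl fun x hx => ?_
  have := hc x (Finset.mem_range.1 hx)
  split_ifs <;> omega

/-- The number of steps of `tryProgram`. -/
def trySteps (n : ℕ) : ℕ :=
  (n * 3 + 2) + ((n * n * (1 + 1 + 1 + 2) + 2) + ((n * 3 + 3) + (1 + (n * 3 + 2) + 1)))

/-- The best result so far is kept in bank 2 and its size in bank 13. Each code loses at most twice
any cover of its monochromatic edges, so the final result is at least as good as the guarantee for
every single code. -/
theorem Does.searchProgram {M n w : ℕ} {adj : ℕ → ℕ → Prop} {s₀ : Memory} (hn : s₀ 0 0 = n)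
    (hadj : StoresAdj n adj s₀) (hirr : ∀ x, ¬ adj x x) (h9 : s₀ 9 0 = w) (h13 : s₀ 13 0 = 0)
    (h2 : ∀ x, x < n → s₀ 2 x = 0) (hnM : n * n ≤ M) (hwM : w ≤ M) (hM : 3 ≤ M) :
    Does M searchProgram s₀ (w * (trySteps n + 2) + 2) fun s => IsProper n adj (s 2) ∧
      ∀ c : ℕ, c < w → ∀ S, Covers n adj (fun x => baseColor c (s₀ 10 x)) S →
        n ≤ colored n (s 2) + 2 * S.card := by
  have hnn : n ≤ M := by nlinarith [Nat.le_mul_self n]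
  refine Does.mono (Does.forLoop (k := trySteps n) (fun c s => IsProper n adj (s 2) ∧
      s 13 0 = colored n (s 2) ∧
      ∀ c' : ℕ, c' < c → ∀ S, Covers n adj (fun x => baseColor c' (s₀ 10 x)) S →
        n ≤ colored n (s 2) + 2 * S.card) (by decide) hwM ?_ ?_ ?_ ?_) le_rfl ?_
  · intro s hs
    simp [Expr.value, hs 9 (by decide) (by decide), h9]
  · intro j s s' h hI
    rw [h 2 (by decide), h 13 (by decide)]; exact hI
  · refine ⟨⟨fun x hx => by simp [h2 x hx], fun x _ hx _ _ _ => h2 x hx⟩, ?_, by simp⟩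
    rw [h13, colored, Finset.filter_false_of_mem]
    · simp
    · intro x hx; simpa using h2 x (Finset.mem_range.1 hx)
  · rintro c hc s h11 hs ⟨hI1, hI2, hI3⟩
    have h0 : s 0 0 = n := by rw [hs 0 (by decide) (by decide), hn]
    have h1 : s 1 = s₀ 1 := hs 1 (by decide) (by decide)
    have h10 : s 10 = s₀ 10 := hs 10 (by decide) (by decide)
    -- This includes unmarked vertices: their mark is 0 and c / 0 = 0, so they receive color 1.
    -- Every vertex is colored before the cleaning starts.
    have hbc : ∀ x, 1 ≤ baseColor c (s₀ 10 x) ∧ baseColor c (s₀ 10 x) ≤ 3 := by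
      intro x; unfold baseColor; omega
    refine Does.seq (Does.mono (Does.frame (Does.fill (fun x => baseColor c (s₀ 10 x))
      (by decide) hnn ?_ ?_)) le_rfl ?_)
    · intro s' hs'
      simp [Expr.value, hs' 0 (by decide) (by decide), h0]
    · intro x hx s' h15 hs'
      refine ⟨?_, by have := hbc x; omega⟩
      simp only [Expr.value, Int.toNat_zero, h15, Int.toNat_natCast, hs' 11 (by decide) (by decide),
        hs' 10 (by decide) (by decide), h11, h10, baseColor, Int.emod_def]
    rintro s1 ⟨h12, hs1⟩
    have h0₁ : s1 0 0 = n := by rw [hs1 0 (by decide), h0]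
    have h1₁ : s1 1 = s₀ 1 := by rw [hs1 1 (by decide), h1]
    refine Does.seq (Does.mono (Does.frame (Does.cleanProgram h0₁
      (by unfold StoresAdj; rw [h1₁]; exact hadj) hirr (fun x hx => ?_) hnM)) le_rfl ?_)
    · rw [h12 x hx]; have := hbc x; omega
    rintro s2 ⟨⟨hc1, hc2, hc3⟩, hs2⟩
    have h0₂ : s2 0 0 = n := by rw [hs2 0 (by decide), h0₁]
    have hrange : ∀ x, x < n → 0 ≤ s2 12 x ∧ s2 12 x ≤ 3 := by
      intro x hx
      have := hbc x
      rcases hc1 x hx with h | h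
      · omega
      · rw [h, h12 x hx]; omega
    have hprop : IsProper n adj (s2 12) := ⟨hrange, hc2⟩
    have hcov : ∀ S, Covers n adj (fun x => baseColor c (s₀ 10 x)) S →
        n ≤ colored n (s2 12) + 2 * S.card := by
      intro S hS
      have g1 := hc3 S fun x y hx hy hxy h => hS x y hx hy hxy (by
        rw [h12 x hx, h12 y hy] at h; exact h)
      have g2 : (S.filter fun x => s2 12 x = 0).card ≤ S.card := Finset.card_filter_le _ _
      have g3 := Finset.card_filter_add_card_filter_not (s := Finset.range n) (fun x => s2 12 x = 0)
      rw [Finset.card_range] at g3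
      unfold colored
      simp only [ne_eq]
      omega
    refine Does.seq (Does.mono (Does.frame (Does.accumulate (fun x => (s2 12 x + 2) / 3)
      (by decide) hnn ?_ ?_ ?_)) le_rfl ?_)
    · intro s' hs'
      simp [Expr.value, hs' 0 (by decide) (by decide), h0₂]
    · intro l hl
      rw [sum_eq_colored fun x hx => hrange x (by omega), Int.natAbs_natCast]
      exact (colored_le l _).trans (hl.trans hnn)
    · intro x hx s' h15 hs'
      simp [Expr.value, h15, hs' 12 (by decide) (by decide)]
    rintro s3 ⟨h14, hs3⟩
    rw [sum_eq_colored hrange] at h14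
    have h0₃ : s3 0 0 = n := by rw [hs3 0 (by decide), h0₂]
    have h12₃ : s3 12 = s2 12 := hs3 12 (by decide)
    have h2₃ : s3 2 = s 2 := by rw [hs3 2 (by decide), hs2 2 (by decide), hs1 2 (by decide)]
    have h13₃ : s3 13 0 = colored n (s 2) := by
      rw [hs3 13 (by decide), hs2 13 (by decide), hs1 13 (by decide), hI2]
    have hval : (Expr.minus (var 14) (var 13)).value s3 = colored n (s2 12) - colored n (s 2) := by
      simp only [Expr.value, Int.toNat_zero, h14, h13₃]
    refine Does.cond (fun he => ?_) (fun he => ?_)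
    · rw [hval] at he
      refine Does.seq (Does.setVar ?_ ?_)
      · simp only [Expr.value, Int.toNat_zero, h14, Int.natAbs_natCast]
        exact (colored_le n _).trans hnn
      set s4 := s3.write 13 0 ((var 14).value s3) with hs4
      have h13₄ : s4 13 0 = colored n (s2 12) := by
        rw [hs4, Memory.write_cell]; simp only [Expr.value, Int.toNat_zero, h14]
      have h0₄ : s4 0 0 = n := by rw [hs4, Memory.write_of_ne _ (by decide), h0₃]
      have h12₄ : s4 12 = s2 12 := by rw [hs4, Memory.write_of_ne _ (by decide), h12₃]
      refine Does.mono (Does.frame (Does.fill (s2 12) (by decide) hnn ?_ ?_)) le_rfl ?_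
      · intro s' hs'
        simp [Expr.value, hs' 0 (by decide) (by decide), h0₄]
      · intro x hx s' h15 hs'
        refine ⟨by simp [Expr.value, h15, hs' 12 (by decide) (by decide), h12₄], ?_⟩
        have := hrange x hx
        omega
      · rintro s' ⟨h2', hs'⟩
        have hcol : colored n (s' 2) = colored n (s2 12) := colored_congr h2'
        refine ⟨hprop.congr h2', ?_, fun c' hc' S hS => ?_⟩
        · rw [hs' 13 (by decide), h13₄, hcol]
        · rw [hcol]
          rcases Nat.lt_succ_iff_lt_or_eq.1 hc' with h | rfl
          · have := hI3 c' h S hS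
            omega
          · exact hcov S hS
    · rw [hval] at he
      refine (Does.skip ?_).mono (by omega) fun _ h => h
      rw [h2₃]
      refine ⟨hI1, h13₃, fun c' hc' S hS => ?_⟩
      rcases Nat.lt_succ_iff_lt_or_eq.1 hc' with h | rfl
      · exact hI3 c' h S hS
      · have := hcov S hS
        omega
  · rintro s ⟨hI1, -, hI3⟩
    exact ⟨hI1, hI3⟩

end RAM

/-! ### Analysis of the clusters -/

namespace IsEigensystem

variable {V : Type*} [Fintype V] [DecidableEq V] {A : V → V → ℝ} {μ : V → ℝ} {ψ : V → V → ℝ}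

/-- The indices of the eigenvalues that the filter does not suppress. -/
noncomputable def bigIndices (μ : V → ℝ) (q : ℕ) : Finset V :=
  Finset.univ.filter fun i => 1 < 8 * (q * μ i ^ 2)

/-- Take τ² = 1/(8q). Since λ ≤ 1/(16q), the gap τ² - λ is at least 1/(16q), so at most 16q
eigenvalues are below -τ. Positive eigenvalues other than the top one are at most λ < τ and do not
count. -/
theorem card_bigIndices_le (h : IsEigensystem A μ ψ) (hA : IsSymmStochastic A) {lam : ℝ}
    (h0 : 0 < lam) (h1 : lam < 1) {i₀ : V} (hμ : ∀ i, i ≠ i₀ → μ i ≤ lam) {q r : ℕ} (hq : 0 < q)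
    (hqr : 16 * q ≤ r) (hr : r * lam ≤ 1) : (bigIndices μ q).card ≤ r + 1 := by
  have hq' : (0 : ℝ) < q := by exact_mod_cast hq
  have hqr' : 16 * (q : ℝ) ≤ r := by exact_mod_cast hqr
  have hql : 16 * q * lam ≤ 1 := le_trans (by gcongr) hr
  set τ : ℝ := √(1 / (8 * q)) with hτ
  have hτ2 : τ ^ 2 = 1 / (8 * q) := Real.sq_sqrt (by positivity)
  have hτ0 : 0 ≤ τ := Real.sqrt_nonneg _
  have hτ3 : 8 * (q * τ ^ 2) = 1 := by rw [hτ2]; field_simp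
  set S : Finset V := Finset.univ.filter fun i => μ i ≤ -τ with hS
  have hcount := h.card_mul_le_one hA (h.quadratic_le_of_eigenvalue_le hA h0.le h1 hμ) hτ0
    (S := S) (by intro i hi; simpa [hS] using hi)
  have hScard : S.card ≤ 16 * q := by
    have h2 : 1 ≤ 16 * q * (τ ^ 2 - lam) := by nlinarith
    have h3 : (S.card : ℝ) ≤ 16 * q := by
      have h4 : (S.card : ℝ) * 1 ≤ S.card * (16 * q * (τ ^ 2 - lam)) := by gcongr
      nlinarith
    exact_mod_cast h3
  have hsub : bigIndices μ q ⊆ insert i₀ S := by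
    intro i hi
    have hi' : 1 < 8 * (q * μ i ^ 2) := by simpa [bigIndices] using hi
    rw [Finset.mem_insert]
    by_cases hi0 : i = i₀
    · exact Or.inl hi0
    · right
      simp only [hS, Finset.mem_filter, Finset.mem_univ, true_and]
      have h2 : τ ^ 2 < μ i ^ 2 := by
        have : 8 * q * τ ^ 2 < 8 * q * μ i ^ 2 := by linarith
        exact lt_of_mul_lt_mul_left this (by positivity)
      by_contra hlt
      rw [not_le] at hlt
      have h3 : τ < μ i := by
        by_contra h4
        rw [not_lt] at h4
        nlinarith
      have h4 := hμ i hi0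
      nlinarith
  refine (Finset.card_le_card hsub).trans ((Finset.card_insert_le _ _).trans ?_)
  omega

/-- The parameters of the filter are compatible. -/
structure FilterParams (n g r q m : ℕ) : Prop where
  q_le : 16 * q ≤ r
  lt_q : r < 32 * q
  g_pos : 0 < g
  le_m : n + 1024 * (g * g) ≤ 2 ^ m

/-- The filtered eigenvalues. -/
noncomputable def filtered (μ : V → ℝ) (q m : ℕ) (i : V) : ℝ := specFilter q m (μ i ^ 2)

theorem filtered_mem (h : IsEigensystem A μ ψ) (hA : IsSymmStochastic A) (q m : ℕ) (i : V) :
    0 ≤ filtered μ q m i ∧ filtered μ q m i ≤ 1 :=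
  specFilter_mem (sq_nonneg _) (h.sq_eigenvalue_le_one hA i) q m

theorem filtered_large (h : IsEigensystem A μ ψ) (hA : IsSymmStochastic A) {q : ℕ} (hq : 0 < q)
    (m : ℕ) (i : V) : 5 / 8 ≤ filtered μ q m i ∨ μ i ^ 2 ≤ 2 / q := by
  have hq' : (0 : ℝ) < q := by exact_mod_cast hq
  by_cases hi : 2 ≤ q * μ i ^ 2
  · exact Or.inl (specFilter_large (sq_nonneg _) (h.sq_eigenvalue_le_one hA i) hi m)
  · right
    rw [le_div_iff₀ hq']
    linarith

theorem filtered_small (h : IsEigensystem A μ ψ) (hA : IsSymmStochastic A) (q m : ℕ) {i : V}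
    (hi : i ∉ bigIndices μ q) : filtered μ q m i ≤ (1 / 2) ^ 2 ^ m / 2 := by
  have hi' : 8 * (q * μ i ^ 2) ≤ 1 := by simpa [bigIndices] using hi
  have := specFilter_small (sq_nonneg _) (h.sq_eigenvalue_le_one hA i) hi' m
  unfold filtered
  linarith

/-- The summand n in the stopping value of the filter absorbs the factor n, and the summand 1024g²
brings the suppressed part below the resolution of the clusters. -/
theorem FilterParams.mul_half_pow_le {n g r q m : ℕ} (hp : FilterParams n g r q m) :
    (n : ℝ) * (1 / 2) ^ 2 ^ m ≤ 1 / (1024 * (g * g)) := by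
  have hg : (0 : ℝ) < g := by exact_mod_cast hp.g_pos
  have h1 : (1 / 2 : ℝ) ^ 2 ^ m ≤ (1 / 2) ^ (n + 1024 * (g * g)) :=
    pow_le_pow_of_le_one (by norm_num) (by norm_num) hp.le_m
  have h2 : (n : ℝ) ≤ 2 ^ n := by exact_mod_cast Nat.lt_two_pow_self.le
  have h3 : (1024 * (g * g) : ℝ) ≤ 2 ^ (1024 * (g * g)) := by
    exact_mod_cast (Nat.lt_two_pow_self (n := 1024 * (g * g))).le
  have h4 : (1 / 2 : ℝ) ^ (n + 1024 * (g * g)) = 1 / (2 ^ n * 2 ^ (1024 * (g * g))) := by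
    rw [one_div_pow, pow_add]
  calc (n : ℝ) * (1 / 2) ^ 2 ^ m ≤ 2 ^ n * (1 / (2 ^ n * 2 ^ (1024 * (g * g)))) := by
        rw [← h4]; gcongr
    _ = 1 / 2 ^ (1024 * (g * g)) := by field_simp
    _ ≤ 1 / (1024 * (g * g)) := by gcongr

/-- A bound for the number of clusters. -/
def clusterBound (g r : ℕ) : ℕ := (2 * (32 * g * (r + 1)) * (r + 1) + 1) ^ (r + 1)

/-- Packing with κ = 1/(1024g²), radius r + 1 and mesh parameter s = 32g(r + 1), for which κs² = (r
+ 1)² is at least the dimension r + 1. -/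
theorem card_centres_le (h : IsEigensystem A μ ψ) (hA : IsSymmStochastic A) {g r q m : ℕ}
    (hp : FilterParams (Fintype.card V) g r q m) (hbig : (bigIndices μ q).card ≤ r + 1)
    {T : Finset V}
    (hsep : ∀ u ∈ T, ∀ v ∈ T, u ≠ v →
      1 < 512 * (g * g) * (Fintype.card V * specDist ψ (filtered μ q m) u v))
    (hnorm : ∀ v ∈ T, Fintype.card V * specKernel ψ (filtered μ q m) v v ≤ r * (r + 2)) :
    T.card ≤ clusterBound g r := by
  have hg : (0 : ℝ) < g := by exact_mod_cast hp.g_pos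
  refine h.card_separated_le (F := filtered μ q m) (fun i => (h.filtered_mem hA q m i).1)
    (B := bigIndices μ q) (ε := (1 / 2) ^ 2 ^ m / 2) (κ := 1 / (1024 * (g * g)))
    (fun u hu v hv huv => ?_) (fun v hv => ?_) (by positivity)
    (fun i hi => h.filtered_small hA q m hi) ?_ hbig ?_ ?_
  · have h1 := hsep u hu v hv huv
    have h2 : 2 * (1 / (1024 * (g * g) : ℝ)) = 1 / (512 * (g * g)) := by field_simp; norm_num
    rw [h2, div_lt_iff₀ (by positivity)]
    linarith
  · refine (hnorm v hv).trans ?_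
    push_cast
    nlinarith
  · refine le_trans (le_of_eq ?_) hp.mul_half_pow_le
    ring
  · have := hp.g_pos
    positivity
  · push_cast
    have : 1 / (1024 * (g * g) : ℝ) * (32 * g * (r + 1)) ^ 2 = (r + 1) ^ 2 := by field_simp; norm_num
    rw [this]
    nlinarith [(Nat.cast_nonneg r : (0 : ℝ) ≤ r)]

/-- Few vertices have large norm. -/
theorem card_large_norm_mul_le (h : IsEigensystem A μ ψ) (hA : IsSymmStochastic A) {g r q m : ℕ}
    (hp : FilterParams (Fintype.card V) g r q m) (hbig : (bigIndices μ q).card ≤ r + 1)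
    {T : Finset V}
    (hnorm : ∀ v ∈ T, r * (r + 2) ≤ Fintype.card V * specKernel ψ (filtered μ q m) v v) :
    (T.card : ℝ) * r ≤ Fintype.card V := by
  have hg : (1 : ℝ) ≤ g := by exact_mod_cast hp.g_pos
  -- The trace: at most r + 1 unsuppressed eigenvalues, each at most 1, and a suppressed part that
  -- sums to at most 1. Markov's inequality for the diagonal then gives the claim.
  have htr : ∑ i, filtered μ q m i ≤ r + 2 := by
    rw [← Finset.sum_add_sum_compl (bigIndices μ q)]
    have h1 : ∑ i ∈ bigIndices μ q, filtered μ q m i ≤ r + 1 := by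
      refine (Finset.sum_le_sum fun i _ => (h.filtered_mem hA q m i).2).trans ?_
      simp only [Finset.sum_const, nsmul_eq_mul, mul_one]
      exact_mod_cast hbig
    have h2 : ∑ i ∈ (bigIndices μ q)ᶜ, filtered μ q m i ≤ 1 := by
      calc ∑ i ∈ (bigIndices μ q)ᶜ, filtered μ q m i
          ≤ ∑ i ∈ (bigIndices μ q)ᶜ, (1 / 2 : ℝ) ^ 2 ^ m / 2 :=
            Finset.sum_le_sum fun i hi => h.filtered_small hA q m (Finset.mem_compl.1 hi)
        _ ≤ Fintype.card V * ((1 / 2 : ℝ) ^ 2 ^ m / 2) := by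
            rw [Finset.sum_const, nsmul_eq_mul]
            gcongr
            exact Finset.card_le_univ _
        _ ≤ Fintype.card V * (1 / 2 : ℝ) ^ 2 ^ m := by
            gcongr
            exact half_le_self (by positivity)
        _ ≤ 1 / (1024 * (g * g)) := hp.mul_half_pow_le
        _ ≤ 1 := by
            rw [div_le_one (by positivity)]
            nlinarith
    linarith
  have hsum : (T.card : ℝ) * (r * (r + 2)) ≤ Fintype.card V * (r + 2) := by
    calc (T.card : ℝ) * (r * (r + 2)) = ∑ v ∈ T, ((r : ℝ) * (r + 2)) := by simp
      _ ≤ ∑ v ∈ T, Fintype.card V * specKernel ψ (filtered μ q m) v v := Finset.sum_le_sum hnorm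
      _ ≤ ∑ v, Fintype.card V * specKernel ψ (filtered μ q m) v v := by
          refine Finset.sum_le_sum_of_subset_of_nonneg (Finset.subset_univ _) fun v _ _ => ?_
          refine mul_nonneg (Nat.cast_nonneg _) (Finset.sum_nonneg fun i _ => ?_)
          exact mul_nonneg (h.filtered_mem hA q m i).1 (mul_self_nonneg _)
      _ = Fintype.card V * ∑ i, filtered μ q m i := by
          rw [← Finset.mul_sum, h.sum_specKernel_self]
      _ ≤ _ := by gcongr
  have hr : (0 : ℝ) < r + 2 := by positivity
  refine le_of_mul_le_mul_right ?_ hr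
  linarith

/-- All but few vertices of a one-sided expander with a `3`-coloring are colored according to their
clusters. -/
theorem exists_bad_set [Nonempty V] (h : IsEigensystem A μ ψ) (hA : IsSymmStochastic A)
    {lam γ σ η : ℝ} (h0 : 0 ≤ lam) (hσ : 0 ≤ σ) (hγ : 0 < γ)
    (hquad : ∀ f : V → ℝ, ∑ u, ∑ v, A u v * (f u * f v) ≤
      (∑ v, f v) ^ 2 / Fintype.card V + lam * ∑ v, f v ^ 2)
    {F : V → ℝ} (hF0 : ∀ i, 0 ≤ F i) (hF : ∀ i, 5 / 8 ≤ F i ∨ μ i ^ 2 ≤ σ)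
    {χ : V → Fin 3} {S : Finset V} (hS : ∀ u v, A u v ≠ 0 → χ u = χ v → u ∈ S ∨ v ∈ S)
    (hχ : ∀ a, ((Finset.univ.filter fun x => χ x = a).card : ℝ) ≤ (1 / 2 - γ) * Fintype.card V)
    (hη : 512 * η ≤ γ ^ 2) :
    ∃ B : Finset V, (B.card : ℝ) ≤ 16 * S.card / γ + 18 * lam * Fintype.card V / γ +
        1024 * σ * Fintype.card V / γ ^ 2 ∧
      ∀ u v, u ∉ B → v ∉ B → Fintype.card V * specDist ψ F u v ≤ 4 * η → χ u = χ v := by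
  classical
  set n : ℝ := ((Fintype.card V : ℕ) : ℝ) with hn
  have hn0 : 0 < n := Nat.cast_pos.2 Fintype.card_pos
  set f : Fin 3 → V → ℝ := fun a v => if χ v = a then 1 else 0 with hf
  set H : Fin 3 → V → ℝ := fun a v => ∑ w, A v w * f a w with hH
  have hfsq : ∀ a, ∑ v, f a v ^ 2 = ((Finset.univ.filter fun x => χ x = a).card : ℝ) := by
    intro a
    simp only [hf, ite_pow, one_pow, ne_eq, OfNat.ofNat_ne_zero, not_false_eq_true, zero_pow]
    simp
  have hfn : ∑ a, ((Finset.univ.filter fun x => χ x = a).card : ℝ) = n := by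
    rw [hn, ← Nat.cast_sum]
    congr 1
    rw [← Finset.card_univ]
    exact (Finset.card_eq_sum_card_fiberwise (t := Finset.univ) fun x _ => Finset.mem_univ _).symm
  choose z hz1 hz2 using fun a => h.exists_profile hσ hF0 hF (h.sq_eigenvalue_le_one hA) (f a)
  have hHsum : ∀ v, H 0 v + H 1 v + H 2 v = 1 := by
    intro v
    rw [← hA.row_sum v]
    simp only [hH]
    rw [← Finset.sum_add_distrib, ← Finset.sum_add_distrib]
    refine Finset.sum_congr rfl fun w _ => ?_
    rw [← mul_add, ← mul_add]
    have : f 0 w + f 1 w + f 2 w = 1 := by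
      simp only [hf]
      generalize χ w = c
      fin_cases c <;> simp
    rw [this, mul_one]
  -- Three kinds of bad vertices: `B₁` has too many neighbors of its own color, `W a` has almost all
  -- its neighbors in the class a, and at `Z a` the Lipschitz approximation of the profile of a is
  -- poor.
  set B₁ : Finset V := Finset.univ.filter fun v => γ / 8 < H (χ v) v with hB₁
  set W : Fin 3 → Finset V := fun a => Finset.univ.filter fun v => 1 - γ / 2 ≤ H a v with hW
  set Z : Fin 3 → Finset V := fun a => Finset.univ.filter fun v => γ / 32 < |z a v| with hZ
  have hH0 : ∀ a v, 0 ≤ H a v := fun a v => Finset.sum_nonneg fun w _ =>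
    mul_nonneg (hA.nonneg v w) (by simp only [hf]; split_ifs <;> norm_num)
  have hB₁card : (B₁.card : ℝ) ≤ 16 * S.card / γ := by
    -- Every monochromatic edge has an end in S, and each vertex of S accounts for weight at most 1
    -- in either direction of its edges.
    have h1 : ∑ v, H (χ v) v ≤ 2 * S.card := by
      have h2 : ∀ v w, A v w * f (χ v) w ≤
          A v w * (if v ∈ S then 1 else 0) + A v w * (if w ∈ S then 1 else 0) := by
        intro v w
        rw [← mul_add]
        by_cases hvw : A v w = 0
        · simp [hvw]
        · refine mul_le_mul_of_nonneg_left ?_ (hA.nonneg v w)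
          simp only [hf]
          by_cases hc : χ w = χ v
          · rcases hS v w hvw hc.symm with h3 | h3 <;> simp [hc, h3] <;> split_ifs <;> norm_num
          · rw [if_neg hc]; positivity
      calc ∑ v, H (χ v) v ≤ ∑ v, ∑ w, (A v w * (if v ∈ S then 1 else 0) +
            A v w * (if w ∈ S then 1 else 0)) :=
            Finset.sum_le_sum fun v _ => Finset.sum_le_sum fun w _ => h2 v w
        _ = 2 * S.card := by
            simp_rw [Finset.sum_add_distrib]
            rw [hA.sum_mul_left fun v => if v ∈ S then 1 else 0,
              hA.sum_mul_right fun v => if v ∈ S then 1 else 0]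
            simp
            ring
    have h2 : (B₁.card : ℝ) * (γ / 8) ≤ ∑ v, H (χ v) v := by
      calc (B₁.card : ℝ) * (γ / 8) = ∑ v ∈ B₁, γ / 8 := by simp
        _ ≤ ∑ v ∈ B₁, H (χ v) v := Finset.sum_le_sum fun v hv => by
            simp only [hB₁, Finset.mem_filter] at hv; exact hv.2.le
        _ ≤ _ := Finset.sum_le_sum_of_subset_of_nonneg (Finset.subset_univ _) fun v _ _ => hH0 _ _
    rw [le_div_iff₀ hγ]
    linarith
  have hWcard : ∀ a, ((W a).card : ℝ) ≤ 6 * lam * n / γ := by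
    intro a
    rw [le_div_iff₀ hγ, mul_comm]
    refine card_pure_mul_le hA h0 hquad hγ (hχ a) fun v hv => ?_
    simp only [hW, Finset.mem_filter, Finset.mem_univ, true_and, hH, hf] at hv
    simpa [Finset.sum_filter] using hv
  have hZcard : ∀ a, ((Z a).card : ℝ) ≤
      1024 * σ / γ ^ 2 * ((Finset.univ.filter fun x => χ x = a).card : ℝ) := by
    intro a
    have h1 : ((Z a).card : ℝ) * (γ / 32) ^ 2 ≤ ∑ v, z a v ^ 2 := by
      calc ((Z a).card : ℝ) * (γ / 32) ^ 2 = ∑ v ∈ Z a, (γ / 32) ^ 2 := by simp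
        _ ≤ ∑ v ∈ Z a, z a v ^ 2 := Finset.sum_le_sum fun v hv => by
            simp only [hZ, Finset.mem_filter] at hv
            rw [← sq_abs (z a v)]
            exact pow_le_pow_left₀ (by positivity) hv.2.le 2
        _ ≤ _ := Finset.sum_le_sum_of_subset_of_nonneg (Finset.subset_univ _)
            fun v _ _ => sq_nonneg _
    have h2 := h1.trans (hz1 a)
    rw [hfsq] at h2
    rw [div_mul_eq_mul_div, le_div_iff₀ (by positivity)]
    linarith
  refine ⟨B₁ ∪ (Finset.univ.biUnion W ∪ Finset.univ.biUnion Z), ?_, ?_⟩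
  · have h1 : ((B₁ ∪ (Finset.univ.biUnion W ∪ Finset.univ.biUnion Z)).card : ℝ) ≤
        B₁.card + (∑ a, ((W a).card : ℝ) + ∑ a, ((Z a).card : ℝ)) := by
      have h2 := Finset.card_union_le B₁ (Finset.univ.biUnion W ∪ Finset.univ.biUnion Z)
      have h3 := Finset.card_union_le (Finset.univ.biUnion W) (Finset.univ.biUnion Z)
      have h4 : (Finset.univ.biUnion W).card ≤ ∑ a, (W a).card := Finset.card_biUnion_le
      have h5 : (Finset.univ.biUnion Z).card ≤ ∑ a, (Z a).card := Finset.card_biUnion_le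
      exact_mod_cast (show _ ≤ B₁.card + (∑ a, (W a).card + ∑ a, (Z a).card) by omega)
    have h2 : ∑ a, ((W a).card : ℝ) ≤ 18 * lam * n / γ := by
      refine (Finset.sum_le_sum fun a _ => hWcard a).trans_eq ?_
      rw [Finset.sum_const, Finset.card_univ, Fintype.card_fin, nsmul_eq_mul]
      push_cast
      ring
    have h3 : ∑ a, ((Z a).card : ℝ) ≤ 1024 * σ * n / γ ^ 2 := by
      refine (Finset.sum_le_sum fun a _ => hZcard a).trans_eq ?_
      rw [← Finset.mul_sum, hfn]
      ring
    linarith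
  · intro u v hu hv hd
    by_contra hne
    simp only [Finset.mem_union, Finset.mem_biUnion, Finset.mem_univ, true_and, not_or,
      not_exists, hB₁, hW, hZ, Finset.mem_filter, not_lt, not_le] at hu hv
    obtain ⟨hu1, -, hu3⟩ := hu
    obtain ⟨hv1, hv2, hv3⟩ := hv
    -- With c the third color, v has at most γ/8 of its neighbors in its own color and less than 1 -
    -- γ/2 in c; the remaining 3γ/8 must have the color of u.
    have hlow : 3 * γ / 8 ≤ H (χ u) v := by
      have key : ∀ a b : Fin 3, a ≠ b → ∃ c, ∀ k : Fin 3 → ℝ, k 0 + k 1 + k 2 = k a + k b + k c := by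
        intro a b hab
        fin_cases a <;> fin_cases b <;>
          first
          | exact absurd rfl hab
          | (refine ⟨0, fun k => ?_⟩; simp; ring1)
          | (refine ⟨1, fun k => ?_⟩; simp; ring1)
          | (refine ⟨2, fun k => ?_⟩; simp <;> ring1)
      obtain ⟨c, hc⟩ := key (χ u) (χ v) hne
      have h1 := hHsum v
      rw [hc fun a => H a v] at h1
      have h2 := hv2 c
      linarith
    have h1 := hz2 (χ u) v u
    have h2 := abs_le.1 (hu3 (χ u))
    have h3 := abs_le.1 (hv3 (χ u))
    -- At u the same color has weight at most γ/8, and the two approximation errors cost γ/32 each: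
    -- 3γ/8 - γ/8 - γ/16 = 3γ/16. The square of this exceeds the Lipschitz bound (32/5)η ≤ γ²/80.
    have h4 : 3 * γ / 16 ≤ (∑ w, A v w * f (χ u) w - z (χ u) v) -
        (∑ w, A u w * f (χ u) w - z (χ u) u) := by
      change 3 * γ / 16 ≤ (H (χ u) v - z (χ u) v) - (H (χ u) u - z (χ u) u)
      linarith
    have h5 := pow_le_pow_left₀ (by positivity) h4 2
    have h6 : 8 / 5 * (∑ w, f (χ u) w ^ 2) * specDist ψ F v u ≤ 8 / 5 * (4 * η) := by
      have h7 : ∑ w, f (χ u) w ^ 2 ≤ n := by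
        rw [hfsq, hn]
        exact_mod_cast Finset.card_le_univ _
      have h8 : 0 ≤ specDist ψ F v u :=
        Finset.sum_nonneg fun i _ => mul_nonneg (hF0 i) (sq_nonneg _)
      rw [specDist_comm ψ F u v] at hd
      nlinarith [mul_le_mul_of_nonneg_right h7 h8]
    nlinarith [mul_pos hγ hγ]

end IsEigensystem

/-! ### Regular graphs -/

section Graph

variable {n : ℕ} (G : SimpleGraph (Fin n)) [DecidableRel G.Adj]

theorem isSymmStochastic_normalizedAdjMatrix {d : ℕ} (hd : 0 < d) (hG : G.IsRegularOfDegree d) :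
    IsSymmStochastic (normalizedAdjMatrix G d) := by
  have hd' : (d : ℝ) ≠ 0 := by exact_mod_cast hd.ne'
  refine ⟨fun u v => ?_, fun u v => ?_, fun u => ?_⟩
  · simp only [normalizedAdjMatrix, Matrix.smul_apply, SimpleGraph.adjMatrix_apply, smul_eq_mul]
    split_ifs <;> positivity
  · simp [normalizedAdjMatrix, SimpleGraph.adj_comm]
  · simp only [normalizedAdjMatrix, Matrix.smul_apply, SimpleGraph.adjMatrix_apply, smul_eq_mul,
      ← Finset.mul_sum]
    have h1 : ∑ v, (if G.Adj u v then (1 : ℝ) else 0) = d := by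
      rw [Finset.sum_boole, ← SimpleGraph.neighborFinset_eq_filter,
        SimpleGraph.card_neighborFinset_eq_degree, hG u]
    rw [h1]
    field_simp

/-- The eigenvalues indexed by vertices are a relabeling of the sorted list; `i₀` is the label of
position 0, and every other label has position at least 1. -/
theorem exists_eigenvalues_le {d : ℕ} (hV : 2 ≤ Fintype.card (Fin n)) {lam : ℝ}
    (h : secondEigenvalue G d hV ≤ lam) :
    ∃ i₀, ∀ i, i ≠ i₀ → (normalizedAdjMatrix_isHermitian G d).eigenvalues i ≤ lam := by
  refine ⟨Fintype.equivOfCardEq (Fintype.card_fin _) ⟨0, by omega⟩, fun i hi => le_trans ?_ h⟩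
  unfold Matrix.IsHermitian.eigenvalues secondEigenvalue
  refine (normalizedAdjMatrix_isHermitian G d).eigenvalues₀_antitone ?_
  rw [Fin.le_def]
  by_contra hlt
  refine hi ?_
  rw [← Equiv.symm_apply_eq, Fin.ext_iff]
  simp only at hlt ⊢
  omega

/-- Adjacency of vertex numbers. -/
def numAdj (x y : ℕ) : Prop := ∃ i j : Fin n, x = i ∧ y = j ∧ G.Adj i j

omit [DecidableRel G.Adj] in
theorem numAdj_irrefl (x : ℕ) : ¬ numAdj G x x := by
  rintro ⟨i, j, h1, h2, h3⟩
  have : i = j := Fin.ext (h1.symm.trans h2)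
  subst this
  exact G.loopless.irrefl i h3

theorem graphInput_one (p g r : ℕ) {x y : ℕ} (hx : x < n) (hy : y < n) :
    graphInput G p g r 1 (x * n + y) = if G.Adj ⟨x, hx⟩ ⟨y, hy⟩ then 1 else 0 := by
  have hn0 : 0 < n := by omega
  have key : (∃ i j : Fin n, x * n + y = (i : ℕ) * n + (j : ℕ) ∧ G.Adj i j) ↔
      G.Adj ⟨x, hx⟩ ⟨y, hy⟩ := by
    constructor
    · rintro ⟨i, j, h1, h2⟩
      have e1 : ∀ a b : ℕ, b < n → (a * n + b) / n = a ∧ (a * n + b) % n = b := by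
        intro a b hb
        constructor
        · rw [mul_comm, Nat.mul_add_div hn0, Nat.div_eq_of_lt hb, add_zero]
        · rw [mul_comm, Nat.mul_add_mod, Nat.mod_eq_of_lt hb]
      have f1 := e1 x y hy
      rw [h1] at f1
      have f2 := e1 i j j.2
      have hi : (⟨x, hx⟩ : Fin n) = i := Fin.ext (f1.1.symm.trans f2.1)
      have hj : (⟨y, hy⟩ : Fin n) = j := Fin.ext (f1.2.symm.trans f2.2)
      rwa [hi, hj]
    · intro h
      exact ⟨_, _, rfl, h⟩
  change (if ∃ i j : Fin n, x * n + y = (i : ℕ) * n + (j : ℕ) ∧ G.Adj i j then (1 : ℤ) else 0) = _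
  simp only [key]

theorem storesAdj_graphInput (p g r : ℕ) :
    RAM.StoresAdj n (numAdj G) (graphInput G p g r) := by
  intro x y hx hy
  rw [graphInput_one G p g r hx hy]
  by_cases h : G.Adj ⟨x, hx⟩ ⟨y, hy⟩
  · exact Or.inl ⟨if_pos h, ⟨_, _, rfl, rfl, h⟩⟩
  · refine Or.inr ⟨if_neg h, ?_⟩
    rintro ⟨i, j, rfl, rfl, h'⟩
    exact h h'

theorem graphInput_one_eq (p g r m : ℕ) :
    graphInput G p g r 1 m = 0 ∨ graphInput G p g r 1 m = 1 := by
  change (if _ then (1 : ℤ) else 0) = 0 ∨ (if _ then (1 : ℤ) else 0) = 1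
  split_ifs
  · exact Or.inr rfl
  · exact Or.inl rfl

theorem graphInput_bounded {p g r M : ℕ} (hn : n ≤ M) (hp : p ≤ M) (hg : g ≤ M) (hr : r ≤ M)
    (h1 : 1 ≤ M) : RAM.Memory.Bounded M (graphInput G p g r) := by
  intro b i
  unfold graphInput
  split
  · simpa using hn
  · simpa using hp
  · simpa using hg
  · simpa using hr
  · split_ifs <;> simp [h1]
  · simp

theorem sum_graphInput {d : ℕ} (hn : 0 < n) (hG : G.IsRegularOfDegree d) (p g r : ℕ) :
    ∑ j ∈ Finset.range n, graphInput G p g r 1 j = d := by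
  rw [← Fin.sum_univ_eq_sum_range]
  have h1 : ∀ j : Fin n, graphInput G p g r 1 j = if G.Adj ⟨0, hn⟩ j then 1 else 0 := by
    intro j
    have := graphInput_one G p g r hn j.2
    simpa using this
  simp_rw [h1]
  rw [Finset.sum_boole, ← SimpleGraph.neighborFinset_eq_filter,
    SimpleGraph.card_neighborFinset_eq_degree, hG]

end Graph

/-- Ternary numbers with prescribed digits. -/
theorem exists_ternary (K : ℕ) (dig : ℕ → Fin 3) :
    ∃ c : ℕ, c < 3 ^ K ∧ ∀ t < K, c / 3 ^ t % 3 = dig t := by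
  induction K with
  | zero => exact ⟨0, by simp, by simp⟩
  | succ K ih =>
    obtain ⟨c, hc, hd⟩ := ih
    refine ⟨c + 3 ^ K * dig K, ?_, fun t ht => ?_⟩
    · have : 3 ^ K * (dig K : ℕ) ≤ 3 ^ K * 2 := Nat.mul_le_mul_left _ (by omega)
      rw [pow_succ]
      omega
    · rcases Nat.lt_succ_iff_lt_or_eq.1 ht with ht | rfl
      · rw [← hd t ht]
        obtain ⟨l, rfl⟩ := Nat.exists_eq_add_of_lt ht
        have : c + 3 ^ (t + l + 1) * (dig (t + l + 1) : ℕ) =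
            c + 3 ^ t * (3 * (3 ^ l * dig (t + l + 1))) := by ring
        rw [this, Nat.add_mul_div_left _ _ (by positivity), Nat.add_mul_mod_self_left]
      · rw [Nat.add_mul_div_left _ _ (by positivity), Nat.div_eq_of_lt hc, zero_add]
        exact Nat.mod_eq_of_lt (dig t).2

/-! ### Assembling the program -/

namespace RAM

open IsEigensystem

section Represents

variable {n : ℕ} {ψ : Fin n → Fin n → ℝ} {F : Fin n → ℝ} {E : ℕ} {s : Memory}

theorem Represents.normOK_iff (hs : Represents ψ F E s) (hE : 0 < E) (r : ℕ) (v : Fin n) :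
    NormOK s n r v ↔ n * specKernel ψ F v v ≤ r * (r + 2) := by
  have hE' : (0 : ℝ) < E := by exact_mod_cast hE
  have h1 : NormOK s n r v ↔ ((n * s 3 (v * n + v) : ℤ) : ℝ) ≤ ((r * (r + 2) * s 5 0 : ℤ) : ℝ) :=
    Int.cast_le.symm
  rw [h1, hs.1]
  push_cast
  rw [hs.2, mul_left_comm, mul_comm _ (E : ℝ), mul_le_mul_iff_right₀ hE']

theorem Represents.near_iff (hs : Represents ψ F E s) (hE : 0 < E) (g : ℕ) (u v : Fin n) :
    Near s n g u v ↔ 512 * (g * g) * (n * specDist ψ F u v) ≤ 1 := by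
  have hE' : (0 : ℝ) < E := by exact_mod_cast hE
  have h1 : Near s n g u v ↔ ((512 * (g * g) * (n * (s 3 (u * n + u) + s 3 (v * n + v) -
      2 * s 3 (u * n + v))) : ℤ) : ℝ) ≤ ((s 5 0 : ℤ) : ℝ) := Int.cast_le.symm
  rw [h1, hs.1]
  push_cast
  rw [hs.2, hs.2, hs.2, specDist_eq]
  have h2 : (512 * (g * g) * (n * (E * specKernel ψ F u u + E * specKernel ψ F v v -
      2 * (E * specKernel ψ F u v))) : ℝ) = E * (512 * (g * g) * (n * (specKernel ψ F u u +
        specKernel ψ F v v - 2 * specKernel ψ F u v))) := by ring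
  rw [h2]
  constructor
  · intro h
    exact le_of_mul_le_mul_left (by linarith) hE'
  · intro h
    exact (mul_le_mul_of_nonneg_left h hE'.le).trans_eq (mul_one _)

end Represents

/-- The program. It does nothing if the expansion is too weak. -/
def colorProgram : Program :=
  .cond (.minus (.read 0 (.lit 3)) (.lit 15))
    (.seq filterProgram (.seq clusterProgram searchProgram)) .skip

/-- The number of steps of `colorProgram`. -/
def colorSteps (n g r : ℕ) : ℕ :=
  (filterSteps n r (n + 1024 * (g * g)) +
    (clusterSteps n + (3 ^ clusterBound g r * (trySteps n + 2) + 2))) + 1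

/-- The output colors most vertices if some coloring is almost constant on clusters. -/
def IsGoodOutput {n : ℕ} (G : SimpleGraph (Fin n)) (μ : Fin n → ℝ) (ψ : Fin n → Fin n → ℝ)
    (g r : ℕ) (c : ℕ → ℤ) : Prop :=
  ∃ q m, FilterParams n g r q m ∧ ∀ (χ : Fin n → Fin 3) (S B L : Finset (Fin n)),
    CoversMonochromaticEdges G χ S →
    (∀ u v, u ∉ B → v ∉ B →
      n * specDist ψ (filtered μ q m) u v ≤ 4 * (1 / (512 * (g * g))) → χ u = χ v) →
    (∀ v, v ∉ L → n * specKernel ψ (filtered μ q m) v v ≤ r * (r + 2)) →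
    n ≤ colored n c + 2 * (S.card + B.card + L.card)

/-- The right code gives every cluster the color of one of its members outside `B`. All members
outside `B` share that color, so outside `B ∪ L` the code reproduces χ and only the edges covered by
`S` remain monochromatic. -/
theorem IsClustering.covers {n K g r : ℕ} {G : SimpleGraph (Fin n)} {ctr : ℕ → ℕ} {mark : ℕ → ℤ}
    {s : Memory} {ψ : Fin n → Fin n → ℝ} {F : Fin n → ℝ} {E : ℕ} (hs : Represents ψ F E s)
    (hE : 0 < E) (hg : 0 < g) (hF0 : ∀ i, 0 ≤ F i)
    (h : IsClustering n (NormOK s n r) (Near s n g) K ctr mark)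
    (hmark : ∀ x, x < n → NormOK s n r x → mark x ≠ 0) {χ : Fin n → Fin 3}
    {S B L : Finset (Fin n)} (hS : CoversMonochromaticEdges G χ S)
    (hB : ∀ u v, u ∉ B → v ∉ B →
      n * specDist ψ F u v ≤ 4 * (1 / (512 * (g * g))) → χ u = χ v)
    (hL : ∀ v, v ∉ L → n * specKernel ψ F v v ≤ r * (r + 2)) :
    ∃ c : ℕ, c < 3 ^ K ∧ Covers n (numAdj G) (fun x => baseColor c (mark x))
      ((S ∪ (B ∪ L)).image Fin.val) := by
  classical
  have hg' : (0 : ℝ) < g := by exact_mod_cast hg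
  set dig : ℕ → Fin 3 := fun t =>
    if ht : ∃ v : Fin n, v ∉ B ∧ t < K ∧ mark v = 3 ^ t ∧ Near s n g v (ctr t) then χ ht.choose
    else 0 with hdig
  obtain ⟨c, hc, hcd⟩ := exists_ternary K dig
  refine ⟨c, hc, ?_⟩
  have hgood : ∀ v : Fin n, v ∉ B → v ∉ L → baseColor c (mark v) = (χ v : ℕ) + 1 := by
    intro v hvB hvL
    rcases h.mark_eq v v.2 with h0 | ⟨t, ht, h1, h2⟩
    · exact absurd h0 (hmark v v.2 ((hs.normOK_iff hE r v).2 (hL v hvL)))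
    · have hex : ∃ v : Fin n, v ∉ B ∧ t < K ∧ mark v = 3 ^ t ∧ Near s n g v (ctr t) :=
        ⟨v, hvB, ht, h1, h2⟩
      have hdt : dig t = χ v := by
        simp only [hdig]
        rw [dif_pos hex]
        obtain ⟨k1, -, -, k4⟩ := hex.choose_spec
        have hctr := (h.ctr_ok t ht).1
        -- The centre itself may lie in `B`, so two members are compared through it; the weak
        -- triangle inequality turns the radius 1/(512g²) into four times that value.
        refine hB _ _ k1 hvB ?_
        have d1 := (hs.near_iff hE g _ ⟨ctr t, hctr⟩).1 k4
        have d2 := (hs.near_iff hE g v ⟨ctr t, hctr⟩).1 h2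
        rw [specDist_comm] at d2
        have d3 := specDist_le ψ hF0 hex.choose ⟨ctr t, hctr⟩ v
        have d4 : (4 : ℝ) * (1 / (512 * (g * g))) = 4 / (512 * (g * g)) := by ring
        rw [d4, le_div_iff₀ (by positivity)]
        have d5 := mul_le_mul_of_nonneg_left d3
          (show (0 : ℝ) ≤ n * (512 * (g * g)) by positivity)
        linarith
      have := hcd t ht
      rw [h1, baseColor, ← hdt, ← this]
      push_cast
      rfl
  rintro x y hx hy ⟨i, j, rfl, rfl, hij⟩ hxy
  by_contra hnot
  rw [not_or] at hnot
  have hmem : ∀ v : Fin n, (v : ℕ) ∉ (S ∪ (B ∪ L)).image Fin.val → v ∉ S ∧ v ∉ B ∧ v ∉ L := by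
    intro v hv
    have : v ∉ S ∪ (B ∪ L) := fun hv' => hv (Finset.mem_image_of_mem _ hv')
    simpa [not_or] using this
  obtain ⟨i1, i2, i3⟩ := hmem i hnot.1
  obtain ⟨j1, j2, j3⟩ := hmem j hnot.2
  simp only [hgood i i2 i3, hgood j j2 j3] at hxy
  have hχ : χ i = χ j := Fin.ext (by omega)
  rcases hS i j hij hχ with h' | h'
  · exact i1 h'
  · exact j1 h'

/-- The test r ≥ 16 ensures both that q = 1 is admissible at the start of the filter and that λ < 1.
Otherwise the empty coloring, which is proper, is left in place. -/
theorem Does.colorProgram {n d p g r M : ℕ} (G : SimpleGraph (Fin n)) [DecidableRel G.Adj]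
    (hd : 0 < d) (hn : 0 < n) (hG : G.IsRegularOfDegree d) {lam : ℝ} (h0 : 0 < lam)
    (hrlam : r * lam ≤ 1) {μ : Fin n → ℝ} {ψ : Fin n → Fin n → ℝ}
    (h : IsEigensystem (normalizedAdjMatrix G d) μ ψ) {i₀ : Fin n}
    (hμ : ∀ i, i ≠ i₀ → μ i ≤ lam) (hg : 0 < g)
    (hnM : n * n ≤ M) (hrM : r ≤ M) (hKM : 2 * (n + 1024 * (g * g)) ≤ M)
    (hM : (n + 1) * scaleBound n r (n + 1024 * (g * g)) ^ 2 ≤ M)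
    (hNM : 3 ^ clusterBound g r ≤ M) (h3M : 3 ≤ M) :
    Does M colorProgram (graphInput G p g r) (colorSteps n g r) fun s =>
      IsProper n (numAdj G) (s 2) ∧ (16 ≤ r → IsGoodOutput G μ ψ g r (s 2)) := by
  have hA := isSymmStochastic_normalizedAdjMatrix G hd hG
  have hnn : n ≤ M := by nlinarith
  have hval : (Expr.minus (.read 0 (.lit 3)) (.lit 15)).value (graphInput G p g r) = r - 15 := rfl
  refine Does.cond (fun he => ?_) (fun he => ?_)
  · rw [hval] at he
    have hr16 : 16 ≤ r := by omega
    have hr16' : (16 : ℝ) ≤ r := by exact_mod_cast hr16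
    have hlam1 : lam < 1 := by nlinarith
    have hdn : d ≤ n := by
      have h1 := G.degree_lt_card_verts ⟨0, hn⟩
      rw [hG, Fintype.card_fin] at h1
      exact h1.le
    have hd' : (d : ℝ) ≠ 0 := by exact_mod_cast hd.ne'
    refine Does.seq (Does.mono (Does.frame (Does.filterProgram h hA (d := d) (g := g) rfl rfl rfl
      hr16 rfl hd hdn (graphInput_one_eq G p g r) (sum_graphInput G hn hG p g r) ?_ hnM hrM hKM hM))
      le_rfl ?_)
    · intro i j
      rw [graphInput_one G p g r i.2 j.2, specKernel, ← h.expansion]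
      simp only [normalizedAdjMatrix, Matrix.smul_apply, SimpleGraph.adjMatrix_apply, smul_eq_mul]
      split_ifs <;> simp [hd']
    rintro s₁ ⟨⟨q, m, E, hq1, hq2, hm, hE, -, hR⟩, hs₁⟩
    have hfr : ∀ b, (∀ a ∈ [3, 4, 5, 6, 7, 8, 9], b ≠ a) → s₁ b = graphInput G p g r b := by
      intro b hb
      refine hs₁ b fun hmem => ?_
      rcases mods_filterProgram b hmem with h' | h' | h' | h' | h' | h' | h' <;>
        exact hb _ (by simp) h'
    have hp : FilterParams n g r q m := ⟨hq1, hq2, hg, hm⟩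
    have hp' : FilterParams (Fintype.card (Fin n)) g r q m := by rwa [Fintype.card_fin]
    have hq0 : 0 < q := by omega
    have hbig := h.card_bigIndices_le hA h0 hlam1 hμ hq0 hq1 hrlam
    refine Does.seq (Does.mono (Does.frame (Does.clusterProgram (g := g) (r := r)
      (N := clusterBound g r) (by rw [hfr 0 (by decide)]; rfl) (by rw [hfr 0 (by decide)]; rfl)
      (by rw [hfr 0 (by decide)]; rfl) (fun x _ => by rw [hfr 10 (by decide)]; rfl)
      (by rw [hR.1]; positivity) hnn hNM ?_)) le_rfl ?_)
    · intro K ctr hctr hsep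
      -- Vertex 0 is a dummy value for addresses outside the graph; no centre with index below K has
      -- such an address.
      have hsep' : ∀ t < K, ∀ t' < K, t ≠ t' →
          1 < 512 * (g * g) * ((Fintype.card (Fin n) : ℕ) * specDist ψ (filtered μ q m)
            (if ht : ctr t < n then ⟨ctr t, ht⟩ else ⟨0, hn⟩)
            (if ht : ctr t' < n then ⟨ctr t', ht⟩ else ⟨0, hn⟩)) := by
        have key : ∀ t' < K, ∀ t < t', 1 < 512 * (g * g) * ((Fintype.card (Fin n) : ℕ) *
            specDist ψ (filtered μ q m)
            (if ht : ctr t' < n then ⟨ctr t', ht⟩ else ⟨0, hn⟩)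
            (if ht : ctr t < n then ⟨ctr t, ht⟩ else ⟨0, hn⟩)) := by
          intro t' ht' t ht
          have h1 := (hctr t' ht').1
          have h2 := (hctr t (ht.trans ht')).1
          rw [dif_pos h1, dif_pos h2, Fintype.card_fin]
          by_contra hle
          exact hsep t' ht' t ht ((hR.near_iff hE g ⟨_, h1⟩ ⟨_, h2⟩).2 (not_lt.1 hle))
        intro t ht t' ht' hne
        rcases lt_or_gt_of_ne hne with hlt | hlt
        · rw [specDist_comm]; exact key t' ht' t hlt
        · exact key t ht t' hlt
      set φ : ℕ → Fin n := fun t => if ht : ctr t < n then ⟨ctr t, ht⟩ else ⟨0, hn⟩ with hφ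
      have hinj : Set.InjOn φ (Finset.range K) := by
        intro t ht t' ht' heq
        by_contra hne
        have h1 := hsep' t (by simpa using ht) t' (by simpa using ht') hne
        change 1 < 512 * (g * g) * ((Fintype.card (Fin n) : ℕ) *
          specDist ψ (filtered μ q m) (φ t) (φ t')) at h1
        rw [heq] at h1
        simp [specDist] at h1
        linarith
      have hcard : ((Finset.range K).image φ).card = K := by
        rw [Finset.card_image_of_injOn hinj, Finset.card_range]
      rw [← hcard]
      refine h.card_centres_le hA hp' hbig ?_ ?_
      · intro u hu v hv huv
        obtain ⟨t, ht, rfl⟩ := Finset.mem_image.1 hu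
        obtain ⟨t', ht', rfl⟩ := Finset.mem_image.1 hv
        exact hsep' t (Finset.mem_range.1 ht) t' (Finset.mem_range.1 ht')
          fun h' => huv (by rw [h'])
      · intro v hv
        obtain ⟨t, ht, rfl⟩ := Finset.mem_image.1 hv
        have h1 := hctr t (Finset.mem_range.1 ht)
        have h2 : φ t = ⟨ctr t, h1.1⟩ := dif_pos h1.1
        rw [h2, Fintype.card_fin]
        exact (hR.normOK_iff hE r ⟨ctr t, h1.1⟩).1 h1.2
    rintro s₂ ⟨⟨K, ctr, hKN, h9, hcl, hmark⟩, hs₂⟩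
    have hfr₂ : ∀ b, (∀ a ∈ [3, 4, 5, 6, 7, 8, 9, 10, 15, 16], b ≠ a) →
        s₂ b = graphInput G p g r b := by
      intro b hb
      simp only [List.mem_cons, List.not_mem_nil, or_false, forall_eq_or_imp, forall_eq] at hb
      rw [hs₂ b (by simp [RAM.clusterProgram]; tauto), hfr b (by simp; tauto)]
    refine Does.mono (Does.searchProgram (adj := numAdj G) (w := 3 ^ K)
      (by rw [hfr₂ 0 (by decide)]; rfl)
      (by unfold StoresAdj; rw [hfr₂ 1 (by decide)]; exact storesAdj_graphInput G p g r)
      (numAdj_irrefl G) (by rw [h9]; push_cast; rfl) (by rw [hfr₂ 13 (by decide)]; rfl)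
      (fun x _ => by rw [hfr₂ 2 (by decide)]; rfl) hnM
      ((Nat.pow_le_pow_right (by norm_num) hKN).trans hNM) h3M) ?_ ?_
    · gcongr
      norm_num
    · rintro s ⟨hprop, hbest⟩
      refine ⟨hprop, fun _ => ⟨q, m, hp, fun χ S B L hS hB hL => ?_⟩⟩
      obtain ⟨c, hc, hcov⟩ := hcl.covers hR hE hg (fun i => (h.filtered_mem hA q m i).1) hmark hS
        hB hL
      refine (hbest c hc _ hcov).trans ?_
      have h1 : ((S ∪ (B ∪ L)).image Fin.val).card ≤ (S ∪ (B ∪ L)).card := Finset.card_image_le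
      have h2 := Finset.card_union_le S (B ∪ L)
      have h3 := Finset.card_union_le B L
      omega
  · rw [hval] at he
    refine (Does.skip ⟨⟨fun x _ => ?_, fun x _ _ _ _ _ => rfl⟩, fun h' => ?_⟩).mono
      (by unfold filterSteps; omega) fun _ h => h
    · change (0 : ℤ) ≤ 0 ∧ (0 : ℤ) ≤ 3; norm_num
    · omega

end RAM

/-! ### Running time and conclusion -/

namespace RAM

open IsEigensystem

/-- The word length that suffices for the program. -/
def wordBound (n p g r : ℕ) : ℕ :=
  (n + 2 * (n * (16 * r * (n + 1024 * (g * g)) ^ 2))) + 2 * clusterBound g r + 2 * n + r +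
    2 * (n + 1024 * (g * g)) + p + g + 2

theorem le_two_pow_of_le {x e b : ℕ} (hx : x ≤ 2 ^ e) (he : e ≤ b) : x ≤ 2 ^ b :=
  hx.trans (Nat.pow_le_pow_right (by norm_num) he)

theorem wordBound_spec (n p g r : ℕ) :
    n * n ≤ 2 ^ wordBound n p g r ∧ r ≤ 2 ^ wordBound n p g r ∧
    2 * (n + 1024 * (g * g)) ≤ 2 ^ wordBound n p g r ∧
    (n + 1) * scaleBound n r (n + 1024 * (g * g)) ^ 2 ≤ 2 ^ wordBound n p g r ∧
    3 ^ clusterBound g r ≤ 2 ^ wordBound n p g r ∧ 3 ≤ 2 ^ wordBound n p g r ∧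
    n ≤ 2 ^ wordBound n p g r ∧ p ≤ 2 ^ wordBound n p g r ∧ g ≤ 2 ^ wordBound n p g r := by
  have hlt : ∀ x : ℕ, x ≤ 2 ^ x := fun x => Nat.lt_two_pow_self.le
  refine ⟨le_two_pow_of_le (e := 2 * n) ?_ ?_, le_two_pow_of_le (hlt r) ?_,
    le_two_pow_of_le (hlt _) ?_,
    le_two_pow_of_le (e := n + 2 * (n * (16 * r * (n + 1024 * (g * g)) ^ 2))) ?_ ?_,
    le_two_pow_of_le (e := 2 * clusterBound g r) ?_ ?_,
    le_two_pow_of_le (show 3 ≤ 2 ^ 2 by norm_num) ?_, le_two_pow_of_le (hlt n) ?_,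
    le_two_pow_of_le (hlt p) ?_, le_two_pow_of_le (hlt g) ?_⟩
  · rw [two_mul, pow_add]
    exact Nat.mul_le_mul (hlt n) (hlt n)
  · unfold wordBound; omega
  · unfold wordBound; omega
  · unfold wordBound; omega
  · have h1 : n + 1 ≤ 2 ^ n := Nat.lt_two_pow_self
    have h2 : scaleBound n r (n + 1024 * (g * g)) ≤
        2 ^ (n * (16 * r * (n + 1024 * (g * g)) ^ 2)) := by
      rw [pow_mul]
      exact Nat.pow_le_pow_left (hlt n) _
    rw [pow_add, mul_comm 2 (n * _), pow_mul _ _ 2]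
    exact Nat.mul_le_mul h1 (Nat.pow_le_pow_left h2 2)
  · unfold wordBound; omega
  · rw [pow_mul]
    exact Nat.pow_le_pow_left (by norm_num) _
  · unfold wordBound; omega
  · unfold wordBound; omega
  · unfold wordBound; omega
  · unfold wordBound; omega
  · unfold wordBound; omega

/-- The coefficient of the polynomial bound for the number of steps. -/
def stepCoeff (g r : ℕ) : ℕ := 200 + 30 * r + 50 * (1 + 1024 * (g * g)) + 40 * 3 ^ clusterBound g r

/-- The degree 4 comes from bounding the number of filter rounds by K, which is linear in n, where
each round multiplies matrices in order n³ steps. -/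
theorem colorSteps_le {n : ℕ} (hn : 0 < n) (g r : ℕ) : colorSteps n g r ≤ stepCoeff g r * n ^ 4 := by
  have h01 : 1 ≤ n := hn
  have h12 : n ≤ n ^ 2 := by nlinarith
  have h23 : n ^ 2 ≤ n ^ 3 := Nat.pow_le_pow_right hn (by norm_num)
  have h34 : n ^ 3 ≤ n ^ 4 := Nat.pow_le_pow_right hn (by norm_num)
  have hm : matSteps n ≤ 19 * n ^ 3 := by
    unfold matSteps
    have : n * n * (n * 3 + 9) + 7 = 3 * n ^ 3 + 9 * n ^ 2 + 7 := by ring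
    omega
  have ht : trySteps n + 2 ≤ 35 * n ^ 4 := by
    unfold trySteps
    have : n * n = n ^ 2 := by ring
    rw [this]
    omega
  have hc : clusterSteps n ≤ 15 * n ^ 4 := by
    unfold clusterSteps
    have : n * (n * 5 + 2 + 1 + 1 + 1 + 2) = 5 * n ^ 2 + 7 * n := by ring
    rw [this]
    omega
  have hK : n + 1024 * (g * g) ≤ (1 + 1024 * (g * g)) * n := by nlinarith [Nat.zero_le (g * g)]
  have hf1 : r * (matSteps n + 1 + 1) ≤ r * (21 * n ^ 4) := Nat.mul_le_mul_left _ (by omega)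
  have hf2 : (n + 1024 * (g * g)) * (matSteps n + (matSteps n + 1) + 1) ≤
      (1 + 1024 * (g * g)) * n * (40 * n ^ 3) := Nat.mul_le_mul hK (by omega)
  have hf3 : (1 + 1024 * (g * g)) * n * (40 * n ^ 3) = (1 + 1024 * (g * g)) * (40 * n ^ 4) := by ring
  have hf : filterSteps n r (n + 1024 * (g * g)) ≤
      100 * n ^ 4 + r * (21 * n ^ 4) + (1 + 1024 * (g * g)) * (40 * n ^ 4) := by
    unfold filterSteps
    have : n * n = n ^ 2 := by ring
    rw [this]
    omega
  have hs : 3 ^ clusterBound g r * (trySteps n + 2) ≤ 3 ^ clusterBound g r * (35 * n ^ 4) :=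
    Nat.mul_le_mul_left _ ht
  unfold colorSteps stepCoeff
  have e : (200 + 30 * r + 50 * (1 + 1024 * (g * g)) + 40 * 3 ^ clusterBound g r) * n ^ 4 =
      200 * n ^ 4 + 30 * (r * n ^ 4) + 50 * ((1 + 1024 * (g * g)) * n ^ 4) +
        40 * (3 ^ clusterBound g r * n ^ 4) := by ring
  have e1 : r * (21 * n ^ 4) = 21 * (r * n ^ 4) := by ring
  have e2 : (1 + 1024 * (g * g)) * (40 * n ^ 4) = 40 * ((1 + 1024 * (g * g)) * n ^ 4) := by ring
  have e3 : 3 ^ clusterBound g r * (35 * n ^ 4) = 35 * (3 ^ clusterBound g r * n ^ 4) := by ring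
  rw [e1, e2] at hf
  rw [e3] at hs
  rw [e]
  omega

/-- The coefficient of the polynomial bound for the word length. -/
def wordCoeff (p g r : ℕ) : ℕ :=
  10 + 32 * r * (1 + 1024 * (g * g)) ^ 2 + 2 * clusterBound g r + r +
    2 * (1 + 1024 * (g * g)) + p + g

theorem wordBound_le {n : ℕ} (hn : 0 < n) (p g r : ℕ) :
    wordBound n p g r + 2 ≤ wordCoeff p g r * n ^ 3 := by
  have h1 : 1 ≤ n ^ 3 := Nat.one_le_pow _ _ hn
  have h2 : n ≤ n ^ 3 := Nat.le_self_pow (by norm_num) n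
  set κ := 1 + 1024 * (g * g) with hκ
  have hK : n + 1024 * (g * g) ≤ κ * n := by nlinarith [Nat.zero_le (g * g)]
  have h3 : 2 * (n * (16 * r * (n + 1024 * (g * g)) ^ 2)) ≤ 32 * r * κ ^ 2 * n ^ 3 := by
    calc 2 * (n * (16 * r * (n + 1024 * (g * g)) ^ 2)) ≤ 2 * (n * (16 * r * (κ * n) ^ 2)) := by gcongr
      _ = _ := by ring
  have h4 : ∀ x : ℕ, x ≤ x * n ^ 3 := fun x => Nat.le_mul_of_pos_right _ (by positivity)
  have h5 : κ * n ≤ κ * n ^ 3 := by gcongr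
  have h6 := h4 (clusterBound g r)
  have h7 := h4 r
  have h8 := h4 p
  have h9 := h4 g
  unfold wordBound wordCoeff
  rw [← hκ]
  have e : (10 + 32 * r * κ ^ 2 + 2 * clusterBound g r + r + 2 * κ + p + g) * n ^ 3 =
      10 * n ^ 3 + 32 * r * κ ^ 2 * n ^ 3 + 2 * (clusterBound g r * n ^ 3) + r * n ^ 3 +
        2 * (κ * n ^ 3) + p * n ^ 3 + g * n ^ 3 := by ring
  rw [e]
  omega

/-- The coefficient of the polynomial bound for the running time. -/
def timeCoeff (p g r : ℕ) : ℕ := stepCoeff g r * (colorProgram.weight * wordCoeff p g r)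

/-- The exponent 7 is 4 for the steps plus 3 for the word length: the scale is n to a power of order
n², and `wordBound` bounds the bit length of its base crudely by n. -/
theorem time_le {n : ℕ} (hn : 0 < n) (p g r : ℕ) :
    colorSteps n g r * (colorProgram.weight * (Nat.size (2 ^ wordBound n p g r) + 1)) ≤
      timeCoeff p g r * n ^ 7 := by
  rw [Nat.size_pow]
  calc colorSteps n g r * (colorProgram.weight * (wordBound n p g r + 1 + 1))
      ≤ stepCoeff g r * n ^ 4 * (colorProgram.weight * (wordCoeff p g r * n ^ 3)) := by
        gcongr
        · exact colorSteps_le hn g r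
        · exact wordBound_le hn p g r
    _ = _ := by unfold timeCoeff; ring

theorem isPartialColoring_outputSets {n : ℕ} {G : SimpleGraph (Fin n)} {s : Memory} {ε : ℝ}
    (hs : IsProper n (numAdj G) (s 2)) (hcov : (1 - ε) * n ≤ colored n (s 2)) :
    IsPartialColoring G 3 ε (outputSets n 3 s) := by
  refine ⟨fun a b hab => ?_, fun a => ?_, ?_⟩
  · rw [Finset.disjoint_left]
    intro x hx hx'
    simp only [outputSets, Finset.mem_filter, Finset.mem_univ, true_and] at hx hx'
    exact hab (Fin.ext (by omega))
  · intro x hx y hy _ hadj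
    simp only [outputSets, Finset.coe_filter, Finset.mem_univ, true_and, Set.mem_ofPred_eq] at hx hy
    have := hs.2 x y x.2 y.2 ⟨x, y, rfl, rfl, hadj⟩ (by rw [hx, hy])
    omega
  · rw [Fintype.card_fin]
    refine hcov.trans ?_
    rw [Nat.cast_le]
    have h1 : ((Finset.range n).filter fun x => s 2 x ≠ 0) ⊆
        (Finset.univ.biUnion (outputSets n 3 s)).map Fin.valEmbedding := by
      intro x hx
      rw [Finset.mem_filter, Finset.mem_range] at hx
      rw [Finset.mem_map]
      refine ⟨⟨x, hx.1⟩, ?_, rfl⟩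
      rw [Finset.mem_biUnion]
      have h2 := hs.1 x hx.1
      refine ⟨⟨(s 2 x - 1).toNat, by omega⟩, Finset.mem_univ _, ?_⟩
      simp only [outputSets, Finset.mem_filter, Finset.mem_univ, true_and]
      omega
    refine (Finset.card_le_card h1).trans ?_
    rw [Finset.card_map]

end RAM

open IsEigensystem in
/-- A good output leaves few vertices uncolored. -/
theorem RAM.IsGoodOutput.le_colored {n d g r : ℕ} {G : SimpleGraph (Fin n)} [DecidableRel G.Adj]
    (hd : 0 < d) (hn : 0 < n) (hG : G.IsRegularOfDegree d) {δ γ lam : ℝ} (hγ0 : 0 < γ)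
    (hlam0 : 0 < lam) (hg : 0 < g) (hgγ : 1 ≤ g * γ) (hγ1 : γ ≤ 1) (hr : 16 ≤ r)
    (hrlam : r * lam ≤ 1) (hrlam' : 1 ≤ (r + 1) * lam) {μ : Fin n → ℝ} {ψ : Fin n → Fin n → ℝ}
    (h : IsEigensystem (normalizedAdjMatrix G d) μ ψ) {i₀ : Fin n}
    (hμ : ∀ i, i ≠ i₀ → μ i ≤ lam) {χ : Fin n → Fin 3} {S : Finset (Fin n)}
    (hS : CoversMonochromaticEdges G χ S) (hSδ : (S.card : ℝ) ≤ δ * n)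
    (hχ : ∀ a, ((Finset.univ.filter fun x => χ x = a).card : ℝ) ≤ (1 / 2 - γ) * n)
    {c : ℕ → ℤ} (hc : IsGoodOutput G μ ψ g r c) :
    (n : ℝ) ≤ colored n c + 300000 * (lam / γ ^ 2 + δ / γ) * n := by
  obtain ⟨q, m, hp, hc⟩ := hc
  have hA := isSymmStochastic_normalizedAdjMatrix G hd hG
  have hr' : (16 : ℝ) ≤ r := by exact_mod_cast hr
  have hn' : (0 : ℝ) < n := by exact_mod_cast hn
  have hg' : (0 : ℝ) < g := by exact_mod_cast hg
  have hlam1 : lam < 1 := by nlinarith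
  have hqr := hp.q_le
  have hrq := hp.lt_q
  have hq0 : 0 < q := by omega
  have hq' : (0 : ℝ) < q := by exact_mod_cast hq0
  have hrq' : (r : ℝ) ≤ 32 * q := by exact_mod_cast hrq.le
  have hbig := h.card_bigIndices_le hA hlam0 hlam1 hμ hq0 hqr hrlam
  have : Nonempty (Fin n) := ⟨⟨0, hn⟩⟩
  have hcard : ((Fintype.card (Fin n) : ℕ) : ℝ) = n := by rw [Fintype.card_fin]
  obtain ⟨B, hB1, hB2⟩ := h.exists_bad_set (γ := γ) (σ := 2 / q) (η := 1 / (512 * (g * g)))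
    (F := filtered μ q m) (χ := χ) (S := S) hA hlam0.le
    (by positivity) hγ0 (h.quadratic_le_of_eigenvalue_le hA hlam0.le hlam1 hμ)
    (fun i => (h.filtered_mem hA q m i).1) (fun i => h.filtered_large hA hq0 m i)
    (fun u v huv hcol => hS u v (by
      by_contra hnot
      exact huv (by simp [normalizedAdjMatrix, hnot])) hcol)
    (fun a => by rw [hcard]; exact hχ a) (by
      have h1 : 1 ≤ (g * g : ℝ) * γ ^ 2 := by nlinarith
      rw [mul_one_div, div_le_iff₀ (by positivity)]
      linarith)
  rw [hcard] at hB1 hB2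
  set L : Finset (Fin n) := Finset.univ.filter fun v =>
    (r * (r + 2) : ℝ) < n * specKernel ψ (filtered μ q m) v v with hL
  have hp' : FilterParams (Fintype.card (Fin n)) g r q m := by rwa [Fintype.card_fin]
  have hLcard := h.card_large_norm_mul_le hA hp' hbig (T := L) (fun v hv => by
    simp only [hL, Finset.mem_filter, Finset.mem_univ, true_and] at hv
    rw [hcard]; exact hv.le)
  rw [hcard] at hLcard
  have hfin := hc χ S B L hS (fun u v hu hv hd => hB2 u v hu hv hd) (fun v hv => by
    simp only [hL, Finset.mem_filter, Finset.mem_univ, true_and, not_lt] at hv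
    exact hv)
  have hfin' : (n : ℝ) ≤ colored n c + 2 * (S.card + B.card + L.card) := by exact_mod_cast hfin
  have hδ0 : 0 ≤ δ * n := le_trans (Nat.cast_nonneg _) hSδ
  have hγinv : 1 ≤ 1 / γ := by rw [le_div_iff₀ hγ0]; linarith
  have hγinv2 : 1 / γ ≤ 1 / γ ^ 2 := by
    apply one_div_le_one_div_of_le (by positivity)
    nlinarith
  have b1 : 16 * (S.card : ℝ) / γ ≤ 16 * (δ / γ * n) := by
    rw [div_le_iff₀ hγ0]
    have : 16 * (δ / γ * n) * γ = 16 * (δ * n) := by field_simp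
    linarith
  have hx : lam * n * 1 ≤ lam * n * (1 / γ) := by gcongr
  have hx2 : lam * n * (1 / γ) ≤ lam * n * (1 / γ ^ 2) := by gcongr
  have e0 : lam / γ ^ 2 * n = lam * n * (1 / γ ^ 2) := by ring
  have b2 : 18 * lam * n / γ ≤ 18 * (lam / γ ^ 2 * n) := by
    have : 18 * lam * n / γ = 18 * (lam * n * (1 / γ)) := by ring
    rw [this, e0]
    linarith
  -- From 1 ≤ (r + 1)λ ≤ 2rλ and r ≤ 32q.
  have hqlam : 1 / q ≤ 64 * lam := by
    rw [div_le_iff₀ hq']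
    nlinarith
  have b3 : 1024 * (2 / q) * n / γ ^ 2 ≤ 131072 * (lam / γ ^ 2 * n) := by
    have : 1024 * (2 / q) * n / γ ^ 2 = 2048 * (1 / q) * (n / γ ^ 2) := by ring
    rw [this]
    calc 2048 * (1 / q) * (n / γ ^ 2) ≤ 2048 * (64 * lam) * (n / γ ^ 2) := by gcongr
      _ = _ := by ring
  have b4 : (L.card : ℝ) ≤ 2 * (lam / γ ^ 2 * n) := by
    have h1 : (L.card : ℝ) ≤ 2 * lam * n := by
      have h2 : (L.card : ℝ) * 1 ≤ L.card * (2 * r * lam) := by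
        gcongr
        nlinarith
      nlinarith [mul_le_mul_of_nonneg_right hLcard hlam0.le]
    rw [e0]
    linarith
  have b5 : (S.card : ℝ) ≤ δ / γ * n := by
    have h1 : δ * n * 1 ≤ δ * n * (1 / γ) := by gcongr
    have : δ / γ * n = δ * n * (1 / γ) := by ring
    linarith
  -- After the factor 2, the terms with λ/γ² have coefficient 2(18 + 131072 + 2) and those with δ/γ
  -- have 2(16 + 1), so 300000 suffices.
  have hfinal : 300000 * (lam / γ ^ 2 + δ / γ) * n =
      300000 * (lam / γ ^ 2 * n) + 300000 * (δ / γ * n) := by ring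
  have hpos1 : 0 ≤ lam / γ ^ 2 * n := by positivity
  have hpos2 : 0 ≤ δ / γ * n := le_trans (Nat.cast_nonneg _) b5
  linarith

theorem mainTheorem3 :
    ∃ (P : RAM.Program) (c : ℕ) (C : ℝ) (T : ℝ → ℝ → ℝ → ℝ),
      ∀ (δ γ lam : ℝ), 0 < δ → 0 < γ → 0 < lam →
      ∀ (n d : ℕ) (hn : 2 ≤ n), 0 < d →
      ∀ (G : SimpleGraph (Fin n)) [DecidableRel G.Adj], G.IsRegularOfDegree d →
        secondEigenvalue G d (hn.trans_eq (Fintype.card_fin n).symm) ≤ lam →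
      ∀ (χ : Fin n → Fin 3),
        (∃ S : Finset (Fin n), CoversMonochromaticEdges G χ S ∧ (S.card : ℝ) ≤ δ * n) →
        (∀ a : Fin 3,
          1 / (n : ℝ) * ((Finset.univ.filter fun x : Fin n => χ x = a).card : ℝ) ≤ 1 / 2 - γ) →
        ∃ (s : RAM.Memory) (t : ℕ),
          RAM.Runs P (graphInput G ⌊1 / δ⌋₊ ⌈1 / γ⌉₊ ⌊1 / lam⌋₊) s t ∧
          (t : ℝ) ≤ T δ γ lam * (n : ℝ) ^ c ∧
          IsPartialColoring G 3 (C * (lam / γ ^ 8 + δ / (lam * γ ^ 8))) (outputSets n 3 s) := by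
  refine ⟨RAM.colorProgram, 7, 300000,
    fun δ γ lam => (RAM.timeCoeff ⌊1 / δ⌋₊ ⌈1 / γ⌉₊ ⌊1 / lam⌋₊ : ℝ), ?_⟩
  rintro δ γ lam hδ hγ hlam n d hn2 hd G _ hG hsec χ ⟨S, hS, hSδ⟩ hχ
  have hn : 0 < n := by omega
  have hn' : (0 : ℝ) < n := by exact_mod_cast hn
  set p := ⌊1 / δ⌋₊
  set g := ⌈1 / γ⌉₊ with hg
  set r := ⌊1 / lam⌋₊ with hr
  have hg0 : 0 < g := Nat.ceil_pos.2 (by positivity)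
  have hgγ : 1 ≤ g * γ := by
    have := Nat.le_ceil (1 / γ)
    rwa [div_le_iff₀ hγ] at this
  have hrlam : r * lam ≤ 1 := by
    have := Nat.floor_le (show 0 ≤ 1 / lam by positivity)
    rwa [le_div_iff₀ hlam] at this
  have hrlam' : 1 ≤ (r + 1) * lam := by
    have := (Nat.lt_floor_add_one (1 / lam)).le
    rwa [div_le_iff₀ hlam] at this
  have hχ' : ∀ a, ((Finset.univ.filter fun x => χ x = a).card : ℝ) ≤ (1 / 2 - γ) * n := by
    intro a
    have := hχ a
    rwa [one_div, inv_mul_le_iff₀ hn', mul_comm (n : ℝ)] at this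
  -- The size of a color class is nonnegative, so γ ≤ 1/2 is forced.
  have hγ1 : γ ≤ 1 := by
    have h1 : (0 : ℝ) ≤ 1 / n * ((Finset.univ.filter fun x : Fin n => χ x = 0).card : ℝ) := by
      positivity
    linarith [hχ 0]
  obtain ⟨i₀, hμ⟩ := exists_eigenvalues_le G _ hsec
  have h := (normalizedAdjMatrix_isHermitian G d).exists_isEigensystem
  obtain ⟨w1, w2, w3, w4, w5, w6, w7, w8, w9⟩ := RAM.wordBound_spec n p g r
  obtain ⟨s, k, hexec, hk, hprop, hgood⟩ := RAM.Does.colorProgram (p := p) G hd hn hG hlam hrlam h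
    hμ hg0 w1 w2 w3 w4 w5 w6
  obtain ⟨-, t, ht, htk⟩ := hexec.runs (graphInput_bounded G w7 w8 w9 w2 Nat.one_le_two_pow)
  refine ⟨s, t, ht, ?_, RAM.isPartialColoring_outputSets hprop ?_⟩
  · have h1 : t ≤ RAM.timeCoeff p g r * n ^ 7 :=
      (htk.trans (Nat.mul_le_mul_right _ hk)).trans (RAM.time_le hn p g r)
    change (t : ℝ) ≤ (RAM.timeCoeff p g r : ℝ) * (n : ℝ) ^ 7
    exact_mod_cast h1
  · have hX : 1 ≤ 1 / γ ^ 8 := by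
      rw [le_div_iff₀ (by positivity), one_mul]
      exact pow_le_one₀ hγ.le hγ1
    have hrest : 0 ≤ δ / (lam * γ ^ 8) := by positivity
    have hlamX : lam ≤ lam / γ ^ 8 := by
      rw [div_eq_mul_one_div]
      exact le_mul_of_one_le_right hlam.le hX
    by_cases hr16 : 16 ≤ r
    · have hmain := (hgood hr16).le_colored hd hn hG hγ hlam hg0 hgγ hγ1 hr16 hrlam hrlam' h hμ hS
        hSδ hχ'
      have hlam1 : lam ≤ 1 := by
        have : (16 : ℝ) ≤ r := by exact_mod_cast hr16
        nlinarith
      have c1 : lam / γ ^ 2 ≤ lam / γ ^ 8 := by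
        apply div_le_div_of_nonneg_left hlam.le (by positivity)
        exact pow_le_pow_of_le_one hγ.le hγ1 (by norm_num)
      have c2 : δ / γ ≤ δ / (lam * γ ^ 8) := by
        apply div_le_div_of_nonneg_left hδ.le (by positivity)
        calc lam * γ ^ 8 ≤ 1 * γ ^ 1 := by
              gcongr ?_ * ?_
              exact pow_le_pow_of_le_one hγ.le hγ1 (by norm_num)
          _ = γ := by ring
      have c3 : 300000 * (lam / γ ^ 2 + δ / γ) * n ≤
          300000 * (lam / γ ^ 8 + δ / (lam * γ ^ 8)) * n := by gcongr
      linarith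
    -- Here λ ≥ 1/16, so the allowed fraction of uncolored vertices exceeds 1 and any proper partial
    -- coloring will do.
    · have hr15 : (r : ℝ) + 1 ≤ 16 := by exact_mod_cast (by omega : r + 1 ≤ 16)
      have hlam16 : 1 ≤ 16 * lam := by nlinarith
      have hneg : (1 - 300000 * (lam / γ ^ 8 + δ / (lam * γ ^ 8))) * (n : ℝ) ≤ 0 := by
        apply mul_nonpos_of_nonpos_of_nonneg _ hn'.le
        linarith
      exact hneg.trans (Nat.cast_nonneg _)
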